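/- **Corollary 2.2.** *Data.* For every $N\ge 1$ let $\{\varepsilon_t\}_{t\in\mathbb Z}$ be i.i.d. random vectors in $\mathbb R^N$, let $\{\varepsilon_t'\}_{t\in\mathbb Z}$ be an independent copy of this sequence, let $g=g_N$ be a measurable function, and let $U_t=(u_{1t},\dots,u_{Nt})^\top=g(\varepsilon_t,\varepsilon_{t-1},\dots)$ with $E[U_t]=0$. For $m\ge 0$ let $U_t^{(m,*)}=g(\varepsilon_t,\dots,\varepsilon_{t-m+1},\varepsilon'_{t-m},\varepsilon'_{t-m-1},\dots)$. For every $(N,T)$ only the units $i$ in a nonrandom set $D_t=D_{N,T,t}\subseteq\{1,\dots,N\}$ with $N_t$ elements are observed at date $t\in\{1,\dots,T\}$. Put $$\mathbb N=\sum_{t=1}^T N_t,\qquad \overline N=\max_{1\le t\le T}N_t,\qquad \overline U_t=\frac1{\sqrt{N_t}}\sum_{i\in D_t}u_{it},\qquad \overline U_t^{(m,*)}=\frac1{\sqrt{N_t}}\sum_{i\in D_t}u_{it}^{(m,*)}$$ (read as $0$ if $N_t=0$), $\lambda_{m,\delta}(t)=\big(E|\overline U_t-\overline U_t^{(m,*)}|^\delta\big)^{1/\delta}$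 and $$S_{\mathbb N}=\frac1{\sqrt{\mathbb N}}\sum_{t=1}^T\sum_{i\in D_t}u_{it}.$$ *Bootstrap.* For every $(N,T)$ let $\xi_1,\dots,\xi_T$ be random variables, independent of the data, and put $$S^*_{\mathbb N}=\frac1{\sqrt{\mathbb N}}\sum_{t=1}^T\Big(\sum_{i\in D_t}u_{it}\Big)\xi_t .$$ $\Pr^*$ denotes probability with respect to $(\xi_t)$, with the data held fixed. Assume the following, where all limits are as $(N,T)\to(\infty,\infty)$ jointly. 1. For some $\delta\ge 4$ there is a constant $C$ such that for all large $N$ and $T$, and for all $t\in\{1,\dots,T\}$, $\;\lambda_{0,\delta}(t)+\sum_{m=0}^\infty m^2\lambda_{m,\delta}(t)\le C$. Moreover $\liminf E[S_{\mathbb N}^2]>0$. 2. There are bandwidths $\ell=\ell_{N,T}>0$ with $\ell\to\infty$ and $\ell/T\to0$ such that $(\xi_t)$ is $\ell$-dependent (for every $k$, the variables $(\xi_t)_{t\le k}$ are independent of $(\xi_t)_{t>k+\ell}$), $E[\xi_t]=0$, $E[\xi_t^2]=1$, $E[\xi_t^4]\le M$ for a constant $M$ not depending on $t,N,T$, and $E[\xi_t\xi_s]=a\big(\frac{t-s}{\ell}\big)$.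 Here $a:\mathbb R\to\mathbb R$ is an even function vanishing outside $[-1,1]$ and Lipschitz continuous on $[-1,1]$, with $a(0)=1$ and $\int_{-\infty}^\infty a(u)e^{-iux}\,du\ge0$ for all $x\in\mathbb R$. 3. $\overline N T/\mathbb N\to c$ for some $c\in(0,\infty)$. Then $$\sup_{w\in\mathbb R}\big|\textstyle\Pr^*(S^*_{\mathbb N}\le w)-\Pr(S_{\mathbb N}\le w)\big|\longrightarrow 0\quad\text{in probability as }(N,T)\to(\infty,\infty).$$ -/

import Mathlib

open MeasureTheory ProbabilityTheory Filter Topology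
open scoped ENNReal NNReal

noncomputable section

namespace DWB

/-! ### The data generating mechanism -/

section Innovations

variable {Ω : Type*} {N : ℕ}

/-- The cross-sectional vector `U_t = g(ε_t, ε_{t-1}, …)`. The argument of `g` is the sequence of
innovations listed from the present into the past. -/
def crossSection (g : (ℕ → Fin N → ℝ) → Fin N → ℝ) (ε : ℤ → Ω → Fin N → ℝ) (t : ℤ) (ω : Ω) :
    Fin N → ℝ :=
  g fun k : ℕ => ε (t - k) ω

/-- The coupled vector `U_t^{(m,*)} = g(ε_t, …, ε_{t-m+1}, εc_{t-m}, εc_{t-m-1}, …)`: the `m` most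
recent innovations are kept and all older ones are replaced by those of the copy `εc`.
For `m = t` this is `U_t^* = g(ε_t, …, ε_1, εc_0, εc_{-1}, …)`. -/
def coupledCrossSection (g : (ℕ → Fin N → ℝ) → Fin N → ℝ) (ε εc : ℤ → Ω → Fin N → ℝ) (m : ℕ) (t : ℤ)
    (ω : Ω) : Fin N → ℝ :=
  g fun k : ℕ => if k < m then ε (t - k) ω else εc (t - k) ω

/-- The normalised cross-sectional sum `(#D)^{-1/2} ∑_{i ∈ D} u_i` over the set `D` of observed
units. It is `0` if nothing is observed. -/
def normalizedSum (D : Finset (Fin N)) (u : Fin N → ℝ) : ℝ :=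
  (Real.sqrt (D.card : ℝ))⁻¹ * ∑ i ∈ D, u i

/-- The dependence coefficient `λ_{m,δ} = ‖Ū_t - Ū_t^{(m,*)}‖_δ`, where `D` is the set of units
observed at time `t`. -/
def depCoeff [MeasurableSpace Ω] (P : Measure Ω) (g : (ℕ → Fin N → ℝ) → Fin N → ℝ)
    (ε εc : ℤ → Ω → Fin N → ℝ) (δ : ℝ) (D : Finset (Fin N)) (t : ℤ) (m : ℕ) : ℝ≥0∞ :=
  eLpNorm (fun ω => normalizedSum D (crossSection g ε t ω)
    - normalizedSum D (coupledCrossSection g ε εc m t ω)) (ENNReal.ofReal δ) P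

end Innovations

/-! ### The unbalanced panel

`D N T t` is the set of the units `i ∈ {1, …, N}` that are observed at the date with index
`t : Fin T`; that date is `t + 1 ∈ {1, …, T}`. -/

/-- The date `t + 1` in `{1, …, T}` with index `t : Fin T`. -/
def date {T : ℕ} (t : Fin T) : ℤ := (t : ℕ) + 1

/-- The total number of observations `∑_t N_t`. -/
def totalObs {N T : ℕ} (D : Fin T → Finset (Fin N)) : ℕ := ∑ t, (D t).card

/-- The largest cross-section `max_t N_t`. -/
def maxObs {N T : ℕ} (D : Fin T → Finset (Fin N)) : ℕ := Finset.univ.sup fun t => (D t).card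

/-- `S = (∑_t N_t)^{-1/2} ∑_t ∑_{i observed at t} u_{it}`. -/
def panelSum {Ω : Type*} {N T : ℕ} (g : (ℕ → Fin N → ℝ) → Fin N → ℝ) (ε : ℤ → Ω → Fin N → ℝ)
    (D : Fin T → Finset (Fin N)) (ω : Ω) : ℝ :=
  (Real.sqrt (totalObs D : ℝ))⁻¹ * ∑ t, ∑ i ∈ D t, crossSection g ε (date t) ω i

/-- The bootstrap version
`S^* = (∑_t N_t)^{-1/2} ∑_t (∑_{i observed at t} u_{it}) ξ_t`, a function of the data `ω` and of the
bootstrap draw `ω'`. -/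
def bootSum {Ω Ω' : Type*} {N T : ℕ} (g : (ℕ → Fin N → ℝ) → Fin N → ℝ) (ε : ℤ → Ω → Fin N → ℝ)
    (D : Fin T → Finset (Fin N)) (ξ : Fin T → Ω' → ℝ) (ω : Ω) (ω' : Ω') : ℝ :=
  (Real.sqrt (totalObs D : ℝ))⁻¹ *
    ∑ t, (∑ i ∈ D t, crossSection g ε (date t) ω i) * ξ t ω'

/-! ### The assumptions -/

/-- For every `N` the innovations are i.i.d. random vectors in `ℝ^N`, `εc N` is an independent copy of
the whole sequence `ε N`, the function `g N` is measurable and `E[U_t] = 0`; and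
`λ_{0,δ} + ∑_m m² λ_{m,δ} = O(1)` as `(N, T) → (∞, ∞)`, uniformly over the dates `t` of the panel. -/
structure WeakDependence {Ω : Type*} [MeasurableSpace Ω] (P : Measure Ω)
    (g : ∀ N : ℕ, (ℕ → Fin N → ℝ) → Fin N → ℝ) (ε εc : ∀ N : ℕ, ℤ → Ω → Fin N → ℝ)
    (D : ∀ N T : ℕ, Fin T → Finset (Fin N)) (δ : ℝ) : Prop where
  measurable_g : ∀ N, Measurable (g N)
  measurable_innovation : ∀ N t, Measurable (ε N t)
  measurable_copy : ∀ N t, Measurable (εc N t)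
  indep : ∀ N, iIndepFun (ε N) P
  identDistrib : ∀ N t, IdentDistrib (ε N t) (ε N 0) P P
  copy_indep : ∀ N, IndepFun (fun ω t => ε N t ω) (fun ω t => εc N t ω) P
  copy_law : ∀ N, IdentDistrib (fun ω t => εc N t ω) (fun ω t => ε N t ω) P P
  integrable : ∀ N t i, Integrable (fun ω => crossSection (g N) (ε N) t ω i) P
  mean_zero : ∀ N t i, ∫ ω, crossSection (g N) (ε N) t ω i ∂P = 0
  four_le : 4 ≤ δ
  summable : ∃ C : ℝ≥0, ∀ᶠ p : ℕ × ℕ in atTop ×ˢ atTop, ∀ t : Fin p.2,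
    depCoeff P (g p.1) (ε p.1) (εc p.1) δ (D p.1 p.2 t) (date t) 0
      + ∑' m : ℕ, (m : ℝ≥0∞) ^ 2 *
          depCoeff P (g p.1) (ε p.1) (εc p.1) δ (D p.1 p.2 t) (date t) m ≤ C

/-- The asymptotic variance does not degenerate: `liminf E[S²] > 0` as `(N, T) → (∞, ∞)`. -/
def NondegenerateVariance {Ω : Type*} [MeasurableSpace Ω] (P : Measure Ω)
    (g : ∀ N : ℕ, (ℕ → Fin N → ℝ) → Fin N → ℝ) (ε : ∀ N : ℕ, ℤ → Ω → Fin N → ℝ)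
    (D : ∀ N T : ℕ, Fin T → Finset (Fin N)) : Prop :=
  ∃ v : ℝ, 0 < v ∧ ∀ᶠ p : ℕ × ℕ in atTop ×ˢ atTop,
    v ≤ ∫ ω, panelSum (g p.1) (ε p.1) (D p.1 p.2) ω ^ 2 ∂P

/-- The Fourier transform `K_a(x) = ∫ a(u) e^{-iux} du`. -/
def kernelTransform (a : ℝ → ℝ) (x : ℝ) : ℂ :=
  ∫ u : ℝ, (a u : ℂ) * Complex.exp (-(Complex.I * u * x))

/-- A symmetric kernel on `[-1, 1]` (extended by `0` to the real line), Lipschitz on `[-1, 1]`, with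
`a(0) = 1` and `K_a ≥ 0`. As `a` is even, `K_a` is real valued. -/
structure IsBootstrapKernel (a : ℝ → ℝ) : Prop where
  symm : ∀ x, a (-x) = a x
  support : ∀ x, 1 < |x| → a x = 0
  lipschitz : ∃ K : ℝ≥0, LipschitzOnWith K a (Set.Icc (-1) 1)
  at_zero : a 0 = 1
  transform_nonneg : ∀ x, 0 ≤ (kernelTransform a x).re

/-- `ξ` is `ℓ`-dependent: for every date `k`, the variables up to `k` are jointly independent of those
after `k + ℓ`. -/
def IsLDependent {Ω' : Type*} [MeasurableSpace Ω'] (P' : Measure Ω') {T : ℕ} (ℓ : ℝ)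
    (ξ : Fin T → Ω' → ℝ) : Prop :=
  ∀ k : Fin T, IndepFun
    (fun ω' (s : {s : Fin T // s ≤ k}) => ξ s ω')
    (fun ω' (s : {s : Fin T // ((k : ℕ) : ℝ) + ℓ < ((s : ℕ) : ℝ)}) => ξ s ω') P'

/-- The bootstrap weights: for all `N`, `T` the weights `ξ N T` form an `ℓ`-dependent series with mean
`0`, variance `1`, autocovariances `a((t - s)/ℓ)` and bounded fourth moments, where `ℓ → ∞` and
`ℓ/T → 0` as `(N, T) → (∞, ∞)`. -/
structure BootstrapWeights {Ω' : Type*} [MeasurableSpace Ω'] (P' : Measure Ω') (a : ℝ → ℝ)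
    (ℓ : ℕ → ℕ → ℝ) (ξ : ∀ _N T : ℕ, Fin T → Ω' → ℝ) : Prop where
  kernel : IsBootstrapKernel a
  bandwidth_pos : ∀ N T, 0 < ℓ N T
  bandwidth_atTop : Tendsto (fun p : ℕ × ℕ => ℓ p.1 p.2) (atTop ×ˢ atTop) atTop
  bandwidth_small : Tendsto (fun p : ℕ × ℕ => ℓ p.1 p.2 / (p.2 : ℝ)) (atTop ×ˢ atTop) (𝓝 0)
  measurable : ∀ N T t, Measurable (ξ N T t)
  lDependent : ∀ N T, IsLDependent P' (ℓ N T) (ξ N T)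
  mean_zero : ∀ N T t, ∫ ω', ξ N T t ω' ∂P' = 0
  variance_one : ∀ N T t, ∫ ω', ξ N T t ω' ^ 2 ∂P' = 1
  memLp_four : ∀ N T t, MemLp (ξ N T t) 4 P'
  fourth_moment : ∃ M : ℝ, ∀ N T t, ∫ ω', ξ N T t ω' ^ 4 ∂P' ≤ M
  covariance : ∀ N T (t s : Fin T), ∫ ω', ξ N T t ω' * ξ N T s ω' ∂P'
    = a ((((t : ℕ) : ℝ) - ((s : ℕ) : ℝ)) / ℓ N T)

/-- `max_t N_t · T / ∑_t N_t → c ∈ (0, ∞)` as `(N, T) → (∞, ∞)`. -/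
def BalancedInTheLimit (D : ∀ N T : ℕ, Fin T → Finset (Fin N)) (c : ℝ) : Prop :=
  0 < c ∧ Tendsto
    (fun p : ℕ × ℕ => (maxObs (D p.1 p.2) : ℝ) * (p.2 : ℝ) / (totalObs (D p.1 p.2) : ℝ))
    (atTop ×ˢ atTop) (𝓝 c)

/-! ### The distributions -/

/-- `Pr(S ≤ w)`. -/
def panelCDF {Ω : Type*} [MeasurableSpace Ω] (P : Measure Ω) {N T : ℕ}
    (g : (ℕ → Fin N → ℝ) → Fin N → ℝ) (ε : ℤ → Ω → Fin N → ℝ) (D : Fin T → Finset (Fin N))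
    (w : ℝ) : ℝ :=
  P.real {ω | panelSum g ε D ω ≤ w}

/-- `Pr^*(S^* ≤ w)`: the probability over the bootstrap draw `ω'`, with the data `ω` held fixed. -/
def bootCDF {Ω Ω' : Type*} [MeasurableSpace Ω'] (P' : Measure Ω') {N T : ℕ}
    (g : (ℕ → Fin N → ℝ) → Fin N → ℝ) (ε : ℤ → Ω → Fin N → ℝ) (D : Fin T → Finset (Fin N))
    (ξ : Fin T → Ω' → ℝ) (ω : Ω) (w : ℝ) : ℝ :=
  P'.real {ω' | bootSum g ε D ξ ω ω' ≤ w}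

end DWB

end

/-!
# Consistency of the dependent wild bootstrap for unbalanced panels

Both the panel sum and, conditionally on the data, its bootstrap version are shown to be close in
law to a centred Gaussian variable with the *same* deterministic variance. The panel sum is
`S = ∑ t, w t * X t`, where `X t` is the normalised cross-sectional sum at date `t` and the weights
`w t` are of order `T^{-1/2}` because the panel is balanced in the limit; the bootstrap version is
`∑ t, w t * X t * ξ t`.

*Dependence.* The moment assumptions say that `X t` lies within `K (m + 1)⁻²`, in `L⁴`, of a variable
that is independent of the innovations at least `m` dates old (`CoupledProcess`,
`DWB.WeakDependence.coupledProcess`; the bound on `X t` itself is the case in which all innovations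
are replaced). This gives summable covariances and, by repeatedly halving an interval, a fourth moment
of order `n²` for a weighted sum over `n` dates.

*Blocks.* The dates are cut into big blocks of length `L`, separated by gaps of length `q`, with
`ℓ ≤ q`, `T^{1/2} ≤ q` and `q ≪ L ≪ T` (`exists_blockScheme`). The gaps are negligible in `L²`. After
decoupling, the block sums of the data are independent up to a small error, and since `q ≥ ℓ` the
conditional block sums of the bootstrap are independent exactly. A Lindeberg comparison of
characteristic functions (`norm_expChar_sum_sub_exp_le`) therefore applies to both sums: to the data
with the variance `blockVariance` (`CoupledProcess.norm_expChar_sum_range_sub_exp_le`), and to the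
bootstrap, for every fixed realisation of the data, with the sum of the conditional block variances.

*Concentration.* These conditional variances are quadratic forms in the data with coefficients
`E[ξ t ξ s] = a((t - s)/ℓ)`. Their expectation approaches `blockVariance` because
`|a(u) - 1| ≤ A |u|^{1/2}` and `∑ k^{1/2} (k + 1)⁻² < ∞`, and their fluctuations are small because
they are nearly independent over the blocks (`integral_abs_conditional_variance_sub_le`). By Markov's
inequality the conditional characteristic function is thus close to the Gaussian one outside of
an event of vanishing probability (`BlockScheme.tendsto_measure_conditional`).

*Conclusion.* As `E[S²]` is bounded away from `0`, so is `blockVariance`. For Gaussian limits with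
variances in a compact subset of `(0, ∞)`, closeness of characteristic functions controls the
Kolmogorov distance uniformly (`exists_kolmogorov_le_of_charFun`, from Lévy's continuity theorem and
Pólya's theorem), and the triangle inequality compares the two distribution functions.
-/

/-! ### From characteristic functions to distribution functions -/

section Kolmogorov

/-- Pólya's theorem: weak convergence to a law without atoms makes the distribution functions
converge uniformly. -/
theorem eventually_abs_measureReal_Iic_sub_le {ι : Type*} {l : Filter ι}
    {μ : ι → ProbabilityMeasure ℝ} {γ : ProbabilityMeasure ℝ} [NullSingletonClass (γ : Measure ℝ)]
    (h : Tendsto μ l (𝓝 γ)) {η : ℝ} (hη : 0 < η) :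
    ∀ᶠ n in l, ∀ w : ℝ,
      |(μ n : Measure ℝ).real (Set.Iic w) - (γ : Measure ℝ).real (Set.Iic w)| ≤ η := by
  set F : ℝ → ℝ := fun w => (γ : Measure ℝ).real (Set.Iic w) with hF
  set G : ι → ℝ → ℝ := fun n w => (μ n : Measure ℝ).real (Set.Iic w) with hG
  have hFm : Monotone F := fun a b hab => measureReal_mono (Set.Iic_subset_Iic.2 hab)
  have hGm : ∀ n, Monotone (G n) := fun n a b hab => measureReal_mono (Set.Iic_subset_Iic.2 hab)
  have hF1 : ∀ w, F w ≤ 1 := fun w => measureReal_le_one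
  have hG1 : ∀ n w, G n w ≤ 1 := fun n w => measureReal_le_one
  have hF0 : ∀ w, 0 ≤ F w := fun w => measureReal_nonneg
  have hG0 : ∀ n w, 0 ≤ G n w := fun n w => measureReal_nonneg
  have hpt : ∀ w, Tendsto (fun n => G n w) l (𝓝 (F w)) := by
    intro w
    have := ProbabilityMeasure.tendsto_measure_of_null_frontier_of_tendsto' h (E := Set.Iic w)
      (by rw [frontier_Iic]; exact measure_singleton w)
    exact (ENNReal.tendsto_toReal (measure_ne_top _ _)).comp this
  have hclose : ∀ w, ∀ᶠ n in l, |G n w - F w| ≤ η / 2 := by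
    intro w
    have := (Metric.tendsto_nhds.1 (hpt w)) (η / 2) (by positivity)
    filter_upwards [this] with n hn
    exact hn.le
  have hbot : Tendsto F atBot (𝓝 0) := by
    have := tendsto_cdf_atBot (γ : Measure ℝ)
    refine this.congr fun w => ?_
    rw [cdf_eq_real]
  have htop : Tendsto F atTop (𝓝 1) := by
    have := tendsto_cdf_atTop (γ : Measure ℝ)
    refine this.congr fun w => ?_
    rw [cdf_eq_real]
  obtain ⟨a, ha⟩ := (hbot.eventually_le_const (half_pos hη)).exists
  obtain ⟨b, hb⟩ := (htop.eventually_const_le (by linarith : 1 - η / 2 < 1)).exists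
  have hmid : ∀ᶠ n in l, ∀ w ∈ Set.Icc a b, |G n w - F w| ≤ η := by
    refine isCompact_Icc.induction_on (p := fun s => ∀ᶠ n in l, ∀ w ∈ s, |G n w - F w| ≤ η)
      (by simp) (fun s t hst ht => ht.mono fun n hn w hw => hn w (hst hw))
      (fun s t hs ht => by
        filter_upwards [hs, ht] with n h1 h2 w hw
        exact hw.elim (h1 w) (h2 w)) ?_
    intro w _
    -- a small open neighbourhood of `w`, since `w` is not an atom
    obtain ⟨U, hwU, hUo, hU⟩ := Set.exists_isOpen_lt_of_lt (μ := (γ : Measure ℝ)) {w}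
      (ENNReal.ofReal (η / 2)) (by simpa using hη)
    obtain ⟨c, d, hcwd, hcd⟩ := mem_nhds_iff_exists_Ioo_subset.1
      (hUo.mem_nhds (hwU rfl))
    obtain ⟨c', hc'⟩ := exists_between hcwd.1
    obtain ⟨d', hd'⟩ := exists_between hcwd.2
    have hinc : F d' - F c' ≤ η / 2 := by
      have h1 : (γ : Measure ℝ).real (Set.Ioc c' d') = F d' - F c' := by
        have : Set.Ioc c' d' = Set.Iic d' \ Set.Iic c' := by
          ext x; simp [and_comm]
        rw [this, measureReal_sdiff (Set.Iic_subset_Iic.2 (by linarith [hc'.2, hd'.1]))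
          measurableSet_Iic]
      rw [← h1]
      have h2 : (γ : Measure ℝ) (Set.Ioc c' d') ≤ ENNReal.ofReal (η / 2) :=
        (measure_mono (fun x hx => hcd ⟨hc'.1.trans hx.1, hx.2.trans_lt hd'.2⟩)).trans hU.le
      exact ENNReal.toReal_le_of_le_ofReal (by positivity) h2
    refine ⟨Set.Ioo c' d', mem_nhdsWithin_of_mem_nhds (Ioo_mem_nhds hc'.2 hd'.1), ?_⟩
    filter_upwards [hclose c', hclose d'] with n h1 h2 x hx
    rw [abs_le] at h1 h2 ⊢
    have e1 := hFm hx.1.le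
    have e2 := hFm hx.2.le
    have e3 := hGm n hx.1.le
    have e4 := hGm n hx.2.le
    constructor <;> linarith
  filter_upwards [hmid, hclose a, hclose b] with n h1 h2 h3 w
  change |G n w - F w| ≤ η
  rcases le_total w a with hwa | hwa
  · rw [abs_le] at h2 ⊢
    have e2 := hFm hwa
    have e4 := hGm n hwa
    have := hF0 w
    have := hG0 n w
    constructor <;> linarith
  rcases le_total w b with hwb | hwb
  · exact h1 w ⟨hwa, hwb⟩
  · rw [abs_le] at h3 ⊢
    have e2 := hFm hwb
    have e4 := hGm n hwb
    have := hF1 w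
    have := hG1 n w
    constructor <;> linarith

theorem charFun_gaussianReal_zero {V : ℝ} (hV : 0 ≤ V) (x : ℝ) :
    charFun (gaussianReal 0 V.toNNReal) x = ((Real.exp (-(x ^ 2 * V / 2)) : ℝ) : ℂ) := by
  rw [charFun_gaussianReal]
  simp only [Complex.ofReal_zero, mul_zero, zero_mul, Complex.ofReal_exp]
  congr 1
  have : ((V.toNNReal : ℝ≥0) : ℝ) = V := Real.coe_toNNReal V hV
  rw [show (((V.toNNReal : ℝ≥0)) : ℂ) = (V : ℂ) by exact congrArg Complex.ofReal this]
  push_cast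
  ring

/-- Closeness of characteristic functions to a centred Gaussian one, at most polynomially bad in the
argument, controls the Kolmogorov distance, uniformly over variances in a compact subset of
`(0, ∞)`. -/
theorem exists_kolmogorov_le_of_charFun {η v C : ℝ} (hη : 0 < η) (hv : 0 < v) :
    ∃ δ : ℝ, 0 < δ ∧ ∀ (μ : Measure ℝ) [IsProbabilityMeasure μ] (V : ℝ), v ≤ V → V ≤ C →
      (∀ x : ℝ, ‖charFun μ x - ((Real.exp (-(x ^ 2 * V / 2)) : ℝ) : ℂ)‖ ≤ δ * (1 + x ^ 4)) →
      ∀ w : ℝ, |μ.real (Set.Iic w) - (gaussianReal 0 V.toNNReal).real (Set.Iic w)| ≤ η := by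
  by_contra! hcon
  choose! μ hμ V hvV hVC hch w hw using fun n : ℕ => hcon ((n : ℝ) + 1)⁻¹ (by positivity)
  obtain ⟨V₀, hV₀, φ, hφ, hφV⟩ := isCompact_Icc.tendsto_subseq
    (fun n => (⟨hvV n, hVC n⟩ : V n ∈ Set.Icc v C))
  have hV₀pos : 0 < V₀ := hv.trans_le hV₀.1
  let γ : ProbabilityMeasure ℝ := ⟨gaussianReal 0 V₀.toNNReal, inferInstance⟩
  have : NullSingletonClass (γ : Measure ℝ) :=
    nullSingletonClass_gaussianReal (by simpa using hV₀pos)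
  have hexp : ∀ x : ℝ, Tendsto (fun n => ((Real.exp (-(x ^ 2 * V (φ n) / 2)) : ℝ) : ℂ)) atTop
      (𝓝 (charFun (γ : Measure ℝ) x)) := by
    intro x
    change Tendsto _ _ (𝓝 (charFun (gaussianReal 0 V₀.toNNReal) x))
    rw [charFun_gaussianReal_zero hV₀pos.le]
    have hc : Continuous fun u : ℝ => ((Real.exp (-(x ^ 2 * u / 2)) : ℝ) : ℂ) := by fun_prop
    exact (hc.tendsto V₀).comp hφV
  have h1 : Tendsto (β := ProbabilityMeasure ℝ) (fun n => ⟨μ (φ n), hμ (φ n)⟩) atTop (𝓝 γ) := by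
    refine ProbabilityMeasure.tendsto_of_tendsto_charFun fun x => ?_
    have hz : Tendsto (fun n => charFun (μ (φ n)) x - ((Real.exp (-(x ^ 2 * V (φ n) / 2)) : ℝ) : ℂ))
        atTop (𝓝 0) := by
      refine squeeze_zero_norm (fun n => hch (φ n) x) ?_
      have h0 : Tendsto (fun n : ℕ => ((n : ℝ) + 1)⁻¹) atTop (𝓝 0) := by
        simpa [one_div] using tendsto_one_div_add_atTop_nhds_zero_nat (𝕜 := ℝ)
      simpa using (h0.comp hφ.tendsto_atTop).mul_const (1 + x ^ 4)
    simpa using hz.add (hexp x)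
  have h2 : Tendsto (β := ProbabilityMeasure ℝ)
      (fun n => ⟨gaussianReal 0 (V (φ n)).toNNReal, inferInstance⟩) atTop (𝓝 γ) := by
    refine ProbabilityMeasure.tendsto_of_tendsto_charFun fun x => (hexp x).congr fun n => ?_
    exact (charFun_gaussianReal_zero (hv.le.trans (hvV (φ n))) x).symm
  have e1 := eventually_abs_measureReal_Iic_sub_le h1 (half_pos hη)
  have e2 := eventually_abs_measureReal_Iic_sub_le h2 (half_pos hη)
  obtain ⟨n, hn1, hn2⟩ := (e1.and e2).exists
  have b1 := hn1 (w (φ n))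
  have b2 := hn2 (w (φ n))
  have b3 := hw (φ n)
  simp only [ProbabilityMeasure.coe_mk] at b1 b2
  rw [abs_le] at b1 b2
  rw [lt_abs] at b3
  rcases b3 with b3 | b3 <;> linarith

end Kolmogorov

/-! ### A central limit theorem for characteristic functions of almost independent blocks -/

section BlockCharFun

theorem norm_cexp_mul_I_sub_le (y z : ℝ) :
    ‖Complex.exp ((y : ℂ) * Complex.I) - Complex.exp ((z : ℂ) * Complex.I)‖ ≤ |y - z| := by
  have h : Complex.exp ((y : ℂ) * Complex.I) - Complex.exp ((z : ℂ) * Complex.I)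
      = Complex.exp ((z : ℂ) * Complex.I) *
        (Complex.exp (Complex.I * ((y - z : ℝ) : ℂ)) - 1) := by
    rw [mul_sub, ← Complex.exp_add, mul_one]
    congr 2
    push_cast
    ring
  rw [h, norm_mul, Complex.norm_exp_ofReal_mul_I, one_mul]
  exact Real.norm_exp_I_mul_ofReal_sub_one_le

theorem norm_cexp_mul_I_sub_taylor_le (y : ℝ) :
    ‖Complex.exp ((y : ℂ) * Complex.I) - (1 + (y : ℂ) * Complex.I - ((y ^ 2 / 2 : ℝ) : ℂ))‖
      ≤ 4 * |y| ^ 3 := by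
  rcases le_or_gt |y| 1 with hy | hy
  · have h := Complex.exp_bound (x := (y : ℂ) * Complex.I) (by simpa using hy)
      (n := 3) (by norm_num)
    have e : ∑ m ∈ Finset.range 3, ((y : ℂ) * Complex.I) ^ m / (m.factorial : ℂ)
        = 1 + (y : ℂ) * Complex.I - ((y ^ 2 / 2 : ℝ) : ℂ) := by
      simp [Finset.sum_range_succ, mul_pow]
      ring
    rw [e] at h
    refine h.trans ?_
    simp only [norm_mul, Complex.norm_real, Real.norm_eq_abs, Complex.norm_I, mul_one]
    norm_num
    nlinarith [pow_nonneg (abs_nonneg y) 3]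
  · have h1 : ‖Complex.exp ((y : ℂ) * Complex.I)‖ = 1 := Complex.norm_exp_ofReal_mul_I y
    have h2 : ‖(1 + (y : ℂ) * Complex.I - ((y ^ 2 / 2 : ℝ) : ℂ))‖ ≤ 1 + |y| + |y| ^ 2 / 2 := by
      refine (norm_sub_le _ _).trans (add_le_add ((norm_add_le _ _).trans ?_) ?_)
      · simp
      · rw [Complex.norm_real, Real.norm_eq_abs, abs_of_nonneg (by positivity), sq_abs]
    refine (norm_sub_le _ _).trans ?_
    rw [h1]
    have h3 : |y| ≤ |y| ^ 3 := by nlinarith [sq_nonneg |y|]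
    have h4 : |y| ^ 2 ≤ |y| ^ 3 := by nlinarith [sq_nonneg |y|]
    nlinarith

theorem abs_exp_neg_sub_le {u : ℝ} (hu : 0 ≤ u) : |Real.exp (-u) - (1 - u)| ≤ u ^ 2 := by
  rcases le_or_gt u 1 with h | h
  · have := Real.abs_exp_sub_one_sub_id_le (x := -u) (by rwa [abs_neg, abs_of_nonneg hu])
    rw [neg_sq] at this
    convert this using 2
    ring
  · have h1 := Real.exp_pos (-u)
    have h2 : Real.exp (-u) ≤ 1 := Real.exp_le_one_iff.2 (by linarith)
    rw [abs_le]
    constructor <;> nlinarith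

theorem abs_exp_neg_sub_exp_neg_le {u v : ℝ} (hu : 0 ≤ u) (hv : 0 ≤ v) :
    |Real.exp (-u) - Real.exp (-v)| ≤ |u - v| := by
  wlog h : u ≤ v generalizing u v
  · rw [abs_sub_comm, abs_sub_comm u]
    exact this hv hu (le_of_not_ge h)
  have h1 : Real.exp (-v) = Real.exp (-u) * Real.exp (u - v) := by
    rw [← Real.exp_add]; ring_nf
  have h2 : 1 + (u - v) ≤ Real.exp (u - v) := by linarith [Real.add_one_le_exp (u - v)]
  have h3 : Real.exp (u - v) ≤ 1 := Real.exp_le_one_iff.2 (by linarith)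
  have h4 : Real.exp (-u) ≤ 1 := Real.exp_le_one_iff.2 (by linarith)
  have h5 := Real.exp_pos (-u)
  rw [h1, abs_of_nonneg (by nlinarith), abs_of_nonpos (by linarith)]
  nlinarith

/-- `|b| ≤ κ + b² / κ`: the first moment is controlled by the second one at any scale `κ`. -/
theorem abs_le_add_sq_div {κ : ℝ} (hκ : 0 < κ) (b : ℝ) : |b| ≤ κ + b ^ 2 / κ := by
  have h : |b| * κ ≤ κ ^ 2 + b ^ 2 := by nlinarith [sq_nonneg (|b| - κ), sq_abs b]
  have : κ + b ^ 2 / κ = (κ ^ 2 + b ^ 2) / κ := by field_simp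
  rw [this, le_div_iff₀ hκ]
  exact h

/-- `|b|³ ≤ κ b² + b⁴ / κ`: the third moment interpolates between the second and the fourth. -/
theorem abs_pow_three_le {κ : ℝ} (hκ : 0 < κ) (b : ℝ) : |b| ^ 3 ≤ κ * b ^ 2 + b ^ 4 / κ := by
  have h := mul_le_mul_of_nonneg_left (abs_le_add_sq_div hκ b) (sq_nonneg b)
  calc |b| ^ 3 = b ^ 2 * |b| := by rw [← sq_abs b]; ring
    _ ≤ _ := h
    _ = _ := by ring

variable {Ω : Type*} [MeasurableSpace Ω] {μ : Measure Ω}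

/-- The characteristic function of the random variable `f`. -/
noncomputable def expChar (μ : Measure Ω) (f : Ω → ℝ) (x : ℝ) : ℂ :=
  ∫ ω, Complex.exp (((x * f ω : ℝ) : ℂ) * Complex.I) ∂μ

theorem charFun_map_eq_expChar {f : Ω → ℝ} (hf : AEMeasurable f μ) (x : ℝ) :
    charFun (μ.map f) x = expChar μ f x := by
  have hc : Continuous fun y : ℝ => Complex.exp ((x : ℂ) * y * Complex.I) := by fun_prop
  rw [charFun_apply_real, integral_map hf hc.aestronglyMeasurable]
  simp [expChar]

theorem integrable_pow_four {B : Ω → ℝ} (hB : MemLp B 4 μ) :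
    Integrable (fun ω => B ω ^ 4) μ := by
  have := hB.integrable_norm_pow (by norm_num : (4 : ℕ) ≠ 0)
  refine this.congr (ae_of_all _ fun ω => ?_)
  simp [Even.pow_abs (by decide : Even 4)]

variable [IsProbabilityMeasure μ]

theorem integrable_cexp {f : Ω → ℝ} (hf : AEStronglyMeasurable f μ) (x : ℝ) :
    Integrable (fun ω => Complex.exp (((x * f ω : ℝ) : ℂ) * Complex.I)) μ := by
  refine Integrable.of_bound (C := 1) ?_ (ae_of_all _ fun ω => ?_)
  · have hc : Continuous fun y : ℝ => Complex.exp (((x * y : ℝ) : ℂ) * Complex.I) := by fun_prop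
    exact hc.comp_aestronglyMeasurable hf
  · rw [Complex.norm_exp_ofReal_mul_I]

theorem norm_expChar_le_one (f : Ω → ℝ) (x : ℝ) : ‖expChar μ f x‖ ≤ 1 := by
  refine (norm_integral_le_of_norm_le_const (C := 1) (ae_of_all _ fun ω => ?_)).trans ?_
  · rw [Complex.norm_exp_ofReal_mul_I]
  · simp

theorem norm_expChar_sub_le {f g : Ω → ℝ} (hf : Integrable f μ) (hg : Integrable g μ) (x : ℝ) :
    ‖expChar μ f x - expChar μ g x‖ ≤ |x| * ∫ ω, |f ω - g ω| ∂μ := by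
  unfold expChar
  rw [← integral_sub (integrable_cexp hf.1 x) (integrable_cexp hg.1 x), ← integral_const_mul]
  refine norm_integral_le_of_norm_le ((hf.sub hg).abs.const_mul _) (ae_of_all _ fun ω => ?_)
  refine (norm_cexp_mul_I_sub_le _ _).trans_eq ?_
  rw [← mul_sub, abs_mul]

theorem abs_le_one_add_pow_four (x : ℝ) : |x| ≤ 1 + x ^ 4 := by
  rw [abs_le]
  constructor <;> nlinarith [sq_nonneg (x ^ 2 - 1), sq_nonneg (x - 1), sq_nonneg (x + 1), sq_nonneg x]

theorem sq_le_one_add_pow_four (x : ℝ) : x ^ 2 ≤ 1 + x ^ 4 := by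
  nlinarith [sq_nonneg (x ^ 2 - 1), sq_nonneg x]

theorem abs_pow_three_le_one_add_pow_four (x : ℝ) : |x| ^ 3 ≤ 1 + x ^ 4 := by
  have : x ^ 4 = |x| ^ 4 := by rw [Even.pow_abs (by decide)]
  rw [this]
  nlinarith [sq_nonneg (|x| ^ 2 - |x|), sq_nonneg (|x| - 1), abs_nonneg x, sq_nonneg |x|,
    sq_nonneg (|x| ^ 2 - 1), pow_nonneg (abs_nonneg x) 3]

theorem integrable_sq_of_memLp_four {B : Ω → ℝ} (hB : MemLp B 4 μ) :
    Integrable (fun ω => B ω ^ 2) μ :=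
  (hB.mono_exponent (by norm_num : (2 : ℝ≥0∞) ≤ 4)).integrable_sq

theorem sq_integral_le {f : Ω → ℝ} (hf : MemLp f 2 μ) :
    (∫ ω, f ω ∂μ) ^ 2 ≤ ∫ ω, f ω ^ 2 ∂μ := by
  have h := variance_nonneg f μ
  rw [variance_eq_sub hf] at h
  simpa using h

theorem sq_integral_sq_le {B : Ω → ℝ} (hB : MemLp B 4 μ) :
    (∫ ω, B ω ^ 2 ∂μ) ^ 2 ≤ ∫ ω, B ω ^ 4 ∂μ := by
  have h : MemLp (fun ω => B ω ^ 2) 2 μ := by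
    refine (memLp_two_iff_integrable_sq (hB.1.pow 2)).2 ?_
    refine (integrable_pow_four hB).congr (ae_of_all _ fun ω => ?_)
    simp only [Pi.pow_apply]; ring
  refine (sq_integral_le h).trans_eq (integral_congr_ae (ae_of_all _ fun ω => ?_))
  simp only; ring

/-- Second order expansion of the characteristic function of one centred block. -/
theorem norm_expChar_sub_exp_le {B : Ω → ℝ} (hB : MemLp B 4 μ) (h0 : ∫ ω, B ω ∂μ = 0)
    {κ : ℝ} (hκ : 0 < κ) (hκ1 : κ ≤ 1) (x : ℝ) :
    ‖expChar μ B x - ((Real.exp (-(x ^ 2 * (∫ ω, B ω ^ 2 ∂μ) / 2)) : ℝ) : ℂ)‖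
      ≤ (1 + x ^ 4) * (5 * (κ * ∫ ω, B ω ^ 2 ∂μ) + 5 * ((∫ ω, B ω ^ 4 ∂μ) / κ)) := by
  set s := ∫ ω, B ω ^ 2 ∂μ with hs
  set f := ∫ ω, B ω ^ 4 ∂μ with hf
  have hi1 : Integrable B μ := (hB.mono_exponent (by norm_num : (1 : ℝ≥0∞) ≤ 4)).integrable le_rfl
  have hi2 := integrable_sq_of_memLp_four hB
  have hi4 := integrable_pow_four hB
  have hs0 : 0 ≤ s := integral_nonneg fun ω => sq_nonneg _
  have hf0 : 0 ≤ f := integral_nonneg fun ω => by positivity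
  have hsf : s ^ 2 ≤ f := sq_integral_sq_le hB
  have hfκ : f ≤ f / κ := by
    rw [le_div_iff₀ hκ]; nlinarith
  have hq2 : Integrable (fun ω => (x * B ω) ^ 2 / 2) μ :=
    (hi2.const_mul (x ^ 2 / 2)).congr (ae_of_all _ fun ω => by simp only; ring)
  have hq2e : ∫ ω, (x * B ω) ^ 2 / 2 ∂μ = x ^ 2 * s / 2 := by
    rw [hs, ← integral_const_mul, ← integral_div]
    exact integral_congr_ae (ae_of_all _ fun ω => by simp only; ring)
  have hA : ‖expChar μ B x - ((1 - x ^ 2 * s / 2 : ℝ) : ℂ)‖ ≤ 4 * |x| ^ 3 * (κ * s + f / κ) := by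
    have hT : ∫ ω, (1 + ((x * B ω : ℝ) : ℂ) * Complex.I - (((x * B ω) ^ 2 / 2 : ℝ) : ℂ)) ∂μ
        = ((1 - x ^ 2 * s / 2 : ℝ) : ℂ) := by
      have i1 : Integrable (fun ω => ((x * B ω : ℝ) : ℂ) * Complex.I) μ :=
        ((hi1.const_mul x).ofReal).mul_const _
      have i3 : Integrable (fun ω => (1 : ℂ) + ((x * B ω : ℝ) : ℂ) * Complex.I) μ :=
        (integrable_const _).add i1
      have i2 : Integrable (fun ω => (((x * B ω) ^ 2 / 2 : ℝ) : ℂ)) μ := hq2.ofReal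
      rw [integral_sub i3 i2, integral_add (integrable_const _) i1,
        integral_mul_const, integral_complex_ofReal, integral_complex_ofReal, integral_const_mul, h0,
        hq2e]
      simp
    unfold expChar
    rw [← hT, ← integral_sub (integrable_cexp hB.1 x)]
    · have hdom : Integrable (fun ω => 4 * |x| ^ 3 * (κ * B ω ^ 2 + B ω ^ 4 / κ)) μ :=
        ((hi2.const_mul _).add (hi4.div_const _)).const_mul _
      refine (norm_integral_le_of_norm_le hdom (ae_of_all _ fun ω => ?_)).trans_eq ?_
      · refine (norm_cexp_mul_I_sub_taylor_le _).trans ?_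
        rw [abs_mul, mul_pow, mul_assoc]
        gcongr
        exact abs_pow_three_le hκ _
      · rw [integral_const_mul, integral_add (hi2.const_mul _) (hi4.div_const _),
          integral_const_mul, integral_div]
    · exact ((integrable_const _).add (((hi1.const_mul x).ofReal).mul_const _)).sub hq2.ofReal
  have hB' : ‖((1 - x ^ 2 * s / 2 : ℝ) : ℂ) - ((Real.exp (-(x ^ 2 * s / 2)) : ℝ) : ℂ)‖
      ≤ x ^ 4 * (f / κ) := by
    rw [← Complex.ofReal_sub, Complex.norm_real, Real.norm_eq_abs, abs_sub_comm]
    refine (abs_exp_neg_sub_le (by positivity)).trans ?_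
    have : x ^ 4 * s ^ 2 ≤ x ^ 4 * (f / κ) := by gcongr; linarith
    nlinarith [mul_nonneg (by positivity : 0 ≤ x ^ 4) (sq_nonneg s)]
  have h3 := abs_pow_three_le_one_add_pow_four x
  have hp : 0 ≤ κ * s + f / κ := by positivity
  have hq : 0 ≤ f / κ := by positivity
  have hr : 0 ≤ κ * s := by positivity
  have hx4 : 0 ≤ x ^ 4 := by positivity
  calc _ ≤ 4 * |x| ^ 3 * (κ * s + f / κ) + x ^ 4 * (f / κ) := by
        refine le_trans ?_ (add_le_add hA hB')
        exact norm_sub_le_norm_sub_add_norm_sub _ _ _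
    _ ≤ 4 * (1 + x ^ 4) * (κ * s + f / κ) + (1 + x ^ 4) * (f / κ) := by
        gcongr
        linarith
    _ ≤ _ := by nlinarith [mul_nonneg hx4 hr]

/-- A sum of `J` centred blocks, whose characteristic functions factorise up to errors `|x| e`, plus
a remainder `R`, is nearly Gaussian with variance the sum of the variances of the blocks. -/
theorem norm_expChar_sum_sub_exp_le {J : ℕ} {B : ℕ → Ω → ℝ} {R : Ω → ℝ}
    (hB : ∀ j, MemLp (B j) 4 μ) (h0 : ∀ j, ∫ ω, B j ω ∂μ = 0) (hR : MemLp R 2 μ)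
    {e : ℝ} (he : 0 ≤ e)
    (hfac : ∀ j < J, ∀ x : ℝ, ‖expChar μ (fun ω => ∑ i ∈ Finset.range j, B i ω + B j ω) x
      - expChar μ (fun ω => ∑ i ∈ Finset.range j, B i ω) x * expChar μ (B j) x‖ ≤ |x| * e)
    {κ : ℝ} (hκ : 0 < κ) (hκ1 : κ ≤ 1) (x : ℝ) :
    ‖expChar μ (fun ω => ∑ j ∈ Finset.range J, B j ω + R ω) x
      - ((Real.exp (-(x ^ 2 * (∑ j ∈ Finset.range J, ∫ ω, B j ω ^ 2 ∂μ) / 2)) : ℝ) : ℂ)‖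
      ≤ (1 + x ^ 4) * (κ + (∫ ω, R ω ^ 2 ∂μ) / κ + J * e
        + 5 * (κ * ∑ j ∈ Finset.range J, ∫ ω, B j ω ^ 2 ∂μ)
        + 5 * ((∑ j ∈ Finset.range J, ∫ ω, B j ω ^ 4 ∂μ) / κ)) := by
  have hi1 : ∀ j, Integrable (B j) μ := fun j =>
    ((hB j).mono_exponent (by norm_num : (1 : ℝ≥0∞) ≤ 4)).integrable le_rfl
  have hRi : Integrable R μ := hR.integrable (by norm_num)
  have hrem : ‖expChar μ (fun ω => ∑ j ∈ Finset.range J, B j ω + R ω) x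
      - expChar μ (fun ω => ∑ j ∈ Finset.range J, B j ω) x‖
      ≤ (1 + x ^ 4) * (κ + (∫ ω, R ω ^ 2 ∂μ) / κ) := by
    have hs : Integrable (fun ω => ∑ j ∈ Finset.range J, B j ω) μ :=
      integrable_finsetSum _ fun j _ => hi1 j
    refine (norm_expChar_sub_le (hs.add hRi) hs x).trans ?_
    have h1 : ∫ ω, |∑ j ∈ Finset.range J, B j ω + R ω - ∑ j ∈ Finset.range J, B j ω| ∂μ
        ≤ κ + (∫ ω, R ω ^ 2 ∂μ) / κ := by
      have h2 : ∫ ω, (κ + R ω ^ 2 / κ) ∂μ = κ + (∫ ω, R ω ^ 2 ∂μ) / κ := by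
        rw [integral_add (integrable_const _) (hR.integrable_sq.div_const _), integral_div]
        simp
      rw [← h2]
      simp only [add_sub_cancel_left]
      exact integral_mono hRi.abs ((integrable_const _).add (hR.integrable_sq.div_const _))
        fun ω => abs_le_add_sq_div hκ _
    have h3 : 0 ≤ ∫ ω, R ω ^ 2 ∂μ := integral_nonneg fun ω => sq_nonneg _
    exact mul_le_mul (abs_le_one_add_pow_four x) h1 (integral_nonneg fun ω => abs_nonneg _)
      (by positivity)
  have hind : ∀ j ≤ J, ‖expChar μ (fun ω => ∑ i ∈ Finset.range j, B i ω) x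
      - ((Real.exp (-(x ^ 2 * (∑ i ∈ Finset.range j, ∫ ω, B i ω ^ 2 ∂μ) / 2)) : ℝ) : ℂ)‖
      ≤ (1 + x ^ 4) * (j * e
        + 5 * (κ * ∑ i ∈ Finset.range j, ∫ ω, B i ω ^ 2 ∂μ)
        + 5 * ((∑ i ∈ Finset.range j, ∫ ω, B i ω ^ 4 ∂μ) / κ)) := by
    intro j hj
    induction j with
    | zero => simp [expChar]
    | succ j ih =>
      have ih := ih (by omega)
      have hf := hfac j (by omega) x
      have hb := norm_expChar_sub_exp_le (hB j) (h0 j) hκ hκ1 x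
      simp only [Finset.sum_range_succ]
      set P := expChar μ (fun ω => ∑ i ∈ Finset.range j, B i ω) x
      set Q := expChar μ (fun ω => ∑ i ∈ Finset.range j, B i ω + B j ω) x
      set V := ∑ i ∈ Finset.range j, ∫ ω, B i ω ^ 2 ∂μ with hV
      set F := ∑ i ∈ Finset.range j, ∫ ω, B i ω ^ 4 ∂μ
      set s := ∫ ω, B j ω ^ 2 ∂μ
      set f := ∫ ω, B j ω ^ 4 ∂μ
      have hV0 : 0 ≤ V := Finset.sum_nonneg fun i _ => integral_nonneg fun ω => sq_nonneg _
      set E1 : ℂ := ((Real.exp (-(x ^ 2 * V / 2)) : ℝ) : ℂ)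
      set E2 : ℂ := ((Real.exp (-(x ^ 2 * s / 2)) : ℝ) : ℂ)
      have hE : ((Real.exp (-(x ^ 2 * (V + s) / 2)) : ℝ) : ℂ) = E1 * E2 := by
        rw [← Complex.ofReal_mul, ← Real.exp_add]
        congr 2
        ring
      have hE1 : ‖E1‖ ≤ 1 := by
        rw [Complex.norm_real, Real.norm_eq_abs, abs_of_pos (Real.exp_pos _)]
        exact Real.exp_le_one_iff.2 (neg_nonpos.2 (by positivity))
      rw [hE]
      have hsplit : Q - E1 * E2 = (Q - P * expChar μ (B j) x) + (P - E1) * expChar μ (B j) x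
          + E1 * (expChar μ (B j) x - E2) := by ring
      have hφ := norm_expChar_le_one (μ := μ) (B j) x
      have n1 : ‖(P - E1) * expChar μ (B j) x‖ ≤ ‖P - E1‖ := by
        rw [norm_mul]
        exact mul_le_of_le_one_right (norm_nonneg _) hφ
      have n2 : ‖E1 * (expChar μ (B j) x - E2)‖ ≤ ‖expChar μ (B j) x - E2‖ := by
        rw [norm_mul]
        exact mul_le_of_le_one_left (norm_nonneg _) hE1
      have n3 : |x| * e ≤ (1 + x ^ 4) * e :=
        mul_le_mul_of_nonneg_right (abs_le_one_add_pow_four x) he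
      rw [hsplit]
      calc _ ≤ |x| * e + ‖P - E1‖ + ‖expChar μ (B j) x - E2‖ := by
            refine (norm_add₃_le).trans ?_
            gcongr
        _ ≤ _ := by
            refine (add_le_add (add_le_add n3 ih) hb).trans_eq ?_
            push_cast
            ring
  refine (norm_sub_le_norm_sub_add_norm_sub _ _ _).trans
    ((add_le_add hrem (hind J le_rfl)).trans_eq ?_)
  ring

end BlockCharFun

/-! ### Moment inequalities -/

section Moments

variable {Ω : Type*} [MeasurableSpace Ω] {μ : Measure Ω}

theorem eLpNorm_le_ofReal_iff {n : ℕ} (hn : Even n) (hn0 : n ≠ 0) {f : Ω → ℝ}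
    (hf : MemLp f n μ) {a : ℝ} (ha : 0 ≤ a) :
    eLpNorm f n μ ≤ ENNReal.ofReal a ↔ ∫ ω, f ω ^ n ∂μ ≤ a ^ n := by
  have h0 : 0 ≤ ∫ ω, f ω ^ n ∂μ := integral_nonneg fun ω => hn.pow_nonneg _
  have e : ∫ ω, ‖f ω‖ ^ ((n : ℝ≥0∞).toReal) ∂μ = ∫ ω, f ω ^ n ∂μ := by
    refine integral_congr_ae (ae_of_all _ fun ω => ?_)
    simp [Even.pow_abs hn]
  rw [hf.eLpNorm_eq_integral_rpow_norm (by exact_mod_cast hn0) (by simp), e,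
    ENNReal.ofReal_le_ofReal_iff ha]
  simp only [ENNReal.toReal_natCast]
  rw [Real.rpow_inv_le_iff_of_pos h0 ha (by positivity), Real.rpow_natCast]

/-- Minkowski's inequality for the even moments of a sum. -/
theorem integral_sum_pow_le {ι : Type*} {n : ℕ} (hn : Even n) (hn0 : n ≠ 0) (s : Finset ι)
    {f : ι → Ω → ℝ} {a : ι → ℝ} (hf : ∀ i ∈ s, MemLp (f i) n μ) (ha : ∀ i ∈ s, 0 ≤ a i)
    (h : ∀ i ∈ s, ∫ ω, f i ω ^ n ∂μ ≤ a i ^ n) :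
    ∫ ω, (∑ i ∈ s, f i ω) ^ n ∂μ ≤ (∑ i ∈ s, a i) ^ n := by
  rw [← eLpNorm_le_ofReal_iff hn hn0 (memLp_finsetSum s hf) (Finset.sum_nonneg ha)]
  have e : (fun ω => ∑ i ∈ s, f i ω) = ∑ i ∈ s, f i := by ext ω; simp
  rw [e, ENNReal.ofReal_sum_of_nonneg ha]
  refine (eLpNorm_sum_le (fun i hi => (hf i hi).1) (by exact_mod_cast Nat.one_le_iff_ne_zero.2 hn0)).trans
    (Finset.sum_le_sum fun i hi => ?_)
  exact (eLpNorm_le_ofReal_iff hn hn0 (hf i hi) (ha i hi)).2 (h i hi)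

theorem sq_integral_mul_le {f g : Ω → ℝ} (hf : MemLp f 2 μ) (hg : MemLp g 2 μ) :
    (∫ ω, f ω * g ω ∂μ) ^ 2 ≤ (∫ ω, f ω ^ 2 ∂μ) * ∫ ω, g ω ^ 2 ∂μ := by
  have hfg : Integrable (fun ω => f ω * g ω) μ := hf.integrable_mul hg
  have h : ∀ x : ℝ, 0 ≤ (∫ ω, g ω ^ 2 ∂μ) * (x * x) + (2 * ∫ ω, f ω * g ω ∂μ) * x
      + ∫ ω, f ω ^ 2 ∂μ := by
    intro x
    have e : (∫ ω, g ω ^ 2 ∂μ) * (x * x) + (2 * ∫ ω, f ω * g ω ∂μ) * x + ∫ ω, f ω ^ 2 ∂μ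
        = ∫ ω, (x * g ω + f ω) ^ 2 ∂μ := by
      have e2 : ∀ ω, (x * g ω + f ω) ^ 2 = g ω ^ 2 * (x * x) + f ω * g ω * (2 * x) + f ω ^ 2 :=
        fun ω => by ring
      have i1 : Integrable (fun ω => g ω ^ 2 * (x * x) + f ω * g ω * (2 * x)) μ :=
        (hg.integrable_sq.mul_const _).add (hfg.mul_const _)
      simp_rw [e2]
      rw [integral_add i1 hf.integrable_sq,
        integral_add (hg.integrable_sq.mul_const _) (hfg.mul_const _), integral_mul_const,
        integral_mul_const]
      ring
    rw [e]
    exact integral_nonneg fun ω => sq_nonneg _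
  have := discrim_le_zero h
  rw [discrim] at this
  nlinarith

/-- The Cauchy–Schwarz inequality with given bounds on the second moments. -/
theorem abs_integral_mul_le {f g : Ω → ℝ} (hf : MemLp f 2 μ) (hg : MemLp g 2 μ) {a b : ℝ}
    (ha : 0 ≤ a) (hb : 0 ≤ b) (hfa : ∫ ω, f ω ^ 2 ∂μ ≤ a ^ 2) (hgb : ∫ ω, g ω ^ 2 ∂μ ≤ b ^ 2) :
    |∫ ω, f ω * g ω ∂μ| ≤ a * b := by
  refine abs_le_of_sq_le_sq ?_ (by positivity)
  refine (sq_integral_mul_le hf hg).trans ?_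
  rw [mul_pow]
  exact mul_le_mul hfa hgb (integral_nonneg fun ω => sq_nonneg _) (by positivity)

theorem MeasureTheory.MemLp.mul_four {f g : Ω → ℝ} (hf : MemLp f 4 μ) (hg : MemLp g 4 μ) :
    MemLp (fun ω => f ω * g ω) 2 μ := by
  have : ENNReal.HolderTriple 4 4 2 := ⟨by
    rw [← two_mul, show (4 : ℝ≥0∞) = 2 * 2 by norm_num,
      ENNReal.mul_inv (by simp) (by simp), ← mul_assoc, ENNReal.mul_inv_cancel (by simp) (by simp),
      one_mul]⟩
  exact hg.mul hf

theorem integral_mul_sq_le {f g : Ω → ℝ} (hf : MemLp f 4 μ) (hg : MemLp g 4 μ) {a b : ℝ}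
    (hfa : ∫ ω, f ω ^ 4 ∂μ ≤ a ^ 4) (hgb : ∫ ω, g ω ^ 4 ∂μ ≤ b ^ 4) :
    ∫ ω, (f ω * g ω) ^ 2 ∂μ ≤ (a * b) ^ 2 := by
  have hf2 : MemLp (fun ω => f ω ^ 2) 2 μ := by simpa only [sq] using hf.mul_four hf
  have hg2 : MemLp (fun ω => g ω ^ 2) 2 μ := by simpa only [sq] using hg.mul_four hg
  have e := abs_integral_mul_le hf2 hg2 (a := a ^ 2) (b := b ^ 2) (by positivity) (by positivity)
    (by simp_rw [← pow_mul]; exact hfa) (by simp_rw [← pow_mul]; exact hgb)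
  simp_rw [mul_pow]
  exact (le_abs_self _).trans e

variable [IsProbabilityMeasure μ]

theorem integral_sq_le_of_pow_four_le {f : Ω → ℝ} (hf : MemLp f 4 μ) {a : ℝ}
    (h : ∫ ω, f ω ^ 4 ∂μ ≤ a ^ 4) : ∫ ω, f ω ^ 2 ∂μ ≤ a ^ 2 := by
  refine le_of_sq_le_sq ?_ (by positivity)
  calc _ ≤ _ := sq_integral_sq_le hf
    _ ≤ _ := h
    _ = _ := by ring

theorem integral_abs_le_of_sq_le {f : Ω → ℝ} (hf : MemLp f 2 μ) {a : ℝ} (ha : 0 ≤ a)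
    (h : ∫ ω, f ω ^ 2 ∂μ ≤ a ^ 2) : ∫ ω, |f ω| ∂μ ≤ a := by
  refine (le_abs_self _).trans (abs_le_of_sq_le_sq ?_ ha)
  refine (sq_integral_le hf.norm).trans ?_
  simpa using h

end Moments

/-! ### Summable correlations -/

section Schur

/-- The correlation bound `(k + 1)^{-2}` at lag `k`. -/
noncomputable def lagBound (k : ℕ) : ℝ := 1 / ((k : ℝ) + 1) ^ 2

theorem lagBound_nonneg (k : ℕ) : 0 ≤ lagBound k := by unfold lagBound; positivity

theorem sum_lagBound_le (n : ℕ) : ∑ k ∈ Finset.range n, lagBound k ≤ 2 := by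
  have h : ∀ n : ℕ, ∑ k ∈ Finset.range (n + 1), lagBound k ≤ 2 - 1 / ((n : ℝ) + 1) := by
    intro n
    induction n with
    | zero => simp [lagBound]; norm_num
    | succ n ih =>
      rw [Finset.sum_range_succ]
      have : lagBound (n + 1) ≤ 1 / ((n : ℝ) + 1) - 1 / ((n : ℝ) + 1 + 1) := by
        unfold lagBound
        rw [div_sub_div _ _ (by positivity) (by positivity), div_le_div_iff₀ (by positivity)
          (by positivity)]
        push_cast
        nlinarith [(Nat.cast_nonneg n : (0 : ℝ) ≤ n)]
      push_cast
      linarith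
  have h0 : ∑ k ∈ Finset.range n, lagBound k ≤ ∑ k ∈ Finset.range (n + 1), lagBound k :=
    Finset.sum_le_sum_of_subset_of_nonneg (Finset.range_mono (Nat.le_succ n))
      fun k _ _ => lagBound_nonneg k
  have : 0 ≤ 1 / ((n : ℝ) + 1) := by positivity
  linarith [h n]

theorem sum_dist_le {ρ : ℕ → ℝ} (hρ : ∀ k, 0 ≤ ρ k) {C : ℝ}
    (hC : ∀ n, ∑ k ∈ Finset.range n, ρ k ≤ C) (A : Finset ℕ) (t : ℕ) :
    ∑ s ∈ A, ρ (Nat.dist t s) ≤ 2 * C := by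
  have half : ∀ (B : Finset ℕ), Set.InjOn (Nat.dist t) B → ∑ s ∈ B, ρ (Nat.dist t s) ≤ C := by
    intro B hB
    rw [← Finset.sum_image (f := ρ) hB]
    refine le_trans ?_ (hC ((B.image (Nat.dist t)).sup id + 1))
    refine Finset.sum_le_sum_of_subset_of_nonneg (fun k hk => ?_) fun k _ _ => hρ k
    exact Finset.mem_range.2 (Nat.lt_succ_of_le (Finset.le_sup (f := id) hk))
  rw [← Finset.sum_filter_add_sum_filter_not A (fun s => s ≤ t), two_mul]
  refine add_le_add (half _ ?_) (half _ ?_)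
  · intro a ha b hb hab
    simp only [Finset.coe_filter, Set.mem_ofPred_eq] at ha hb
    simp only [Nat.dist] at hab
    omega
  · intro a ha b hb hab
    simp only [Finset.coe_filter, Set.mem_ofPred_eq] at ha hb
    simp only [Nat.dist] at hab
    omega

/-- Schur's test for a kernel that depends on the lag only. -/
theorem sum_sum_dist_le {ρ : ℕ → ℝ} (hρ : ∀ k, 0 ≤ ρ k) {C : ℝ}
    (hC : ∀ n, ∑ k ∈ Finset.range n, ρ k ≤ C) (A : Finset ℕ) (c : ℕ → ℝ) :
    ∑ t ∈ A, ∑ s ∈ A, |c t| * |c s| * ρ (Nat.dist t s) ≤ 2 * C * ∑ t ∈ A, c t ^ 2 := by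
  have h1 : ∑ t ∈ A, ∑ s ∈ A, |c t| * |c s| * ρ (Nat.dist t s)
      ≤ ∑ t ∈ A, ∑ s ∈ A, (c t ^ 2 / 2 * ρ (Nat.dist t s) + c s ^ 2 / 2 * ρ (Nat.dist s t)) := by
    refine Finset.sum_le_sum fun t _ => Finset.sum_le_sum fun s _ => ?_
    rw [Nat.dist_comm s t, ← add_mul]
    refine mul_le_mul_of_nonneg_right ?_ (hρ _)
    nlinarith [sq_nonneg (|c t| - |c s|), sq_abs (c t), sq_abs (c s)]
  refine h1.trans ?_
  simp_rw [Finset.sum_add_distrib]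
  rw [Finset.sum_comm (f := fun t s => c s ^ 2 / 2 * ρ (Nat.dist s t)), ← two_mul]
  simp_rw [← Finset.mul_sum]
  rw [Finset.mul_sum, Finset.mul_sum]
  refine Finset.sum_le_sum fun t _ => ?_
  have := sum_dist_le hρ hC A t
  nlinarith [sq_nonneg (c t)]

end Schur

/-! ### Weakly dependent processes with couplings -/

section Coupled

variable {Ω : Type*} [MeasurableSpace Ω] {P : Measure Ω}

/-- A centred process `X` with bounded fourth moments that can be decoupled from its own past: for
every date `r` there is a process `Y r` on the dates after `r` that is independent of `X` up to `r`,
is distributed as `X` after `r`, and is at distance at most `K (t - r + 1)^{-2}` from `X` in `L⁴` at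
date `t`. -/
structure CoupledProcess (P : Measure Ω) (X : ℕ → Ω → ℝ) (Y : ℕ → ℕ → Ω → ℝ) (K : ℝ) : Prop where
  pos : 0 < K
  measurable : ∀ t, Measurable (X t)
  measurable_coupled : ∀ r t, Measurable (Y r t)
  memLp : ∀ t, MemLp (X t) 4 P
  mean_zero : ∀ t, ∫ ω, X t ω ∂P = 0
  fourth_moment : ∀ t, ∫ ω, X t ω ^ 4 ∂P ≤ K ^ 4
  coupling : ∀ r t, r < t → ∫ ω, (X t ω - Y r t ω) ^ 4 ∂P ≤ (K * lagBound (t - r)) ^ 4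
  indep : ∀ r, IndepFun (fun ω (s : Set.Iic r) => X s ω) (fun ω (t : Set.Ioi r) => Y r t ω) P
  identDistrib : ∀ r,
    IdentDistrib (fun ω (t : Set.Ioi r) => Y r t ω) (fun ω (t : Set.Ioi r) => X t ω) P P

/-- The extension by `0` of a sequence that is given on the index set `S`. -/
noncomputable def extendZero (S : Set ℕ) (x : S → ℝ) : ℕ → ℝ :=
  open Classical in fun t => if h : t ∈ S then x ⟨t, h⟩ else 0

theorem extendZero_apply {S : Set ℕ} (x : ℕ → ℝ) {t : ℕ} (h : t ∈ S) :
    extendZero S (fun s => x s) t = x t := by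
  simp [extendZero, h]

theorem measurable_extendZero (S : Set ℕ) : Measurable (extendZero S) := by
  refine measurable_pi_lambda _ fun t => ?_
  by_cases h : t ∈ S
  · simpa [extendZero, h] using measurable_pi_apply _
  · simp [extendZero, h]

/-- Independence of two subfamilies of possibly different sequences factorises expectations of
functionals that depend on the respective subfamilies only. -/
theorem integral_mul_of_indepFun_restrict {𝕜 : Type*} [RCLike 𝕜] {X Y : ℕ → Ω → ℝ}
    (hX : ∀ t, Measurable (X t)) (hY : ∀ t, Measurable (Y t)) {S S' : Set ℕ}
    (h : IndepFun (fun ω (s : S) => X s ω) (fun ω (t : S') => Y t ω) P)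
    {Φ Ψ : (ℕ → ℝ) → 𝕜} (hΦm : Measurable Φ) (hΨm : Measurable Ψ)
    (hΦ : ∀ x y : ℕ → ℝ, (∀ t ∈ S, x t = y t) → Φ x = Φ y)
    (hΨ : ∀ x y : ℕ → ℝ, (∀ t ∈ S', x t = y t) → Ψ x = Ψ y) :
    ∫ ω, Φ (fun t => X t ω) * Ψ (fun t => Y t ω) ∂P
      = (∫ ω, Φ (fun t => X t ω) ∂P) * ∫ ω, Ψ (fun t => Y t ω) ∂P := by
  have hm1 : Measurable fun ω (s : S) => X s ω := measurable_pi_lambda _ fun s => hX s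
  have hm2 : Measurable fun ω (s : S') => Y s ω := measurable_pi_lambda _ fun s => hY s
  have e1 : ∀ ω, Φ (fun t => X t ω) = Φ (extendZero S fun s : S => X s ω) := fun ω =>
    hΦ _ _ fun t ht => (extendZero_apply (fun t => X t ω) ht).symm
  have e2 : ∀ ω, Ψ (fun t => Y t ω) = Ψ (extendZero S' fun s : S' => Y s ω) := fun ω =>
    hΨ _ _ fun t ht => (extendZero_apply (fun t => Y t ω) ht).symm
  simp_rw [e1, e2]
  exact h.integral_fun_comp_mul_comp (f := fun x => Φ (extendZero S x))
    (g := fun x => Ψ (extendZero S' x)) hm1.aemeasurable hm2.aemeasurable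
    (hΦm.comp (measurable_extendZero S)).aestronglyMeasurable
    (hΨm.comp (measurable_extendZero S')).aestronglyMeasurable

namespace CoupledProcess

variable {X : ℕ → Ω → ℝ} {Y : ℕ → ℕ → Ω → ℝ} {K : ℝ}

theorem identDistrib_comp {𝕜 : Type*} [RCLike 𝕜] (hX : CoupledProcess P X Y K) (r : ℕ)
    {Ψ : (ℕ → ℝ) → 𝕜} (hΨm : Measurable Ψ)
    (hΨ : ∀ x y : ℕ → ℝ, (∀ t, r < t → x t = y t) → Ψ x = Ψ y) :
    IdentDistrib (fun ω => Ψ fun t => Y r t ω) (fun ω => Ψ fun t => X t ω) P P := by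
  have e1 : ∀ ω, Ψ (fun t => X t ω) = Ψ (extendZero (Set.Ioi r) fun s : Set.Ioi r => X s ω) :=
    fun ω => hΨ _ _ fun t ht => (extendZero_apply (S := Set.Ioi r) (fun t => X t ω) ht).symm
  have e2 : ∀ ω, Ψ (fun t => Y r t ω) = Ψ (extendZero (Set.Ioi r) fun s : Set.Ioi r => Y r s ω) :=
    fun ω => hΨ _ _ fun t ht => (extendZero_apply (S := Set.Ioi r) (fun t => Y r t ω) ht).symm
  simp_rw [e1, e2]
  exact (hX.identDistrib r).comp (hΨm.comp (measurable_extendZero _))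

/-- A functional of the past and a functional of the decoupled future have product expectation. -/
theorem integral_mul_coupled {𝕜 : Type*} [RCLike 𝕜] (hX : CoupledProcess P X Y K) (r : ℕ)
    {Φ Ψ : (ℕ → ℝ) → 𝕜} (hΦm : Measurable Φ) (hΨm : Measurable Ψ)
    (hΦ : ∀ x y : ℕ → ℝ, (∀ t, t ≤ r → x t = y t) → Φ x = Φ y)
    (hΨ : ∀ x y : ℕ → ℝ, (∀ t, r < t → x t = y t) → Ψ x = Ψ y) :
    ∫ ω, Φ (fun t => X t ω) * Ψ (fun t => Y r t ω) ∂P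
      = (∫ ω, Φ (fun t => X t ω) ∂P) * ∫ ω, Ψ (fun t => X t ω) ∂P := by
  rw [integral_mul_of_indepFun_restrict hX.measurable (hX.measurable_coupled r) (hX.indep r)
    hΦm hΨm hΦ hΨ, (hX.identDistrib_comp r hΨm hΨ).integral_eq]

theorem identDistrib_apply (hX : CoupledProcess P X Y K) {r t : ℕ} (h : r < t) :
    IdentDistrib (Y r t) (X t) P P :=
  hX.identDistrib_comp r (Ψ := fun x => x t) (measurable_pi_apply t) fun _ _ hxy => hxy t h

theorem memLp_coupled (hX : CoupledProcess P X Y K) {r t : ℕ} (h : r < t) :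
    MemLp (Y r t) 4 P :=
  (hX.identDistrib_apply h).memLp_iff.2 (hX.memLp t)

theorem fourth_moment_coupled (hX : CoupledProcess P X Y K) {r t : ℕ} (h : r < t) :
    ∫ ω, Y r t ω ^ 4 ∂P ≤ K ^ 4 := by
  have := ((hX.identDistrib_apply h).comp (u := fun x : ℝ => x ^ 4) (by fun_prop)).integral_eq
  simp only [Function.comp_def] at this
  rw [this]
  exact hX.fourth_moment t

theorem memLp_sum (hX : CoupledProcess P X Y K) (A : Finset ℕ) (c : ℕ → ℝ) :
    MemLp (fun ω => ∑ t ∈ A, c t * X t ω) 4 P :=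
  memLp_finsetSum _ fun t _ => (hX.memLp t).const_mul _

theorem memLp_sum_coupled (hX : CoupledProcess P X Y K) {r : ℕ} {A : Finset ℕ}
    (hA : ∀ t ∈ A, r < t) (c : ℕ → ℝ) :
    MemLp (fun ω => ∑ t ∈ A, c t * Y r t ω) 4 P :=
  memLp_finsetSum _ fun t ht => (hX.memLp_coupled (hA t ht)).const_mul _

/-- The decoupling error of a weighted sum, in `L⁴`. -/
theorem integral_sum_sub_pow_four_le (hX : CoupledProcess P X Y K) {r : ℕ} {A : Finset ℕ}
    (hA : ∀ t ∈ A, r < t) (c : ℕ → ℝ) :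
    ∫ ω, (∑ t ∈ A, c t * X t ω - ∑ t ∈ A, c t * Y r t ω) ^ 4 ∂P
      ≤ (∑ t ∈ A, |c t| * (K * lagBound (t - r))) ^ 4 := by
  simp_rw [← Finset.sum_sub_distrib, ← mul_sub]
  refine integral_sum_pow_le (n := 4) (by decide) (by decide) A
    (fun t ht => ((hX.memLp t).sub (hX.memLp_coupled (hA t ht))).const_mul _)
    (fun t _ => mul_nonneg (abs_nonneg _) (mul_nonneg hX.pos.le (lagBound_nonneg _)))
    fun t ht => ?_
  simp_rw [mul_pow (c t)]
  rw [integral_const_mul, mul_pow |c t|, Even.pow_abs (by decide)]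
  gcongr
  exact hX.coupling r t (hA t ht)

variable [IsProbabilityMeasure P]

theorem memLp_two (hX : CoupledProcess P X Y K) (t : ℕ) : MemLp (X t) 2 P :=
  (hX.memLp t).mono_exponent (by norm_num)

theorem integral_sum (hX : CoupledProcess P X Y K) (A : Finset ℕ) (c : ℕ → ℝ) :
    ∫ ω, ∑ t ∈ A, c t * X t ω ∂P = 0 := by
  rw [integral_finsetSum]
  · refine Finset.sum_eq_zero fun t _ => ?_
    rw [integral_const_mul, hX.mean_zero t, mul_zero]
  · exact fun t _ => ((hX.memLp_two t).integrable (by norm_num)).const_mul _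

theorem second_moment (hX : CoupledProcess P X Y K) (t : ℕ) : ∫ ω, X t ω ^ 2 ∂P ≤ K ^ 2 :=
  integral_sq_le_of_pow_four_le (hX.memLp t) (hX.fourth_moment t)

theorem abs_integral_mul_le_of_lt (hX : CoupledProcess P X Y K) {s t : ℕ} (h : s < t) :
    |∫ ω, X s ω * X t ω ∂P| ≤ K ^ 2 * lagBound (t - s) := by
  have h0 : ∫ ω, X s ω * Y s t ω ∂P = 0 := by
    have := hX.integral_mul_coupled s (Φ := fun x => x s) (Ψ := fun x => x t)
      (measurable_pi_apply s) (measurable_pi_apply t) (fun _ _ hxy => hxy s le_rfl)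
      (fun _ _ hxy => hxy t h)
    rw [this, hX.mean_zero, zero_mul]
  have hY2 : MemLp (Y s t) 2 P := (hX.memLp_coupled h).mono_exponent (by norm_num)
  have hd : MemLp (fun ω => X t ω - Y s t ω) 4 P := (hX.memLp t).sub (hX.memLp_coupled h)
  have e : ∫ ω, X s ω * X t ω ∂P = ∫ ω, X s ω * (X t ω - Y s t ω) ∂P := by
    have i1 : Integrable (fun ω => X s ω * X t ω) P :=
      (hX.memLp_two s).integrable_mul (hX.memLp_two t)
    have i2 : Integrable (fun ω => X s ω * Y s t ω) P := (hX.memLp_two s).integrable_mul hY2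
    simp_rw [mul_sub]
    rw [integral_sub i1 i2, h0, sub_zero]
  rw [e]
  refine (abs_integral_mul_le (hX.memLp_two s) (hd.mono_exponent (by norm_num)) hX.pos.le
    (mul_nonneg hX.pos.le (lagBound_nonneg _)) (hX.second_moment s)
    (integral_sq_le_of_pow_four_le hd (hX.coupling s t h))).trans_eq ?_
  ring

theorem abs_integral_mul_le_lagBound (hX : CoupledProcess P X Y K) (s t : ℕ) :
    |∫ ω, X s ω * X t ω ∂P| ≤ K ^ 2 * lagBound (Nat.dist s t) := by
  rcases lt_trichotomy s t with h | h | h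
  · rw [Nat.dist_eq_sub_of_le h.le]
    exact hX.abs_integral_mul_le_of_lt h
  · subst h
    rw [Nat.dist_self, show lagBound 0 = 1 by simp [lagBound], mul_one]
    refine (abs_integral_mul_le (hX.memLp_two s) (hX.memLp_two s) hX.pos.le hX.pos.le
      (hX.second_moment s) (hX.second_moment s)).trans_eq (sq K).symm
  · rw [Nat.dist_eq_sub_of_le_right h.le]
    simp_rw [mul_comm (X s _)]
    exact hX.abs_integral_mul_le_of_lt h

theorem integral_sq_sum (hX : CoupledProcess P X Y K) (A : Finset ℕ) (c : ℕ → ℝ) :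
    ∫ ω, (∑ t ∈ A, c t * X t ω) ^ 2 ∂P
      = ∑ t ∈ A, ∑ s ∈ A, c t * c s * ∫ ω, X t ω * X s ω ∂P := by
  have hi : ∀ t s, Integrable (fun ω => X t ω * X s ω) P := fun t s =>
    (hX.memLp_two t).integrable_mul (hX.memLp_two s)
  have e : ∀ ω, (∑ t ∈ A, c t * X t ω) ^ 2
      = ∑ t ∈ A, ∑ s ∈ A, c t * c s * (X t ω * X s ω) := by
    intro ω
    rw [sq, Finset.sum_mul_sum]
    refine Finset.sum_congr rfl fun t _ => Finset.sum_congr rfl fun s _ => ?_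
    ring
  simp_rw [e]
  rw [integral_finsetSum]
  · refine Finset.sum_congr rfl fun t _ => ?_
    rw [integral_finsetSum]
    · exact Finset.sum_congr rfl fun s _ => integral_const_mul _ _
    · exact fun s _ => (hi t s).const_mul _
  · exact fun t _ => integrable_finsetSum _ fun s _ => (hi t s).const_mul _

/-- Quadratic forms in the covariances are bounded by the diagonal. -/
theorem sum_sum_abs_integral_le (hX : CoupledProcess P X Y K) (A : Finset ℕ) (c : ℕ → ℝ) :
    ∑ t ∈ A, ∑ s ∈ A, |c t| * |c s| * |∫ ω, X t ω * X s ω ∂P|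
      ≤ 4 * K ^ 2 * ∑ t ∈ A, c t ^ 2 := by
  calc _ ≤ ∑ t ∈ A, ∑ s ∈ A, |c t| * |c s| * (K ^ 2 * lagBound (Nat.dist t s)) := by
        gcongr with t _ s _
        exact hX.abs_integral_mul_le_lagBound t s
    _ = K ^ 2 * ∑ t ∈ A, ∑ s ∈ A, |c t| * |c s| * lagBound (Nat.dist t s) := by
        simp_rw [Finset.mul_sum]
        refine Finset.sum_congr rfl fun t _ => Finset.sum_congr rfl fun s _ => ?_
        ring
    _ ≤ K ^ 2 * (2 * 2 * ∑ t ∈ A, c t ^ 2) := by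
        gcongr
        exact sum_sum_dist_le lagBound_nonneg sum_lagBound_le A c
    _ = _ := by ring

theorem integral_sq_sum_le (hX : CoupledProcess P X Y K) (A : Finset ℕ) (c : ℕ → ℝ) :
    ∫ ω, (∑ t ∈ A, c t * X t ω) ^ 2 ∂P ≤ 4 * K ^ 2 * ∑ t ∈ A, c t ^ 2 := by
  rw [hX.integral_sq_sum]
  refine le_trans ?_ (hX.sum_sum_abs_integral_le A c)
  refine Finset.sum_le_sum fun t _ => Finset.sum_le_sum fun s _ => ?_
  rw [← abs_mul, ← abs_mul]
  exact le_abs_self _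

end CoupledProcess

end Coupled

/-! ### Fourth moments of block sums -/

section FourthMoment

/-- Convexity with a constant close to `1` on the first summand. -/
theorem add_pow_four_le (a b : ℝ) : (a + b) ^ 4 ≤ 5 / 4 * a ^ 4 + 10000 * b ^ 4 := by
  have h1 : (a + b) ^ 2 ≤ 21 / 20 * a ^ 2 + 21 * b ^ 2 := by nlinarith [sq_nonneg (a - 20 * b)]
  have h2 : (21 / 20 * a ^ 2 + 21 * b ^ 2) ^ 2
      ≤ 21 / 20 * (21 / 20 * a ^ 2) ^ 2 + 21 * (21 * b ^ 2) ^ 2 := by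
    nlinarith [sq_nonneg (21 / 20 * a ^ 2 - 20 * (21 * b ^ 2))]
  have h3 : (a + b) ^ 4 ≤ (21 / 20 * a ^ 2 + 21 * b ^ 2) ^ 2 := by
    rw [show (a + b) ^ 4 = ((a + b) ^ 2) ^ 2 by ring]
    exact pow_le_pow_left₀ (sq_nonneg _) h1 2
  nlinarith [pow_nonneg (sq_nonneg a) 2, pow_nonneg (sq_nonneg b) 2]

variable {Ω : Type*} [MeasurableSpace Ω] {P : Measure Ω}

theorem integrable_pow_mul_pow {f g : Ω → ℝ} (hf : MemLp f 4 P) (hg : MemLp g 4 P) {i j : ℕ}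
    (hij : i + j = 4) : Integrable (fun ω => f ω ^ i * g ω ^ j) P := by
  refine ((integrable_pow_four hf).add (integrable_pow_four hg)).mono'
    ((hf.1.pow i).mul (hg.1.pow j)) (ae_of_all _ fun ω => ?_)
  simp only [Pi.add_apply, norm_mul, norm_pow, Real.norm_eq_abs]
  have e1 : f ω ^ 4 = |f ω| ^ 4 := (Even.pow_abs (by decide) _).symm
  have e2 : g ω ^ 4 = |g ω| ^ 4 := (Even.pow_abs (by decide) _).symm
  rw [e1, e2]
  rcases le_total |f ω| |g ω| with h | h
  · calc |f ω| ^ i * |g ω| ^ j ≤ |g ω| ^ i * |g ω| ^ j := by gcongr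
      _ = |g ω| ^ 4 := by rw [← pow_add, hij]
      _ ≤ _ := le_add_of_nonneg_left (by positivity)
  · calc |f ω| ^ i * |g ω| ^ j ≤ |f ω| ^ i * |f ω| ^ j := by gcongr
      _ = |f ω| ^ 4 := by rw [← pow_add, hij]
      _ ≤ _ := le_add_of_nonneg_right (by positivity)

variable [IsProbabilityMeasure P]
variable {X : ℕ → Ω → ℝ} {Y : ℕ → ℕ → Ω → ℝ} {K : ℝ}

namespace CoupledProcess

/-- The fourth moment of the sum of a past block and of a decoupled future block. -/
theorem integral_add_coupled_pow_four (hX : CoupledProcess P X Y K) {r : ℕ} {A A' : Finset ℕ}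
    (hA : ∀ t ∈ A, t ≤ r) (hA' : ∀ t ∈ A', r < t) (c : ℕ → ℝ) :
    ∫ ω, (∑ t ∈ A, c t * X t ω + ∑ t ∈ A', c t * Y r t ω) ^ 4 ∂P
      = ∫ ω, (∑ t ∈ A, c t * X t ω) ^ 4 ∂P
        + 6 * ((∫ ω, (∑ t ∈ A, c t * X t ω) ^ 2 ∂P) * ∫ ω, (∑ t ∈ A', c t * X t ω) ^ 2 ∂P)
        + ∫ ω, (∑ t ∈ A', c t * X t ω) ^ 4 ∂P := by
  set S : Ω → ℝ := fun ω => ∑ t ∈ A, c t * X t ω with hS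
  set T : Ω → ℝ := fun ω => ∑ t ∈ A', c t * X t ω with hT
  set T' : Ω → ℝ := fun ω => ∑ t ∈ A', c t * Y r t ω with hT'
  have hSm : MemLp S 4 P := hX.memLp_sum A c
  have hTm : MemLp T' 4 P := hX.memLp_sum_coupled hA' c
  have key : ∀ i j : ℕ, ∫ ω, S ω ^ i * T' ω ^ j ∂P = (∫ ω, S ω ^ i ∂P) * ∫ ω, T ω ^ j ∂P := by
    intro i j
    refine hX.integral_mul_coupled r (Φ := fun x => (∑ t ∈ A, c t * x t) ^ i)
      (Ψ := fun x => (∑ t ∈ A', c t * x t) ^ j) (by fun_prop) (by fun_prop) ?_ ?_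
    · intro x y hxy
      rw [Finset.sum_congr rfl fun t ht => by rw [hxy t (hA t ht)]]
    · intro x y hxy
      rw [Finset.sum_congr rfl fun t ht => by rw [hxy t (hA' t ht)]]
  have hS0 : ∫ ω, S ω ^ 1 ∂P = 0 := by simpa using hX.integral_sum A c
  have hT0 : ∫ ω, T ω ^ 1 ∂P = 0 := by simpa using hX.integral_sum A' c
  have e : ∀ ω, (S ω + T' ω) ^ 4 = S ω ^ 4 * T' ω ^ 0 + 4 * (S ω ^ 3 * T' ω ^ 1)
      + 6 * (S ω ^ 2 * T' ω ^ 2) + 4 * (S ω ^ 1 * T' ω ^ 3) + S ω ^ 0 * T' ω ^ 4 :=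
    fun ω => by ring
  have i40 := integrable_pow_mul_pow hSm hTm (i := 4) (j := 0) (by norm_num)
  have i31 := (integrable_pow_mul_pow hSm hTm (i := 3) (j := 1) (by norm_num)).const_mul 4
  have i22 := (integrable_pow_mul_pow hSm hTm (i := 2) (j := 2) (by norm_num)).const_mul 6
  have i13 := (integrable_pow_mul_pow hSm hTm (i := 1) (j := 3) (by norm_num)).const_mul 4
  have i04 := integrable_pow_mul_pow hSm hTm (i := 0) (j := 4) (by norm_num)
  change ∫ ω, (S ω + T' ω) ^ 4 ∂P = ∫ ω, S ω ^ 4 ∂P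
    + 6 * ((∫ ω, S ω ^ 2 ∂P) * ∫ ω, T ω ^ 2 ∂P) + ∫ ω, T ω ^ 4 ∂P
  simp_rw [e]
  rw [integral_add (by exact ((i40.add i31).add i22).add i13) i04,
    integral_add (by exact (i40.add i31).add i22) i13, integral_add (by exact i40.add i31) i22,
    integral_add i40 i31, integral_const_mul, integral_const_mul, integral_const_mul,
    key, key, key, key, key, hS0, hT0]
  simp

/-- Rosenthal type bound: with arbitrary weights, the fourth moment of a sum over `n` consecutive
dates is of the order `n ∑ c_t⁴`. The proof halves the block: after decoupling the second half from
the first, the fourth moments of the halves add up, which gains a factor less than `1`; the cross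
term and the decoupling error are of the right order. -/
theorem integral_sum_Ico_pow_four_le (hX : CoupledProcess P X Y K) (c : ℕ → ℝ) (n : ℕ) :
    ∀ a : ℕ, ∫ ω, (∑ t ∈ Finset.Ico a (a + n), c t * X t ω) ^ 4 ∂P
      ≤ 10 ^ 6 * K ^ 4 * (n * ∑ t ∈ Finset.Ico a (a + n), c t ^ 4) := by
  induction n using Nat.strong_induction_on with
  | _ n ih =>
  intro a
  have hK := hX.pos
  rcases Nat.lt_or_ge n 2 with hn | hn
  · interval_cases n
    · simp
    · simp only [Nat.Ico_succ_singleton, Finset.sum_singleton, mul_pow, Nat.cast_one, one_mul]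
      rw [integral_const_mul]
      have := hX.fourth_moment a
      have h4 : 0 ≤ c a ^ 4 := by positivity
      have hk4 : 0 ≤ K ^ 4 := by positivity
      nlinarith [mul_le_mul_of_nonneg_left this h4, mul_nonneg h4 hk4]
  obtain ⟨h, m, hnm, hh, hh3, hm3⟩ : ∃ h m : ℕ, n = h + m ∧ 0 < h ∧ 3 * h ≤ 2 * n ∧ 3 * m ≤ 2 * n :=
    ⟨n / 2, n - n / 2, by omega, by omega, by omega, by omega⟩
  have hm0 : 0 < m := by omega
  set r := a + h - 1 with hr
  set A := Finset.Ico a (a + h) with hAdef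
  set A' := Finset.Ico (a + h) (a + h + m) with hA'def
  have hA : ∀ t ∈ A, t ≤ r := fun t ht => by have := Finset.mem_Ico.1 ht; omega
  have hA' : ∀ t ∈ A', r < t := fun t ht => by have := Finset.mem_Ico.1 ht; omega
  have hsum : ∀ f : ℕ → ℝ, ∑ t ∈ Finset.Ico a (a + n), f t = ∑ t ∈ A, f t + ∑ t ∈ A', f t := by
    intro f
    rw [hnm, ← add_assoc]
    exact (Finset.sum_Ico_consecutive f (by omega) (by omega)).symm
  simp_rw [hsum]
  set F := ∑ t ∈ A, c t ^ 4
  set F' := ∑ t ∈ A', c t ^ 4 with hF'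
  set Q := ∑ t ∈ A, c t ^ 2
  set Q' := ∑ t ∈ A', c t ^ 2
  have hF0 : 0 ≤ F := Finset.sum_nonneg fun t _ => by positivity
  have hF'0 : 0 ≤ F' := Finset.sum_nonneg fun t _ => by positivity
  have hQ0 : 0 ≤ Q := Finset.sum_nonneg fun t _ => by positivity
  have hQ'0 : 0 ≤ Q' := Finset.sum_nonneg fun t _ => by positivity
  have ih1 := ih h (by omega) a
  have ih2 := ih m (by omega) (a + h)
  have hQF : Q ^ 2 ≤ h * F := by
    have := sq_sum_le_card_mul_sum_sq (s := A) (f := fun t => c t ^ 2)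
    simpa [hAdef, ← pow_mul] using this
  have hQF' : Q' ^ 2 ≤ m * F' := by
    have := sq_sum_le_card_mul_sum_sq (s := A') (f := fun t => c t ^ 2)
    simpa [hA'def, ← pow_mul] using this
  have hs1 := hX.integral_sq_sum_le A c
  have hs2 := hX.integral_sq_sum_le A' c
  -- the decoupling error, with `|c t| ≤ F' ^ (1 / 4)`
  have herr : ∫ ω, (∑ t ∈ A', c t * X t ω - ∑ t ∈ A', c t * Y r t ω) ^ 4 ∂P
      ≤ 16 * K ^ 4 * F' := by
    set b := √(√F') with hb
    have hb4 : b ^ 4 = F' := by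
      rw [show b ^ 4 = (b ^ 2) ^ 2 by ring, Real.sq_sqrt (Real.sqrt_nonneg _), Real.sq_sqrt hF'0]
    have hcb : ∀ t ∈ A', |c t| ≤ b := by
      intro t ht
      refine (pow_le_pow_iff_left₀ (abs_nonneg _) (Real.sqrt_nonneg _) (by norm_num : 4 ≠ 0)).1 ?_
      rw [hb4, Even.pow_abs (by decide)]
      exact Finset.single_le_sum (f := fun t => c t ^ 4) (fun t _ => by positivity) ht
    refine (hX.integral_sum_sub_pow_four_le hA' c).trans ?_
    have h1 : ∑ t ∈ A', |c t| * (K * lagBound (t - r)) ≤ b * (K * 2) := by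
      calc _ ≤ ∑ t ∈ A', b * (K * lagBound (t - r)) := by
            refine Finset.sum_le_sum fun t ht => mul_le_mul_of_nonneg_right (hcb t ht) ?_
            exact mul_nonneg hK.le (lagBound_nonneg _)
        _ = b * (K * ∑ t ∈ A', lagBound (t - r)) := by rw [Finset.mul_sum, Finset.mul_sum]
        _ ≤ _ := by
            have hb0 : 0 ≤ b := Real.sqrt_nonneg _
            gcongr
            have hinj : Set.InjOn (fun t => t - r) (A' : Set ℕ) := by
              intro x hx y hy hxy
              have h1 := hA' x hx
              have h2 := hA' y hy
              simp only at hxy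
              omega
            rw [← Finset.sum_image (f := lagBound) hinj]
            refine le_trans ?_ (sum_lagBound_le (m + 1))
            refine Finset.sum_le_sum_of_subset_of_nonneg (fun k hk => ?_)
              fun k _ _ => lagBound_nonneg k
            obtain ⟨t, ht, rfl⟩ := Finset.mem_image.1 hk
            have := Finset.mem_Ico.1 ht
            rw [Finset.mem_range]
            omega
    have h0 : 0 ≤ ∑ t ∈ A', |c t| * (K * lagBound (t - r)) :=
      Finset.sum_nonneg fun t _ =>
        mul_nonneg (abs_nonneg _) (mul_nonneg hK.le (lagBound_nonneg _))
    refine (pow_le_pow_left₀ h0 h1 4).trans_eq ?_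
    rw [mul_pow, mul_pow, hb4]
    ring
  have hmain : ∫ ω, (∑ t ∈ A, c t * X t ω + ∑ t ∈ A', c t * X t ω) ^ 4 ∂P
      ≤ 5 / 4 * ∫ ω, (∑ t ∈ A, c t * X t ω + ∑ t ∈ A', c t * Y r t ω) ^ 4 ∂P
        + 10000 * ∫ ω, (∑ t ∈ A', c t * X t ω - ∑ t ∈ A', c t * Y r t ω) ^ 4 ∂P := by
    have i1 : Integrable (fun ω => (∑ t ∈ A, c t * X t ω + ∑ t ∈ A', c t * Y r t ω) ^ 4) P :=
      integrable_pow_four ((hX.memLp_sum A c).add (hX.memLp_sum_coupled hA' c))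
    have i2 : Integrable (fun ω => (∑ t ∈ A', c t * X t ω - ∑ t ∈ A', c t * Y r t ω) ^ 4) P :=
      integrable_pow_four ((hX.memLp_sum A' c).sub (hX.memLp_sum_coupled hA' c))
    have i3 : Integrable (fun ω => (∑ t ∈ A, c t * X t ω + ∑ t ∈ A', c t * X t ω) ^ 4) P :=
      integrable_pow_four ((hX.memLp_sum A c).add (hX.memLp_sum A' c))
    rw [← integral_const_mul, ← integral_const_mul, ← integral_add (i1.const_mul _) (i2.const_mul _)]
    refine integral_mono i3 ((i1.const_mul _).add (i2.const_mul _)) fun ω => ?_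
    refine le_trans (le_of_eq ?_) (add_pow_four_le _ _)
    ring
  rw [hX.integral_add_coupled_pow_four hA hA' c] at hmain
  have hS2 : 0 ≤ ∫ ω, (∑ t ∈ A, c t * X t ω) ^ 2 ∂P := integral_nonneg fun ω => sq_nonneg _
  have hcross : (∫ ω, (∑ t ∈ A, c t * X t ω) ^ 2 ∂P) * ∫ ω, (∑ t ∈ A', c t * X t ω) ^ 2 ∂P
      ≤ 8 * K ^ 4 * (h * F + m * F') := by
    calc _ ≤ (4 * K ^ 2 * Q) * (4 * K ^ 2 * Q') :=
          mul_le_mul hs1 hs2 (integral_nonneg fun ω => sq_nonneg _) (by positivity)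
      _ = 16 * K ^ 4 * (Q * Q') := by ring
      _ ≤ 16 * K ^ 4 * ((h * F + m * F') / 2) := by
          gcongr
          nlinarith [sq_nonneg (Q - Q')]
      _ = _ := by ring
  have hnr : (n : ℝ) = h + m := by exact_mod_cast hnm
  have hh3' : 3 * (h : ℝ) ≤ 2 * n := by exact_mod_cast hh3
  have hm3' : 3 * (m : ℝ) ≤ 2 * n := by exact_mod_cast hm3
  have hn1 : (1 : ℝ) ≤ n := by exact_mod_cast (by omega : 1 ≤ n)
  have g1 : (h : ℝ) * F + m * F' ≤ 2 / 3 * (n * (F + F')) := by nlinarith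
  have g2 : F' ≤ n * (F + F') := by nlinarith
  have hK4 : 0 ≤ K ^ 4 := by positivity
  have g1' := mul_le_mul_of_nonneg_left g1 hK4
  have g2' := mul_le_mul_of_nonneg_left g2 hK4
  nlinarith [mul_nonneg hK4 (by positivity : 0 ≤ (n : ℝ) * (F + F'))]

end CoupledProcess

end FourthMoment

/-! ### Big blocks and gaps -/

section Blocks

/-- The `j`-th big block: `L` consecutive dates, followed by a gap of `q` dates. -/
def bigBlock (L q j : ℕ) : Finset ℕ := Finset.Ico (j * (L + q)) (j * (L + q) + L)

/-- The gap that follows the `j`-th big block. -/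
def gapBlock (L q j : ℕ) : Finset ℕ := Finset.Ico (j * (L + q) + L) (j * (L + q) + L + q)

/-- The union of the first `J` big blocks. -/
def bigBlocks (L q J : ℕ) : Finset ℕ := (Finset.range J).biUnion (bigBlock L q)

/-- The union of the first `J` gaps. -/
def gapBlocks (L q J : ℕ) : Finset ℕ := (Finset.range J).biUnion (gapBlock L q)

theorem card_bigBlock (L q j : ℕ) : (bigBlock L q j).card = L := by simp [bigBlock]

theorem card_gapBlocks_le (L q J : ℕ) : (gapBlocks L q J).card ≤ J * q := by
  refine Finset.card_biUnion_le.trans ?_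
  simp [gapBlock]

theorem card_bigBlocks_le (L q J : ℕ) : (bigBlocks L q J).card ≤ J * L := by
  refine Finset.card_biUnion_le.trans ?_
  simp [bigBlock]

theorem add_mul_le_mul_of_lt {i j m : ℕ} (h : i < j) : i * m + m ≤ j * m := by
  rw [← Nat.succ_mul]
  exact Nat.mul_le_mul_right m h

theorem sum_bigBlocks (L q J : ℕ) (f : ℕ → ℝ) :
    ∑ t ∈ bigBlocks L q J, f t = ∑ j ∈ Finset.range J, ∑ t ∈ bigBlock L q j, f t := by
  refine Finset.sum_biUnion fun i _ j _ hij => Finset.disjoint_left.2 fun t hi hj => ?_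
  have h1 := Finset.mem_Ico.1 hi
  have h2 := Finset.mem_Ico.1 hj
  rcases lt_or_gt_of_ne hij with h | h <;> have := add_mul_le_mul_of_lt (m := L + q) h <;> omega

theorem sum_gapBlocks (L q J : ℕ) (f : ℕ → ℝ) :
    ∑ t ∈ gapBlocks L q J, f t = ∑ j ∈ Finset.range J, ∑ t ∈ gapBlock L q j, f t := by
  refine Finset.sum_biUnion fun i _ j _ hij => Finset.disjoint_left.2 fun t hi hj => ?_
  have h1 := Finset.mem_Ico.1 hi
  have h2 := Finset.mem_Ico.1 hj
  rcases lt_or_gt_of_ne hij with h | h <;> have := add_mul_le_mul_of_lt (m := L + q) h <;> omega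

theorem sum_range_eq_blocks (L q J : ℕ) (f : ℕ → ℝ) :
    ∑ t ∈ Finset.range (J * (L + q)), f t
      = ∑ j ∈ Finset.range J, ∑ t ∈ bigBlock L q j, f t + ∑ t ∈ gapBlocks L q J, f t := by
  rw [sum_gapBlocks, ← Finset.sum_add_distrib]
  induction J with
  | zero => simp
  | succ J ih =>
    rw [Finset.sum_range_succ, ← ih, bigBlock, gapBlock,
      Finset.sum_Ico_consecutive f (by omega) (by omega), Finset.range_eq_Ico, Finset.range_eq_Ico,
      Finset.sum_Ico_consecutive f (by omega) (by omega)]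
    congr 2
    ring

/-- The last date before the gap that precedes the `j`-th big block, for `0 < j`. -/
def cutDate (L q j : ℕ) : ℕ := j * (L + q) - q - 1

theorem le_cutDate {L q j t : ℕ} (ht : t ∈ bigBlocks L q j) : t ≤ cutDate L q j := by
  obtain ⟨i, hi, hit⟩ := Finset.mem_biUnion.1 ht
  have h1 := Finset.mem_Ico.1 hit
  have h2 := add_mul_le_mul_of_lt (m := L + q) (Finset.mem_range.1 hi)
  unfold cutDate
  omega

theorem cutDate_add_lt {L q j t : ℕ} (hL : 0 < L) (hj : 0 < j) (ht : t ∈ bigBlock L q j) :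
    cutDate L q j + q < t := by
  have h1 := Finset.mem_Ico.1 ht
  have h2 := add_mul_le_mul_of_lt (m := L + q) hj
  unfold cutDate
  omega

end Blocks

/-! ### Decoupling of weighted sums over blocks -/

section Decoupling

theorem lagBound_anti {m n : ℕ} (h : m ≤ n) : lagBound n ≤ lagBound m := by
  unfold lagBound
  gcongr

variable {Ω : Type*} [MeasurableSpace Ω] {P : Measure Ω} [IsProbabilityMeasure P]
variable {X : ℕ → Ω → ℝ} {Y : ℕ → ℕ → Ω → ℝ} {K : ℝ}

theorem sum_sq_le_card_mul {A : Finset ℕ} {w : ℕ → ℝ} {b : ℝ} (hw : ∀ t, |w t| ≤ b) {n : ℕ}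
    (hA : A.card ≤ n) : ∑ t ∈ A, w t ^ 2 ≤ n * b ^ 2 := by
  have h : ∀ t ∈ A, w t ^ 2 ≤ b ^ 2 := fun t _ => by
    rw [← sq_abs]; exact pow_le_pow_left₀ (abs_nonneg _) (hw t) 2
  refine (Finset.sum_le_card_nsmul A _ _ h).trans ?_
  rw [nsmul_eq_mul]
  have : (A.card : ℝ) ≤ n := by exact_mod_cast hA
  gcongr

namespace CoupledProcess

theorem integral_sq_sum_le_card (hX : CoupledProcess P X Y K) {w : ℕ → ℝ} {b : ℝ}
    (hw : ∀ t, |w t| ≤ b) {A : Finset ℕ} {n : ℕ} (hA : A.card ≤ n) :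
    ∫ ω, (∑ t ∈ A, w t * X t ω) ^ 2 ∂P ≤ 4 * K ^ 2 * (n * b ^ 2) := by
  refine (hX.integral_sq_sum_le A w).trans ?_
  gcongr
  exact sum_sq_le_card_mul hw hA

/-- The second moment of the decoupling error across a gap of length `q`. -/
theorem integral_sum_sub_sq_le (hX : CoupledProcess P X Y K) {w : ℕ → ℝ} {b : ℝ}
    (hw : ∀ t, |w t| ≤ b) {r q L : ℕ} {A : Finset ℕ} (hA : ∀ t ∈ A, r + q < t)
    (hc : A.card ≤ L) :
    ∫ ω, (∑ t ∈ A, w t * X t ω - ∑ t ∈ A, w t * Y r t ω) ^ 2 ∂P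
      ≤ (L * (b * (K * lagBound q))) ^ 2 := by
  have hA' : ∀ t ∈ A, r < t := fun t ht => by have := hA t ht; omega
  have hb : 0 ≤ b := (abs_nonneg _).trans (hw 0)
  have hKq : ∀ m, 0 ≤ K * lagBound m := fun m => mul_nonneg hX.pos.le (lagBound_nonneg m)
  refine integral_sq_le_of_pow_four_le ((hX.memLp_sum A w).sub (hX.memLp_sum_coupled hA' w)) ?_
  refine (hX.integral_sum_sub_pow_four_le hA' w).trans ?_
  refine pow_le_pow_left₀ (Finset.sum_nonneg fun t _ => mul_nonneg (abs_nonneg _) (hKq _)) ?_ 4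
  calc ∑ t ∈ A, |w t| * (K * lagBound (t - r)) ≤ ∑ t ∈ A, b * (K * lagBound q) := by
        refine Finset.sum_le_sum fun t ht => mul_le_mul (hw t) ?_ (hKq _) hb
        refine mul_le_mul_of_nonneg_left (lagBound_anti ?_) hX.pos.le
        have := hA t ht
        omega
    _ = A.card * (b * (K * lagBound q)) := by rw [Finset.sum_const, nsmul_eq_mul]
    _ ≤ _ := by
        have : (A.card : ℝ) ≤ L := by exact_mod_cast hc
        exact mul_le_mul_of_nonneg_right this (mul_nonneg hb (hKq q))

/-- Across a gap, the characteristic function of a sum nearly factorises. -/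
theorem norm_expChar_add_sub_mul_le (hX : CoupledProcess P X Y K) {w : ℕ → ℝ} {b : ℝ}
    (hw : ∀ t, |w t| ≤ b) {r q L : ℕ} {A A' : Finset ℕ} (hA : ∀ t ∈ A, t ≤ r)
    (hA' : ∀ t ∈ A', r + q < t) (hc : A'.card ≤ L) (x : ℝ) :
    ‖expChar P (fun ω => ∑ t ∈ A, w t * X t ω + ∑ t ∈ A', w t * X t ω) x
      - expChar P (fun ω => ∑ t ∈ A, w t * X t ω) x * expChar P (fun ω => ∑ t ∈ A', w t * X t ω) x‖
      ≤ |x| * (L * (b * (K * lagBound q))) := by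
  have hb : 0 ≤ b := (abs_nonneg _).trans (hw 0)
  have hr : ∀ t ∈ A', r < t := fun t ht => by have := hA' t ht; omega
  have hS := (hX.memLp_sum A w).integrable (by norm_num)
  have hT := (hX.memLp_sum A' w).integrable (by norm_num)
  have hT' := (hX.memLp_sum_coupled hr w).integrable (by norm_num)
  have hprod : expChar P (fun ω => ∑ t ∈ A, w t * X t ω) x
      * expChar P (fun ω => ∑ t ∈ A', w t * X t ω) x
      = expChar P (fun ω => ∑ t ∈ A, w t * X t ω + ∑ t ∈ A', w t * Y r t ω) x := by
    have := hX.integral_mul_coupled r (𝕜 := ℂ)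
      (Φ := fun y => Complex.exp (((x * ∑ t ∈ A, w t * y t : ℝ) : ℂ) * Complex.I))
      (Ψ := fun y => Complex.exp (((x * ∑ t ∈ A', w t * y t : ℝ) : ℂ) * Complex.I))
      (by fun_prop) (by fun_prop)
      (fun y z hyz => by rw [Finset.sum_congr rfl fun t ht => by rw [hyz t (hA t ht)]])
      (fun y z hyz => by rw [Finset.sum_congr rfl fun t ht => by rw [hyz t (hr t ht)]])
    unfold expChar
    rw [← this]
    refine integral_congr_ae (ae_of_all _ fun ω => ?_)
    simp only
    rw [← Complex.exp_add, ← add_mul, ← Complex.ofReal_add, ← mul_add]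
  rw [hprod]
  refine (norm_expChar_sub_le (hS.add hT) (hS.add hT') x).trans ?_
  gcongr
  simp only [Pi.add_apply, add_sub_add_left_eq_sub]
  refine integral_abs_le_of_sq_le
    (((hX.memLp_sum A' w).sub (hX.memLp_sum_coupled hr w)).mono_exponent (by norm_num)) ?_
    (hX.integral_sum_sub_sq_le hw hA' hc)
  exact mul_nonneg (Nat.cast_nonneg _)
    (mul_nonneg hb (mul_nonneg hX.pos.le (lagBound_nonneg q)))

/-- Across a gap, sums are nearly uncorrelated. -/
theorem abs_integral_sum_mul_sum_le (hX : CoupledProcess P X Y K) {w : ℕ → ℝ} {b : ℝ}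
    (hw : ∀ t, |w t| ≤ b) {r q L : ℕ} {A A' : Finset ℕ} (hA : ∀ t ∈ A, t ≤ r)
    (hA' : ∀ t ∈ A', r + q < t) (hc : A'.card ≤ L) {M : ℝ} (hM : 0 ≤ M)
    (hAM : ∫ ω, (∑ t ∈ A, w t * X t ω) ^ 2 ∂P ≤ M ^ 2) :
    |∫ ω, (∑ t ∈ A, w t * X t ω) * (∑ t ∈ A', w t * X t ω) ∂P|
      ≤ M * (L * (b * (K * lagBound q))) := by
  have hb : 0 ≤ b := (abs_nonneg _).trans (hw 0)
  have hr : ∀ t ∈ A', r < t := fun t ht => by have := hA' t ht; omega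
  have hS : MemLp (fun ω => ∑ t ∈ A, w t * X t ω) 2 P :=
    (hX.memLp_sum A w).mono_exponent (by norm_num)
  have hT : MemLp (fun ω => ∑ t ∈ A', w t * X t ω) 2 P :=
    (hX.memLp_sum A' w).mono_exponent (by norm_num)
  have hT' : MemLp (fun ω => ∑ t ∈ A', w t * Y r t ω) 2 P :=
    (hX.memLp_sum_coupled hr w).mono_exponent (by norm_num)
  have h0 : ∫ ω, (∑ t ∈ A, w t * X t ω) * (∑ t ∈ A', w t * Y r t ω) ∂P = 0 := by
    have := hX.integral_mul_coupled r (Φ := fun y => ∑ t ∈ A, w t * y t)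
      (Ψ := fun y => ∑ t ∈ A', w t * y t) (by fun_prop) (by fun_prop)
      (fun y z hyz => Finset.sum_congr rfl fun t ht => by rw [hyz t (hA t ht)])
      (fun y z hyz => Finset.sum_congr rfl fun t ht => by rw [hyz t (hr t ht)])
    rw [this, hX.integral_sum, zero_mul]
  have i1 : Integrable (fun ω => (∑ t ∈ A, w t * X t ω) * (∑ t ∈ A', w t * X t ω)) P :=
    hS.integrable_mul hT
  have i2 : Integrable (fun ω => (∑ t ∈ A, w t * X t ω) * (∑ t ∈ A', w t * Y r t ω)) P :=
    hS.integrable_mul hT'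
  have e : ∫ ω, (∑ t ∈ A, w t * X t ω) * (∑ t ∈ A', w t * X t ω) ∂P
      = ∫ ω, (∑ t ∈ A, w t * X t ω) * (∑ t ∈ A', w t * X t ω - ∑ t ∈ A', w t * Y r t ω) ∂P := by
    simp_rw [mul_sub (∑ t ∈ A, w t * X t _)]
    rw [integral_sub i1 i2, h0, sub_zero]
  rw [e]
  exact abs_integral_mul_le hS (hT.sub hT') hM
    (mul_nonneg (Nat.cast_nonneg _) (mul_nonneg hb (mul_nonneg hX.pos.le (lagBound_nonneg q))))
    hAM (hX.integral_sum_sub_sq_le hw hA' hc)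

/-- The sum of the variances of the weighted sums over the first `J` big blocks. -/
noncomputable def _root_.blockVariance (P : Measure Ω) (X : ℕ → Ω → ℝ) (w : ℕ → ℝ)
    (L q J : ℕ) : ℝ :=
  ∑ j ∈ Finset.range J, ∫ ω, (∑ t ∈ bigBlock L q j, w t * X t ω) ^ 2 ∂P

theorem blockVariance_le (hX : CoupledProcess P X Y K) {w : ℕ → ℝ} {b : ℝ}
    (hw : ∀ t, |w t| ≤ b) (L q J : ℕ) :
    blockVariance P X w L q J ≤ 4 * K ^ 2 * (J * L * b ^ 2) := by
  refine (Finset.sum_le_card_nsmul _ _ _ fun j _ =>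
    hX.integral_sq_sum_le_card hw (card_bigBlock L q j).le).trans_eq ?_
  rw [Finset.card_range, nsmul_eq_mul]
  ring

/-- The variance of a sum over all dates is at most twice the sum of the block variances, up to
the contributions of the gaps and of the correlations between blocks. -/
theorem integral_sq_sum_range_le (hX : CoupledProcess P X Y K) {w : ℕ → ℝ} {b : ℝ}
    (hw : ∀ t, |w t| ≤ b) {L : ℕ} (hL : 0 < L) (q J : ℕ) {M : ℝ} (hM : 0 ≤ M)
    (hJM : 4 * K ^ 2 * (J * L * b ^ 2) ≤ M ^ 2) :
    ∫ ω, (∑ t ∈ Finset.range (J * (L + q)), w t * X t ω) ^ 2 ∂P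
      ≤ 2 * blockVariance P X w L q J + 4 * (J * (M * (L * (b * (K * lagBound q)))))
        + 8 * K ^ 2 * (J * q * b ^ 2) := by
  have hb : 0 ≤ b := (abs_nonneg _).trans (hw 0)
  have hK := hX.pos
  have he : 0 ≤ M * (L * (b * (K * lagBound q))) :=
    mul_nonneg hM (mul_nonneg (Nat.cast_nonneg _)
      (mul_nonneg hb (mul_nonneg hK.le (lagBound_nonneg q))))
  have hind : ∀ j ≤ J, ∫ ω, (∑ t ∈ bigBlocks L q j, w t * X t ω) ^ 2 ∂P
      ≤ blockVariance P X w L q j + 2 * (j * (M * (L * (b * (K * lagBound q))))) := by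
    intro j hj
    induction j with
    | zero => simp [bigBlocks, blockVariance]
    | succ j ih =>
      have ih := ih (by omega)
      have hS : MemLp (fun ω => ∑ t ∈ bigBlocks L q j, w t * X t ω) 2 P :=
        (hX.memLp_sum _ w).mono_exponent (by norm_num)
      have hT : MemLp (fun ω => ∑ t ∈ bigBlock L q j, w t * X t ω) 2 P :=
        (hX.memLp_sum _ w).mono_exponent (by norm_num)
      have hcross : |∫ ω, (∑ t ∈ bigBlocks L q j, w t * X t ω)
          * (∑ t ∈ bigBlock L q j, w t * X t ω) ∂P| ≤ M * (L * (b * (K * lagBound q))) := by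
        rcases Nat.eq_zero_or_pos j with rfl | hj0
        · simpa [bigBlocks] using he
        · refine hX.abs_integral_sum_mul_sum_le hw (fun t ht => le_cutDate ht)
            (fun t ht => cutDate_add_lt hL hj0 ht) (card_bigBlock L q j).le hM ?_
          refine (hX.integral_sq_sum_le_card hw (card_bigBlocks_le L q j)).trans (le_trans ?_ hJM)
          have : (j : ℝ) ≤ J := by exact_mod_cast (by omega : j ≤ J)
          push_cast
          gcongr
      have hexp : ∫ ω, (∑ t ∈ bigBlocks L q (j + 1), w t * X t ω) ^ 2 ∂P
          = ∫ ω, (∑ t ∈ bigBlocks L q j, w t * X t ω) ^ 2 ∂P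
            + 2 * ∫ ω, (∑ t ∈ bigBlocks L q j, w t * X t ω)
              * (∑ t ∈ bigBlock L q j, w t * X t ω) ∂P
            + ∫ ω, (∑ t ∈ bigBlock L q j, w t * X t ω) ^ 2 ∂P := by
        have i1 : Integrable (fun ω => (∑ t ∈ bigBlocks L q j, w t * X t ω)
          * (∑ t ∈ bigBlock L q j, w t * X t ω)) P := hS.integrable_mul hT
        have i2 : Integrable (fun ω => (∑ t ∈ bigBlocks L q j, w t * X t ω) ^ 2
          + 2 * ((∑ t ∈ bigBlocks L q j, w t * X t ω)
            * (∑ t ∈ bigBlock L q j, w t * X t ω))) P :=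
          hS.integrable_sq.add (i1.const_mul 2)
        rw [← integral_const_mul, ← integral_add hS.integrable_sq (i1.const_mul 2),
          ← integral_add i2 hT.integrable_sq]
        refine integral_congr_ae (ae_of_all _ fun ω => ?_)
        simp only [sum_bigBlocks, Finset.sum_range_succ]
        ring
      have := (abs_le.1 hcross).2
      rw [hexp, blockVariance, Finset.sum_range_succ, ← blockVariance]
      push_cast
      linarith
  have hS : MemLp (fun ω => ∑ t ∈ bigBlocks L q J, w t * X t ω) 2 P :=
    (hX.memLp_sum _ w).mono_exponent (by norm_num)
  have hR : MemLp (fun ω => ∑ t ∈ gapBlocks L q J, w t * X t ω) 2 P :=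
    (hX.memLp_sum _ w).mono_exponent (by norm_num)
  have h1 : ∫ ω, (∑ t ∈ Finset.range (J * (L + q)), w t * X t ω) ^ 2 ∂P
      ≤ 2 * ∫ ω, (∑ t ∈ bigBlocks L q J, w t * X t ω) ^ 2 ∂P
        + 2 * ∫ ω, (∑ t ∈ gapBlocks L q J, w t * X t ω) ^ 2 ∂P := by
    rw [← integral_const_mul, ← integral_const_mul,
      ← integral_add (hS.integrable_sq.const_mul 2) (hR.integrable_sq.const_mul 2)]
    refine integral_mono
      ((hX.memLp_sum (Finset.range (J * (L + q))) w).mono_exponent (by norm_num)).integrable_sq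
      ((hS.integrable_sq.const_mul 2).add (hR.integrable_sq.const_mul 2)) fun ω => ?_
    simp only
    rw [sum_range_eq_blocks, ← sum_bigBlocks]
    nlinarith [sq_nonneg (∑ t ∈ bigBlocks L q J, w t * X t ω
      - ∑ t ∈ gapBlocks L q J, w t * X t ω)]
  have h2 := hind J le_rfl
  have h3 := hX.integral_sq_sum_le_card hw (card_gapBlocks_le L q J)
  push_cast at h3
  linarith

theorem sum_integral_pow_four_le (hX : CoupledProcess P X Y K) {w : ℕ → ℝ} {b : ℝ}
    (hw : ∀ t, |w t| ≤ b) (L q J : ℕ) :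
    ∑ j ∈ Finset.range J, ∫ ω, (∑ t ∈ bigBlock L q j, w t * X t ω) ^ 4 ∂P
      ≤ 10 ^ 6 * K ^ 4 * (J * L ^ 2 * b ^ 4) := by
  have h : ∀ j ∈ Finset.range J, ∫ ω, (∑ t ∈ bigBlock L q j, w t * X t ω) ^ 4 ∂P
      ≤ 10 ^ 6 * K ^ 4 * (L * (L * b ^ 4)) := by
    intro j _
    refine (hX.integral_sum_Ico_pow_four_le w L (j * (L + q))).trans ?_
    gcongr
    have h4 : ∀ t ∈ bigBlock L q j, w t ^ 4 ≤ b ^ 4 := fun t _ => by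
      rw [← Even.pow_abs (by decide)]; exact pow_le_pow_left₀ (abs_nonneg _) (hw t) 4
    refine (Finset.sum_le_card_nsmul _ _ _ h4).trans_eq ?_
    rw [card_bigBlock, nsmul_eq_mul]
  refine (Finset.sum_le_card_nsmul _ _ _ h).trans_eq ?_
  rw [Finset.card_range, nsmul_eq_mul]
  ring

/-- Gaussian approximation of the weighted sum of a weakly dependent process. -/
theorem norm_expChar_sum_range_sub_exp_le (hX : CoupledProcess P X Y K) {w : ℕ → ℝ} {b : ℝ}
    (hw : ∀ t, |w t| ≤ b) {L : ℕ} (hL : 0 < L) (q J : ℕ) {κ : ℝ} (hκ : 0 < κ) (hκ1 : κ ≤ 1)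
    (x : ℝ) :
    ‖expChar P (fun ω => ∑ t ∈ Finset.range (J * (L + q)), w t * X t ω) x
      - ((Real.exp (-(x ^ 2 * blockVariance P X w L q J / 2)) : ℝ) : ℂ)‖
      ≤ (1 + x ^ 4) * (κ + 4 * K ^ 2 * (J * q * b ^ 2) / κ + J * (L * (b * (K * lagBound q)))
        + 5 * (κ * (4 * K ^ 2 * (J * L * b ^ 2)))
        + 5 * (10 ^ 6 * K ^ 4 * (J * L ^ 2 * b ^ 4) / κ)) := by
  have hb : 0 ≤ b := (abs_nonneg _).trans (hw 0)
  have he : 0 ≤ L * (b * (K * lagBound q)) :=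
    mul_nonneg (Nat.cast_nonneg _) (mul_nonneg hb (mul_nonneg hX.pos.le (lagBound_nonneg q)))
  simp_rw [sum_range_eq_blocks]
  refine (norm_expChar_sum_sub_exp_le (μ := P) (J := J)
    (B := fun j ω => ∑ t ∈ bigBlock L q j, w t * X t ω)
    (R := fun ω => ∑ t ∈ gapBlocks L q J, w t * X t ω)
    (fun j => hX.memLp_sum _ w) (fun j => hX.integral_sum _ w)
    ((hX.memLp_sum _ w).mono_exponent (by norm_num)) he ?_ hκ hκ1 x).trans ?_
  · intro j _ x
    simp_rw [← sum_bigBlocks]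
    rcases Nat.eq_zero_or_pos j with rfl | hj0
    · have h0 : expChar P (fun _ => (0 : ℝ)) x = 1 := by simp [expChar]
      simp only [bigBlocks, Finset.range_zero, Finset.biUnion_empty, Finset.sum_empty, zero_add]
      rw [h0, one_mul, sub_self, norm_zero]
      exact mul_nonneg (abs_nonneg _) he
    · exact hX.norm_expChar_add_sub_mul_le hw (fun t ht => le_cutDate ht)
        (fun t ht => cutDate_add_lt hL hj0 ht) (card_bigBlock L q j).le x
  · have h1 := hX.integral_sq_sum_le_card hw (card_gapBlocks_le L q J)
    have h2 := hX.blockVariance_le hw L q J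
    have h3 := hX.sum_integral_pow_four_le hw L q J
    unfold blockVariance at h2
    push_cast at h1
    gcongr

end CoupledProcess

end Decoupling

/-! ### Weighted sums with random multipliers -/

section Multipliers

variable {Ω Ω' : Type*} [MeasurableSpace Ω] [MeasurableSpace Ω'] {P : Measure Ω} {Q : Measure Ω'}

/-- Centred multipliers with variance at most `1` and fourth moment at most `M`, such that the
multipliers up to any date `r` are independent of those after `r + q`. -/
structure GapIndependentMultipliers (Q : Measure Ω') (ξ : ℕ → Ω' → ℝ) (q : ℕ) (M : ℝ) : Prop where
  measurable : ∀ t, Measurable (ξ t)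
  memLp : ∀ t, MemLp (ξ t) 4 Q
  mean_zero : ∀ t, ∫ ω, ξ t ω ∂Q = 0
  second_moment : ∀ t, ∫ ω, ξ t ω ^ 2 ∂Q ≤ 1
  fourth_moment : ∀ t, ∫ ω, ξ t ω ^ 4 ∂Q ≤ M
  indep : ∀ r, IndepFun (fun ω (s : Set.Iic r) => ξ s ω) (fun ω (t : Set.Ioi (r + q)) => ξ t ω) Q

namespace GapIndependentMultipliers

variable {ξ : ℕ → Ω' → ℝ} {q : ℕ} {M : ℝ}

theorem memLp_sum (hξ : GapIndependentMultipliers Q ξ q M) (A : Finset ℕ) (c : ℕ → ℝ) :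
    MemLp (fun ω => ∑ t ∈ A, c t * ξ t ω) 4 Q :=
  memLp_finsetSum _ fun t _ => (hξ.memLp t).const_mul _

theorem expChar_add (hξ : GapIndependentMultipliers Q ξ q M) {r : ℕ} {A A' : Finset ℕ}
    (hA : ∀ t ∈ A, t ≤ r) (hA' : ∀ t ∈ A', r + q < t) (c : ℕ → ℝ) (x : ℝ) :
    expChar Q (fun ω => ∑ t ∈ A, c t * ξ t ω + ∑ t ∈ A', c t * ξ t ω) x
      = expChar Q (fun ω => ∑ t ∈ A, c t * ξ t ω) x
        * expChar Q (fun ω => ∑ t ∈ A', c t * ξ t ω) x := by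
  have := integral_mul_of_indepFun_restrict (𝕜 := ℂ) hξ.measurable hξ.measurable (hξ.indep r)
    (Φ := fun y => Complex.exp (((x * ∑ t ∈ A, c t * y t : ℝ) : ℂ) * Complex.I))
    (Ψ := fun y => Complex.exp (((x * ∑ t ∈ A', c t * y t : ℝ) : ℂ) * Complex.I))
    (by fun_prop) (by fun_prop)
    (fun y z hyz => by rw [Finset.sum_congr rfl fun t ht => by rw [hyz t (hA t ht)]])
    (fun y z hyz => by rw [Finset.sum_congr rfl fun t ht => by rw [hyz t (hA' t ht)]])
  unfold expChar
  rw [← this]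
  refine integral_congr_ae (ae_of_all _ fun ω => ?_)
  simp only
  rw [← Complex.exp_add, ← add_mul, ← Complex.ofReal_add, ← mul_add]

variable [IsProbabilityMeasure Q]

theorem memLp_two (hξ : GapIndependentMultipliers Q ξ q M) (t : ℕ) : MemLp (ξ t) 2 Q :=
  (hξ.memLp t).mono_exponent (by norm_num)

theorem abs_integral_mul_le_one (hξ : GapIndependentMultipliers Q ξ q M) (t s : ℕ) :
    |∫ ω, ξ t ω * ξ s ω ∂Q| ≤ 1 := by
  simpa using abs_integral_mul_le (hξ.memLp_two t) (hξ.memLp_two s) zero_le_one zero_le_one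
    (by simpa using hξ.second_moment t) (by simpa using hξ.second_moment s)

theorem integral_sum (hξ : GapIndependentMultipliers Q ξ q M) (A : Finset ℕ) (c : ℕ → ℝ) :
    ∫ ω, ∑ t ∈ A, c t * ξ t ω ∂Q = 0 := by
  rw [integral_finsetSum]
  · refine Finset.sum_eq_zero fun t _ => ?_
    rw [integral_const_mul, hξ.mean_zero t, mul_zero]
  · exact fun t _ => ((hξ.memLp_two t).integrable (by norm_num)).const_mul _

theorem integral_sq_sum (hξ : GapIndependentMultipliers Q ξ q M) (A : Finset ℕ) (c : ℕ → ℝ) :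
    ∫ ω, (∑ t ∈ A, c t * ξ t ω) ^ 2 ∂Q
      = ∑ t ∈ A, ∑ s ∈ A, c t * c s * ∫ ω, ξ t ω * ξ s ω ∂Q := by
  have hi : ∀ t s, Integrable (fun ω => ξ t ω * ξ s ω) Q := fun t s =>
    (hξ.memLp_two t).integrable_mul (hξ.memLp_two s)
  have e : ∀ ω, (∑ t ∈ A, c t * ξ t ω) ^ 2
      = ∑ t ∈ A, ∑ s ∈ A, c t * c s * (ξ t ω * ξ s ω) := by
    intro ω
    rw [sq, Finset.sum_mul_sum]
    refine Finset.sum_congr rfl fun t _ => Finset.sum_congr rfl fun s _ => ?_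
    ring
  simp_rw [e]
  rw [integral_finsetSum]
  · refine Finset.sum_congr rfl fun t _ => ?_
    rw [integral_finsetSum]
    · exact Finset.sum_congr rfl fun s _ => integral_const_mul _ _
    · exact fun s _ => (hi t s).const_mul _
  · exact fun t _ => integrable_finsetSum _ fun s _ => (hi t s).const_mul _

/-- Gaussian approximation of a weighted sum of multipliers, with deterministic weights. -/
theorem norm_expChar_sum_range_sub_exp_le (hξ : GapIndependentMultipliers Q ξ q M) (c : ℕ → ℝ)
    {L : ℕ} (hL : 0 < L) (J : ℕ) {κ : ℝ} (hκ : 0 < κ) (hκ1 : κ ≤ 1) (x : ℝ) :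
    ‖expChar Q (fun ω => ∑ t ∈ Finset.range (J * (L + q)), c t * ξ t ω) x
      - ((Real.exp (-(x ^ 2 * (∑ j ∈ Finset.range J,
          ∫ ω, (∑ t ∈ bigBlock L q j, c t * ξ t ω) ^ 2 ∂Q) / 2)) : ℝ) : ℂ)‖
      ≤ (1 + x ^ 4) * (κ + (∫ ω, (∑ t ∈ gapBlocks L q J, c t * ξ t ω) ^ 2 ∂Q) / κ
        + 5 * (κ * ∑ j ∈ Finset.range J, ∫ ω, (∑ t ∈ bigBlock L q j, c t * ξ t ω) ^ 2 ∂Q)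
        + 5 * ((∑ j ∈ Finset.range J, ∫ ω, (∑ t ∈ bigBlock L q j, c t * ξ t ω) ^ 4 ∂Q) / κ)) := by
  simp_rw [sum_range_eq_blocks]
  refine (norm_expChar_sum_sub_exp_le (μ := Q) (J := J)
    (B := fun j ω => ∑ t ∈ bigBlock L q j, c t * ξ t ω)
    (R := fun ω => ∑ t ∈ gapBlocks L q J, c t * ξ t ω)
    (fun j => hξ.memLp_sum _ c) (fun j => hξ.integral_sum _ c)
    ((hξ.memLp_sum _ c).mono_exponent (by norm_num)) le_rfl ?_ hκ hκ1 x).trans_eq ?_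
  · intro j _ x
    simp_rw [← sum_bigBlocks]
    rcases Nat.eq_zero_or_pos j with rfl | hj0
    · simp [bigBlocks, expChar]
    · rw [hξ.expChar_add (fun t ht => le_cutDate ht) (fun t ht => cutDate_add_lt hL hj0 ht)]
      simp
  · rw [mul_zero, add_zero]

end GapIndependentMultipliers

theorem memLp_prod_mul [SFinite P] [SFinite Q] {f : Ω → ℝ} {g : Ω' → ℝ} (hf : MemLp f 4 P)
    (hg : MemLp g 4 Q) : MemLp (fun z : Ω × Ω' => f z.1 * g z.2) 4 (P.prod Q) := by
  have hm : AEStronglyMeasurable (fun z : Ω × Ω' => f z.1 * g z.2) (P.prod Q) :=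
    hf.1.comp_fst.mul hg.1.comp_snd
  rw [← integrable_norm_rpow_iff hm (by norm_num) (by norm_num)]
  have hf' := (integrable_norm_rpow_iff hf.1 (by norm_num) (by norm_num)).2 hf
  have hg' := (integrable_norm_rpow_iff hg.1 (by norm_num) (by norm_num)).2 hg
  refine (hf'.mul_prod hg').congr (ae_of_all _ fun z => ?_)
  simp only [norm_mul]
  rw [Real.mul_rpow (norm_nonneg _) (norm_nonneg _)]

section Joint

variable [IsProbabilityMeasure P] [IsProbabilityMeasure Q]
variable {X : ℕ → Ω → ℝ} {Y : ℕ → ℕ → Ω → ℝ} {K : ℝ} {ξ : ℕ → Ω' → ℝ} {q : ℕ} {M : ℝ}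

theorem memLp_prod_sum (hX : CoupledProcess P X Y K) (hξ : GapIndependentMultipliers Q ξ q M)
    (w : ℕ → ℝ) (A : Finset ℕ) :
    MemLp (fun z : Ω × Ω' => ∑ t ∈ A, w t * X t z.1 * ξ t z.2) 4 (P.prod Q) :=
  memLp_finsetSum _ fun t _ => memLp_prod_mul ((hX.memLp t).const_mul _) (hξ.memLp t)

theorem integrable_integral_sum_sq (hX : CoupledProcess P X Y K)
    (hξ : GapIndependentMultipliers Q ξ q M) (w : ℕ → ℝ) (A : Finset ℕ) :
    Integrable (fun ω => ∫ ω', (∑ t ∈ A, w t * X t ω * ξ t ω') ^ 2 ∂Q) P :=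
  (integrable_sq_of_memLp_four (memLp_prod_sum hX hξ w A)).integral_prod_left

theorem integrable_integral_sum_pow_four (hX : CoupledProcess P X Y K)
    (hξ : GapIndependentMultipliers Q ξ q M) (w : ℕ → ℝ) (A : Finset ℕ) :
    Integrable (fun ω => ∫ ω', (∑ t ∈ A, w t * X t ω * ξ t ω') ^ 4 ∂Q) P :=
  (integrable_pow_four (memLp_prod_sum hX hξ w A)).integral_prod_left

/-- The joint second moment: given the multipliers, this is a second moment of a weighted sum of
the weakly dependent process. -/
theorem integral_integral_sum_sq_le (hX : CoupledProcess P X Y K)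
    (hξ : GapIndependentMultipliers Q ξ q M) {w : ℕ → ℝ} {b : ℝ} (hw : ∀ t, |w t| ≤ b)
    {A : Finset ℕ} {n : ℕ} (hA : A.card ≤ n) :
    ∫ ω, ∫ ω', (∑ t ∈ A, w t * X t ω * ξ t ω') ^ 2 ∂Q ∂P ≤ 4 * K ^ 2 * (n * b ^ 2) := by
  have hi := integrable_sq_of_memLp_four (memLp_prod_sum hX hξ w A)
  rw [integral_integral_swap hi]
  have hi2 : ∀ t ∈ A, Integrable (fun ω' => (w t * ξ t ω') ^ 2) Q := fun t _ =>
    ((hξ.memLp_two t).const_mul (w t)).integrable_sq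
  calc _ ≤ ∫ ω', 4 * K ^ 2 * ∑ t ∈ A, (w t * ξ t ω') ^ 2 ∂Q := by
        refine integral_mono hi.integral_prod_right ((integrable_finsetSum _ hi2).const_mul _)
          fun ω' => ?_
        have e : ∀ ω t, w t * X t ω * ξ t ω' = w t * ξ t ω' * X t ω := fun ω t => by ring
        simp only [e]
        exact hX.integral_sq_sum_le A fun t => w t * ξ t ω'
    _ = 4 * K ^ 2 * ∑ t ∈ A, w t ^ 2 * ∫ ω', ξ t ω' ^ 2 ∂Q := by
        rw [integral_const_mul, integral_finsetSum _ hi2]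
        simp_rw [mul_pow, integral_const_mul]
    _ ≤ 4 * K ^ 2 * ∑ t ∈ A, w t ^ 2 := by
        gcongr with t _
        exact mul_le_of_le_one_right (sq_nonneg _) (hξ.second_moment t)
    _ ≤ _ := by
        gcongr
        exact sum_sq_le_card_mul hw hA

/-- The joint fourth moment over a big block. -/
theorem integral_integral_sum_pow_four_le (hX : CoupledProcess P X Y K)
    (hξ : GapIndependentMultipliers Q ξ q M) {w : ℕ → ℝ} {b : ℝ} (hw : ∀ t, |w t| ≤ b)
    (L j : ℕ) :
    ∫ ω, ∫ ω', (∑ t ∈ bigBlock L q j, w t * X t ω * ξ t ω') ^ 4 ∂Q ∂P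
      ≤ 10 ^ 6 * K ^ 4 * (L ^ 2 * b ^ 4 * M) := by
  have hM : 0 ≤ M := (integral_nonneg fun ω => by positivity).trans (hξ.fourth_moment 0)
  have hi := integrable_pow_four (memLp_prod_sum hX hξ w (bigBlock L q j))
  rw [integral_integral_swap hi]
  have hi4 : ∀ t ∈ bigBlock L q j, Integrable (fun ω' => (w t * ξ t ω') ^ 4) Q := fun t _ =>
    integrable_pow_four ((hξ.memLp t).const_mul (w t))
  calc _ ≤ ∫ ω', 10 ^ 6 * K ^ 4 * (L * ∑ t ∈ bigBlock L q j, (w t * ξ t ω') ^ 4) ∂Q := by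
        refine integral_mono hi.integral_prod_right
          (((integrable_finsetSum _ hi4).const_mul _).const_mul _) fun ω' => ?_
        have e : ∀ ω t, w t * X t ω * ξ t ω' = w t * ξ t ω' * X t ω := fun ω t => by ring
        simp only [e]
        exact hX.integral_sum_Ico_pow_four_le (fun t => w t * ξ t ω') L (j * (L + q))
    _ = 10 ^ 6 * K ^ 4 * (L * ∑ t ∈ bigBlock L q j, w t ^ 4 * ∫ ω', ξ t ω' ^ 4 ∂Q) := by
        rw [integral_const_mul, integral_const_mul, integral_finsetSum _ hi4]
        simp_rw [mul_pow, integral_const_mul]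
    _ ≤ 10 ^ 6 * K ^ 4 * (L * (L * (b ^ 4 * M))) := by
        gcongr
        have h : ∀ t ∈ bigBlock L q j, w t ^ 4 * ∫ ω', ξ t ω' ^ 4 ∂Q ≤ b ^ 4 * M := by
          intro t _
          refine mul_le_mul ?_ (hξ.fourth_moment t) (integral_nonneg fun ω => by positivity)
            (by positivity)
          rw [← Even.pow_abs (by decide)]
          exact pow_le_pow_left₀ (abs_nonneg _) (hw t) 4
        refine (Finset.sum_le_card_nsmul _ _ _ h).trans_eq ?_
        rw [card_bigBlock, nsmul_eq_mul]
    _ = _ := by ring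

end Joint

end Multipliers

/-! ### Concentration of the conditional block variances -/

section QuadraticForms

theorem integral_add_sq_le {Ω : Type*} [MeasurableSpace Ω] {μ : Measure Ω} {f g : Ω → ℝ}
    (hf : MemLp f 2 μ) (hg : MemLp g 2 μ) {a b : ℝ} (ha : 0 ≤ a) (hb : 0 ≤ b)
    (hfa : ∫ ω, f ω ^ 2 ∂μ ≤ a ^ 2) (hgb : ∫ ω, g ω ^ 2 ∂μ ≤ b ^ 2) :
    ∫ ω, (f ω + g ω) ^ 2 ∂μ ≤ (a + b) ^ 2 := by
  have := integral_sum_pow_le (μ := μ) (n := 2) (by decide) (by decide) Finset.univ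
    (f := fun i : Bool => if i then f else g) (a := fun i : Bool => if i then a else b)
    (by simp [hf, hg]) (by simp [ha, hb]) (by simp [hfa, hgb])
  simpa using this

/-- The quadratic form `∑ w_t w_s α_{ts} y_t y_s` over the index set `A`. -/
def quadForm (A : Finset ℕ) (w : ℕ → ℝ) (α : ℕ → ℕ → ℝ) (y : ℕ → ℝ) : ℝ :=
  ∑ t ∈ A, ∑ s ∈ A, w t * w s * α t s * (y t * y s)

theorem measurable_quadForm (A : Finset ℕ) (w : ℕ → ℝ) (α : ℕ → ℕ → ℝ) :
    Measurable (quadForm A w α) := by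
  unfold quadForm
  fun_prop

theorem quadForm_congr {A : Finset ℕ} {w : ℕ → ℝ} {α : ℕ → ℕ → ℝ} {y z : ℕ → ℝ}
    (h : ∀ t ∈ A, y t = z t) : quadForm A w α y = quadForm A w α z :=
  Finset.sum_congr rfl fun t ht => Finset.sum_congr rfl fun s hs => by rw [h t ht, h s hs]

variable {Ω Ω' : Type*} [MeasurableSpace Ω] [MeasurableSpace Ω'] {P : Measure Ω} {Q : Measure Ω'}
variable {X : ℕ → Ω → ℝ} {Y : ℕ → ℕ → Ω → ℝ} {K : ℝ} {ξ : ℕ → Ω' → ℝ} {q : ℕ} {M : ℝ}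

theorem memLp_quadForm {U : ℕ → Ω → ℝ} (A : Finset ℕ) (hU : ∀ t ∈ A, MemLp (U t) 4 P) (w : ℕ → ℝ)
    (α : ℕ → ℕ → ℝ) : MemLp (fun ω => quadForm A w α fun t => U t ω) 2 P :=
  memLp_finsetSum _ fun t ht => memLp_finsetSum _ fun s hs =>
    ((hU t ht).mul_four (hU s hs)).const_mul _

theorem CoupledProcess.integral_quadForm_sub_sq_le (hX : CoupledProcess P X Y K) {w : ℕ → ℝ}
    {b : ℝ} (hw : ∀ t, |w t| ≤ b) {α : ℕ → ℕ → ℝ} (hα : ∀ t s, |α t s| ≤ 1) {r L : ℕ}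
    {A : Finset ℕ} (hA : ∀ t ∈ A, r + q < t) (hc : A.card ≤ L) :
    ∫ ω, (quadForm A w α (fun t => X t ω) - quadForm A w α (fun t => Y r t ω)) ^ 2 ∂P
      ≤ (L ^ 2 * b ^ 2 * (2 * K ^ 2 * lagBound q)) ^ 2 := by
  have hA' : ∀ t ∈ A, r < t := fun t ht => by have := hA t ht; omega
  have hb : 0 ≤ b := (abs_nonneg _).trans (hw 0)
  have hK := hX.pos
  have hl := lagBound_nonneg q
  have hd : ∀ t ∈ A, MemLp (fun ω => X t ω - Y r t ω) 4 P := fun t ht =>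
    (hX.memLp t).sub (hX.memLp_coupled (hA' t ht))
  have hd4 : ∀ t ∈ A, ∫ ω, (X t ω - Y r t ω) ^ 4 ∂P ≤ (K * lagBound q) ^ 4 := by
    intro t ht
    refine (hX.coupling r t (hA' t ht)).trans (pow_le_pow_left₀
      (mul_nonneg hK.le (lagBound_nonneg _)) (mul_le_mul_of_nonneg_left (lagBound_anti ?_) hK.le) 4)
    have := hA t ht
    omega
  have hterm : ∀ t ∈ A, ∀ s ∈ A,
      ∫ ω, (X t ω * X s ω - Y r t ω * Y r s ω) ^ 2 ∂P ≤ (2 * K ^ 2 * lagBound q) ^ 2 := by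
    intro t ht s hs
    have e : ∀ ω, X t ω * X s ω - Y r t ω * Y r s ω
        = (X t ω - Y r t ω) * X s ω + Y r t ω * (X s ω - Y r s ω) := fun ω => by ring
    simp_rw [e]
    refine (integral_add_sq_le ((hd t ht).mul_four (hX.memLp s))
      ((hX.memLp_coupled (hA' t ht)).mul_four (hd s hs)) (a := K * lagBound q * K)
      (b := K * (K * lagBound q)) (by positivity) (by positivity)
      (integral_mul_sq_le (hd t ht) (hX.memLp s) (hd4 t ht) (hX.fourth_moment s))
      (integral_mul_sq_le (hX.memLp_coupled (hA' t ht)) (hd s hs)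
        (hX.fourth_moment_coupled (hA' t ht)) (hd4 s hs))).trans_eq ?_
    ring
  have hD : 0 ≤ 2 * K ^ 2 * lagBound q := by positivity
  have hcoef : ∀ t s, |w t * w s * α t s| ≤ b ^ 2 := by
    intro t s
    rw [abs_mul, abs_mul]
    calc _ ≤ b * b * 1 := by
          gcongr
          exacts [hw t, hw s, hα t s]
      _ = b ^ 2 := by ring
  have hm : ∀ t ∈ A, ∀ s ∈ A, MemLp (fun ω => X t ω * X s ω - Y r t ω * Y r s ω) 2 P :=
    fun t ht s hs => ((hX.memLp t).mul_four (hX.memLp s)).sub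
      ((hX.memLp_coupled (hA' t ht)).mul_four (hX.memLp_coupled (hA' s hs)))
  have e : ∀ ω, quadForm A w α (fun t => X t ω) - quadForm A w α (fun t => Y r t ω)
      = ∑ z ∈ A ×ˢ A, w z.1 * w z.2 * α z.1 z.2 * (X z.1 ω * X z.2 ω - Y r z.1 ω * Y r z.2 ω) := by
    intro ω
    rw [Finset.sum_product]
    simp only [quadForm, ← Finset.sum_sub_distrib, mul_sub]
  simp_rw [e]
  refine (integral_sum_pow_le (n := 2) (by decide) (by decide) (A ×ˢ A)
    (a := fun _ => b ^ 2 * (2 * K ^ 2 * lagBound q)) (fun z hz => ?_) (fun _ _ => by positivity)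
    fun z hz => ?_).trans ?_
  · obtain ⟨h1, h2⟩ := Finset.mem_product.1 hz
    exact (hm z.1 h1 z.2 h2).const_mul _
  · obtain ⟨h1, h2⟩ := Finset.mem_product.1 hz
    simp_rw [mul_pow (w z.1 * w z.2 * α z.1 z.2)]
    rw [integral_const_mul, mul_pow (b ^ 2)]
    refine mul_le_mul ?_ (hterm z.1 h1 z.2 h2) (integral_nonneg fun ω => sq_nonneg _) (by positivity)
    rw [← sq_abs]
    exact pow_le_pow_left₀ (abs_nonneg _) (hcoef _ _) 2
  · rw [Finset.sum_const, Finset.card_product, nsmul_eq_mul, mul_assoc ((L : ℝ) ^ 2)]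
    have h1 : (A.card : ℝ) ≤ L := by exact_mod_cast hc
    have h2 : ((A.card * A.card : ℕ) : ℝ) ≤ (L : ℝ) ^ 2 := by
      rw [Nat.cast_mul, sq]
      exact mul_le_mul h1 h1 (Nat.cast_nonneg _) (Nat.cast_nonneg _)
    exact pow_le_pow_left₀ (by positivity) (mul_le_mul_of_nonneg_right h2 (by positivity)) 2

variable [IsProbabilityMeasure P] [IsProbabilityMeasure Q]

theorem integral_sub_integral_sq_le {f : Ω → ℝ} (hf : MemLp f 2 P) :
    ∫ ω, (f ω - ∫ ω', f ω' ∂P) ^ 2 ∂P ≤ ∫ ω, f ω ^ 2 ∂P := by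
  rw [← variance_eq_integral hf.1.aemeasurable]
  refine (variance_le_expectation_sq hf.1).trans_eq ?_
  simp

/-- Block sums of quadratic forms concentrate: across the gaps the blocks are nearly uncorrelated.
Here `G ^ 2` bounds the second moment of each block. -/
theorem CoupledProcess.integral_sum_quadForm_sub_sq_le (hX : CoupledProcess P X Y K) {w : ℕ → ℝ}
    {b : ℝ} (hw : ∀ t, |w t| ≤ b) {α : ℕ → ℕ → ℝ} (hα : ∀ t s, |α t s| ≤ 1) {L : ℕ} (hL : 0 < L)
    (q : ℕ) (J : ℕ) {G : ℝ} (hG : 0 ≤ G)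
    (hZ : ∀ j, ∫ ω, quadForm (bigBlock L q j) w α (fun t => X t ω) ^ 2 ∂P ≤ G ^ 2) :
    ∫ ω, (∑ j ∈ Finset.range J, (quadForm (bigBlock L q j) w α (fun t => X t ω)
        - ∫ ω', quadForm (bigBlock L q j) w α (fun t => X t ω') ∂P)) ^ 2 ∂P
      ≤ J * (G ^ 2 + 2 * (J * G * (L ^ 2 * b ^ 2 * (2 * K ^ 2 * lagBound q)))) := by
  set Z : ℕ → Ω → ℝ := fun j ω => quadForm (bigBlock L q j) w α (fun t => X t ω) with hZdef
  set m : ℕ → ℝ := fun j => ∫ ω, Z j ω ∂P with hm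
  set D := L ^ 2 * b ^ 2 * (2 * K ^ 2 * lagBound q) with hD
  have hD0 : 0 ≤ D := by have := lagBound_nonneg q; positivity
  have hZm : ∀ j, MemLp (Z j) 2 P := fun j => memLp_quadForm _ (fun t _ => hX.memLp t) w α
  have hcm : ∀ j, MemLp (fun ω => Z j ω - m j) 2 P := fun j => (hZm j).sub (memLp_const _)
  have hcent : ∀ j, ∫ ω, (Z j ω - m j) ^ 2 ∂P ≤ G ^ 2 := fun j =>
    (integral_sub_integral_sq_le (hZm j)).trans (hZ j)
  have hc0 : ∀ j, ∫ ω, (Z j ω - m j) ∂P = 0 := by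
    intro j
    rw [integral_sub ((hZm j).integrable (by norm_num)) (integrable_const _)]
    simp [hm]
  have hPm : ∀ j, MemLp (fun ω => ∑ i ∈ Finset.range j, (Z i ω - m i)) 2 P := fun j =>
    memLp_finsetSum _ fun i _ => hcm i
  have hP0 : ∀ j, ∫ ω, ∑ i ∈ Finset.range j, (Z i ω - m i) ∂P = 0 := by
    intro j
    rw [integral_finsetSum _ fun i _ => (hcm i).integrable (by norm_num)]
    exact Finset.sum_eq_zero fun i _ => hc0 i
  have hP2 : ∀ j, ∫ ω, (∑ i ∈ Finset.range j, (Z i ω - m i)) ^ 2 ∂P ≤ (j * G) ^ 2 := by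
    intro j
    have := integral_sum_pow_le (μ := P) (n := 2) (by decide) (by decide) (Finset.range j)
      (f := fun i ω => Z i ω - m i) (a := fun _ => G) (fun i _ => hcm i) (fun _ _ => hG)
      fun i _ => hcent i
    simpa using this
  have hind : ∀ j ≤ J, ∫ ω, (∑ i ∈ Finset.range j, (Z i ω - m i)) ^ 2 ∂P
      ≤ j * (G ^ 2 + 2 * (J * G * D)) := by
    intro j hj
    induction j with
    | zero => simp
    | succ j ih =>
      have ih := ih (by omega)
      have hcross : |∫ ω, (∑ i ∈ Finset.range j, (Z i ω - m i)) * (Z j ω - m j) ∂P|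
          ≤ J * G * D := by
        rcases Nat.eq_zero_or_pos j with rfl | hj0
        · simp only [Finset.range_zero, Finset.sum_empty, zero_mul, integral_zero, abs_zero]
          positivity
        have hcut : ∀ t ∈ bigBlock L q j, cutDate L q j + q < t := fun t ht =>
          cutDate_add_lt hL hj0 ht
        have hcut' : ∀ t ∈ bigBlock L q j, cutDate L q j < t := fun t ht => by
          have := hcut t ht; omega
        set Z' : Ω → ℝ := fun ω => quadForm (bigBlock L q j) w α (fun t => Y (cutDate L q j) t ω)
        have hZ'm : MemLp Z' 2 P :=
          memLp_quadForm _ (fun t ht => hX.memLp_coupled (hcut' t ht)) w α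
        have h0 : ∫ ω, (∑ i ∈ Finset.range j, (Z i ω - m i)) * Z' ω ∂P = 0 := by
          have := hX.integral_mul_coupled (cutDate L q j)
            (Φ := fun y => ∑ i ∈ Finset.range j, (quadForm (bigBlock L q i) w α y - m i))
            (Ψ := quadForm (bigBlock L q j) w α)
            (Finset.measurable_sum _ fun i _ => (measurable_quadForm _ _ _).sub_const _)
            (measurable_quadForm _ _ _)
            (fun y z hyz => Finset.sum_congr rfl fun i hi => by
              rw [quadForm_congr fun t ht => hyz t (le_cutDate
                (Finset.mem_biUnion.2 ⟨i, hi, ht⟩))])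
            (fun y z hyz => quadForm_congr fun t ht => hyz t (hcut' t ht))
          refine this.trans ?_
          have h1 := hP0 j
          simp only [hZdef] at h1
          rw [h1, zero_mul]
        have i1 : Integrable (fun ω => (∑ i ∈ Finset.range j, (Z i ω - m i)) * Z j ω) P :=
          (hPm j).integrable_mul (hZm j)
        have i2 : Integrable (fun ω => (∑ i ∈ Finset.range j, (Z i ω - m i)) * Z' ω) P :=
          (hPm j).integrable_mul hZ'm
        have e : ∫ ω, (∑ i ∈ Finset.range j, (Z i ω - m i)) * (Z j ω - m j) ∂P
            = ∫ ω, (∑ i ∈ Finset.range j, (Z i ω - m i)) * (Z j ω - Z' ω) ∂P := by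
          simp_rw [mul_sub (∑ i ∈ Finset.range j, (Z i _ - m i))]
          rw [integral_sub i1 (((hPm j).integrable (by norm_num)).mul_const _), integral_sub i1 i2,
            h0, integral_mul_const, hP0, zero_mul]
        rw [e]
        refine (abs_integral_mul_le (hPm j) ((hZm j).sub hZ'm) (by positivity) hD0 (hP2 j)
          (hX.integral_quadForm_sub_sq_le hw hα hcut (card_bigBlock L q j).le)).trans ?_
        have : (j : ℝ) ≤ J := by exact_mod_cast (by omega : j ≤ J)
        gcongr
      have hexp : ∫ ω, (∑ i ∈ Finset.range (j + 1), (Z i ω - m i)) ^ 2 ∂P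
          = ∫ ω, (∑ i ∈ Finset.range j, (Z i ω - m i)) ^ 2 ∂P
            + 2 * ∫ ω, (∑ i ∈ Finset.range j, (Z i ω - m i)) * (Z j ω - m j) ∂P
            + ∫ ω, (Z j ω - m j) ^ 2 ∂P := by
        have i1 : Integrable (fun ω => (∑ i ∈ Finset.range j, (Z i ω - m i)) * (Z j ω - m j)) P :=
          (hPm j).integrable_mul (hcm j)
        have i2 : Integrable (fun ω => (∑ i ∈ Finset.range j, (Z i ω - m i)) ^ 2
            + 2 * ((∑ i ∈ Finset.range j, (Z i ω - m i)) * (Z j ω - m j))) P :=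
          (hPm j).integrable_sq.add (i1.const_mul 2)
        rw [← integral_const_mul, ← integral_add (hPm j).integrable_sq (i1.const_mul 2),
          ← integral_add i2 (hcm j).integrable_sq]
        refine integral_congr_ae (ae_of_all _ fun ω => ?_)
        simp only [Finset.sum_range_succ]
        ring
      have h1 := (abs_le.1 hcross).2
      have h2 := hcent j
      rw [hexp]
      push_cast
      linarith
  exact hind J le_rfl

/-- The conditional variance of a block sum is a quadratic form in the data. -/
theorem GapIndependentMultipliers.integral_sq_eq_quadForm
    (hξ : GapIndependentMultipliers Q ξ q M) (A : Finset ℕ) (w y : ℕ → ℝ) :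
    ∫ ω', (∑ t ∈ A, w t * y t * ξ t ω') ^ 2 ∂Q
      = quadForm A w (fun t s => ∫ ω', ξ t ω' * ξ s ω' ∂Q) y := by
  rw [hξ.integral_sq_sum A fun t => w t * y t]
  refine Finset.sum_congr rfl fun t _ => Finset.sum_congr rfl fun s _ => ?_
  ring

theorem CoupledProcess.integral_quadForm (hX : CoupledProcess P X Y K) (A : Finset ℕ) (w : ℕ → ℝ)
    (α : ℕ → ℕ → ℝ) : ∫ ω, quadForm A w α (fun t => X t ω) ∂P
      = ∑ t ∈ A, ∑ s ∈ A, w t * w s * α t s * ∫ ω, X t ω * X s ω ∂P := by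
  have hi : ∀ t s, Integrable (fun ω => X t ω * X s ω) P := fun t s =>
    (hX.memLp_two t).integrable_mul (hX.memLp_two s)
  unfold quadForm
  rw [integral_finsetSum]
  · refine Finset.sum_congr rfl fun t _ => ?_
    rw [integral_finsetSum]
    · exact Finset.sum_congr rfl fun s _ => integral_const_mul _ _
    · exact fun s _ => (hi t s).const_mul _
  · exact fun t _ => integrable_finsetSum _ fun s _ => (hi t s).const_mul _

/-- The bias of the conditional block variances: replacing the covariance weights `α` by `1` costs
little when `1 - α` is small at the lags where the covariances are not. -/
theorem CoupledProcess.abs_sum_integral_quadForm_sub_le (hX : CoupledProcess P X Y K)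
    {w : ℕ → ℝ} {b : ℝ} (hw : ∀ t, |w t| ≤ b) {α : ℕ → ℕ → ℝ} {ρ : ℕ → ℝ} (hρ : ∀ k, 0 ≤ ρ k)
    {β : ℝ} (hβ : ∀ n, ∑ k ∈ Finset.range n, ρ k ≤ β)
    (hα : ∀ t s, w t ≠ 0 → w s ≠ 0 → |α t s - 1| * lagBound (Nat.dist t s) ≤ ρ (Nat.dist t s))
    (L q J : ℕ) :
    |∑ j ∈ Finset.range J, ∫ ω, quadForm (bigBlock L q j) w α (fun t => X t ω) ∂P
      - blockVariance P X w L q J| ≤ 2 * β * K ^ 2 * (J * L * b ^ 2) := by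
  have hβ0 : 0 ≤ β := by simpa using hβ 0
  unfold blockVariance
  rw [← Finset.sum_sub_distrib]
  have hblock : ∀ j ∈ Finset.range J, |∫ ω, quadForm (bigBlock L q j) w α (fun t => X t ω) ∂P
      - ∫ ω, (∑ t ∈ bigBlock L q j, w t * X t ω) ^ 2 ∂P| ≤ K ^ 2 * (2 * β * (L * b ^ 2)) := by
    intro j _
    set A := bigBlock L q j with hA
    rw [hX.integral_quadForm, hX.integral_sq_sum, ← Finset.sum_sub_distrib]
    simp_rw [← Finset.sum_sub_distrib]
    calc _ ≤ ∑ t ∈ A, ∑ s ∈ A, |w t| * |w s| * (K ^ 2 * ρ (Nat.dist t s)) := by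
          refine (Finset.abs_sum_le_sum_abs _ _).trans (Finset.sum_le_sum fun t _ => ?_)
          refine (Finset.abs_sum_le_sum_abs _ _).trans (Finset.sum_le_sum fun s _ => ?_)
          by_cases ht : w t = 0
          · simp [ht]
          by_cases hs : w s = 0
          · simp [hs]
          have h1 := hα t s ht hs
          have h2 := hX.abs_integral_mul_le_lagBound t s
          rw [show w t * w s * α t s * ∫ ω, X t ω * X s ω ∂P
            - w t * w s * ∫ ω, X t ω * X s ω ∂P
            = w t * w s * ((α t s - 1) * ∫ ω, X t ω * X s ω ∂P) by ring, abs_mul, abs_mul, abs_mul]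
          refine mul_le_mul_of_nonneg_left ?_ (by positivity)
          calc _ ≤ |α t s - 1| * (K ^ 2 * lagBound (Nat.dist t s)) := by gcongr
            _ = K ^ 2 * (|α t s - 1| * lagBound (Nat.dist t s)) := by ring
            _ ≤ _ := by gcongr
      _ = K ^ 2 * ∑ t ∈ A, ∑ s ∈ A, |w t| * |w s| * ρ (Nat.dist t s) := by
          simp_rw [Finset.mul_sum]
          refine Finset.sum_congr rfl fun t _ => Finset.sum_congr rfl fun s _ => ?_
          ring
      _ ≤ K ^ 2 * (2 * β * ∑ t ∈ A, w t ^ 2) := by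
          gcongr
          exact sum_sum_dist_le hρ hβ A w
      _ ≤ _ := by
          gcongr
          exact sum_sq_le_card_mul hw (card_bigBlock L q j).le
  refine (Finset.abs_sum_le_sum_abs _ _).trans
    ((Finset.sum_le_card_nsmul _ _ _ hblock).trans_eq ?_)
  rw [Finset.card_range, nsmul_eq_mul]
  ring

/-- The conditional block variances are close in mean to the unconditional ones. -/
theorem integral_abs_conditional_variance_sub_le (hX : CoupledProcess P X Y K)
    (hξ : GapIndependentMultipliers Q ξ q M) {w : ℕ → ℝ} {b : ℝ} (hw : ∀ t, |w t| ≤ b)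
    {ρ : ℕ → ℝ} (hρ : ∀ k, 0 ≤ ρ k) {β : ℝ} (hβ : ∀ n, ∑ k ∈ Finset.range n, ρ k ≤ β)
    (hα : ∀ t s, w t ≠ 0 → w s ≠ 0 →
      |∫ ω', ξ t ω' * ξ s ω' ∂Q - 1| * lagBound (Nat.dist t s) ≤ ρ (Nat.dist t s))
    {L : ℕ} (hL : 0 < L) (J : ℕ) {G : ℝ} (hG : 0 ≤ G)
    (hMG : 10 ^ 6 * K ^ 4 * (L ^ 2 * b ^ 4 * M) ≤ G ^ 2) :
    ∫ ω, |∑ j ∈ Finset.range J, ∫ ω', (∑ t ∈ bigBlock L q j, w t * X t ω * ξ t ω') ^ 2 ∂Q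
        - blockVariance P X w L q J| ∂P
      ≤ √(J * (G ^ 2 + 2 * (J * G * (L ^ 2 * b ^ 2 * (2 * K ^ 2 * lagBound q)))))
        + 2 * β * K ^ 2 * (J * L * b ^ 2) := by
  have hb : 0 ≤ b := (abs_nonneg _).trans (hw 0)
  have hl := lagBound_nonneg q
  set α : ℕ → ℕ → ℝ := fun t s => ∫ ω', ξ t ω' * ξ s ω' ∂Q with hαdef
  have hZ : ∀ j, ∫ ω, quadForm (bigBlock L q j) w α (fun t => X t ω) ^ 2 ∂P ≤ G ^ 2 := by
    intro j
    refine le_trans ?_ ((integral_integral_sum_pow_four_le hX hξ hw L j).trans hMG)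
    refine integral_mono (memLp_quadForm _ (fun t _ => hX.memLp t) w α).integrable_sq
      (integrable_integral_sum_pow_four hX hξ w _) fun ω => ?_
    simp only
    rw [← hξ.integral_sq_eq_quadForm]
    exact sq_integral_sq_le (hξ.memLp_sum _ fun t => w t * X t ω)
  have hvar := hX.integral_sum_quadForm_sub_sq_le hw (α := α) hξ.abs_integral_mul_le_one hL q J hG hZ
  have hbias := hX.abs_sum_integral_quadForm_sub_le hw hρ hβ hα L q J
  have hm : MemLp (fun ω => ∑ j ∈ Finset.range J,
      (quadForm (bigBlock L q j) w α (fun t => X t ω)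
        - ∫ ω', quadForm (bigBlock L q j) w α (fun t => X t ω') ∂P)) 2 P :=
    memLp_finsetSum _ fun j _ =>
      (memLp_quadForm _ (fun t _ => hX.memLp t) w α).sub (memLp_const _)
  have h1 : ∫ ω, |∑ j ∈ Finset.range J, (quadForm (bigBlock L q j) w α (fun t => X t ω)
        - ∫ ω', quadForm (bigBlock L q j) w α (fun t => X t ω') ∂P)| ∂P
      ≤ √(J * (G ^ 2 + 2 * (J * G * (L ^ 2 * b ^ 2 * (2 * K ^ 2 * lagBound q))))) := by
    refine integral_abs_le_of_sq_le hm (Real.sqrt_nonneg _) ?_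
    rw [Real.sq_sqrt (by positivity)]
    exact hvar
  simp_rw [hξ.integral_sq_eq_quadForm]
  refine le_trans ?_ (add_le_add h1 hbias)
  set m := ∑ j ∈ Finset.range J, ∫ ω, quadForm (bigBlock L q j) w α (fun t => X t ω) ∂P with hmdef
  set V := blockVariance P X w L q J
  have i1 := (hm.integrable (by norm_num)).abs
  have hone : |m - V| = ∫ _, |m - V| ∂P := by simp
  rw [hone, ← integral_add i1 (integrable_const _)]
  refine integral_mono ?_ (i1.add (integrable_const _)) fun ω => ?_
  · have i2 : Integrable (fun ω => ∑ j ∈ Finset.range J,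
        quadForm (bigBlock L q j) w α (fun t => X t ω)) P :=
      integrable_finsetSum _ fun j _ =>
        (memLp_quadForm _ (fun t _ => hX.memLp t) w α).integrable (by norm_num)
    exact (i2.sub (integrable_const V)).abs
  · simp only [Finset.sum_sub_distrib]
    exact abs_sub_le _ _ _

end QuadraticForms

/-! ### Gaussian approximation given the data -/

section ConditionalApproximation

variable {Ω Ω' : Type*} [MeasurableSpace Ω] [MeasurableSpace Ω'] {P : Measure Ω} {Q : Measure Ω'}
variable [IsProbabilityMeasure P] [IsProbabilityMeasure Q]
variable {X : ℕ → Ω → ℝ} {Y : ℕ → ℕ → Ω → ℝ} {K : ℝ} {ξ : ℕ → Ω' → ℝ} {q : ℕ} {M : ℝ}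

/-- For every realisation of the data the characteristic function of the sum with multipliers is
close to a Gaussian one with the unconditional block variance; the error is random, with an explicit
bound on its mean. -/
theorem exists_conditional_error (hX : CoupledProcess P X Y K)
    (hξ : GapIndependentMultipliers Q ξ q M) {w : ℕ → ℝ} {b : ℝ} (hw : ∀ t, |w t| ≤ b)
    {ρ : ℕ → ℝ} (hρ : ∀ k, 0 ≤ ρ k) {β : ℝ} (hβ : ∀ n, ∑ k ∈ Finset.range n, ρ k ≤ β)
    (hα : ∀ t s, w t ≠ 0 → w s ≠ 0 →
      |∫ ω', ξ t ω' * ξ s ω' ∂Q - 1| * lagBound (Nat.dist t s) ≤ ρ (Nat.dist t s))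
    {L : ℕ} (hL : 0 < L) (J : ℕ) {G : ℝ} (hG : 0 ≤ G)
    (hMG : 10 ^ 6 * K ^ 4 * (L ^ 2 * b ^ 4 * M) ≤ G ^ 2) {κ : ℝ} (hκ : 0 < κ) (hκ1 : κ ≤ 1) :
    ∃ err : Ω → ℝ, Integrable err P ∧ (∀ ω, 0 ≤ err ω) ∧
      (∀ ω x, ‖expChar Q (fun ω' => ∑ t ∈ Finset.range (J * (L + q)), w t * X t ω * ξ t ω') x
        - ((Real.exp (-(x ^ 2 * blockVariance P X w L q J / 2)) : ℝ) : ℂ)‖ ≤ (1 + x ^ 4) * err ω) ∧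
      ∫ ω, err ω ∂P ≤ κ + 4 * K ^ 2 * (J * q * b ^ 2) / κ + 5 * (κ * (4 * K ^ 2 * (J * L * b ^ 2)))
        + 5 * (10 ^ 6 * K ^ 4 * (J * L ^ 2 * b ^ 4) * M / κ)
        + (√(J * (G ^ 2 + 2 * (J * G * (L ^ 2 * b ^ 2 * (2 * K ^ 2 * lagBound q)))))
          + 2 * β * K ^ 2 * (J * L * b ^ 2)) := by
  set V := blockVariance P X w L q J with hV
  set R : Ω → ℝ := fun ω => ∫ ω', (∑ t ∈ gapBlocks L q J, w t * X t ω * ξ t ω') ^ 2 ∂Q with hR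
  set W : Ω → ℝ := fun ω => ∑ j ∈ Finset.range J,
    ∫ ω', (∑ t ∈ bigBlock L q j, w t * X t ω * ξ t ω') ^ 2 ∂Q with hW
  set F : Ω → ℝ := fun ω => ∑ j ∈ Finset.range J,
    ∫ ω', (∑ t ∈ bigBlock L q j, w t * X t ω * ξ t ω') ^ 4 ∂Q with hF
  have hV0 : 0 ≤ V := Finset.sum_nonneg fun j _ => integral_nonneg fun ω => sq_nonneg _
  have hR0 : ∀ ω, 0 ≤ R ω := fun ω => integral_nonneg fun ω' => sq_nonneg _
  have hW0 : ∀ ω, 0 ≤ W ω := fun ω =>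
    Finset.sum_nonneg fun j _ => integral_nonneg fun ω' => sq_nonneg _
  have hF0 : ∀ ω, 0 ≤ F ω := fun ω =>
    Finset.sum_nonneg fun j _ => integral_nonneg fun ω' => by positivity
  have iR : Integrable R P := integrable_integral_sum_sq hX hξ w _
  have iW : Integrable W P := integrable_finsetSum _ fun j _ => integrable_integral_sum_sq hX hξ w _
  have iF : Integrable F P :=
    integrable_finsetSum _ fun j _ => integrable_integral_sum_pow_four hX hξ w _
  have iV : Integrable (fun ω => |W ω - V|) P := (iW.sub (integrable_const V)).abs
  have bR : ∫ ω, R ω ∂P ≤ 4 * K ^ 2 * (J * q * b ^ 2) := by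
    have := integral_integral_sum_sq_le hX hξ hw (card_gapBlocks_le L q J)
    push_cast at this
    exact this
  have bW : ∫ ω, W ω ∂P ≤ 4 * K ^ 2 * (J * L * b ^ 2) := by
    rw [integral_finsetSum _ fun j _ => integrable_integral_sum_sq hX hξ w _]
    refine (Finset.sum_le_card_nsmul _ _ _ fun j _ =>
      integral_integral_sum_sq_le hX hξ hw (card_bigBlock L q j).le).trans_eq ?_
    rw [Finset.card_range, nsmul_eq_mul]
    ring
  have bF : ∫ ω, F ω ∂P ≤ 10 ^ 6 * K ^ 4 * (J * L ^ 2 * b ^ 4) * M := by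
    rw [integral_finsetSum _ fun j _ => integrable_integral_sum_pow_four hX hξ w _]
    refine (Finset.sum_le_card_nsmul _ _ _ fun j _ =>
      integral_integral_sum_pow_four_le hX hξ hw L j).trans_eq ?_
    rw [Finset.card_range, nsmul_eq_mul]
    ring
  have bV := integral_abs_conditional_variance_sub_le hX hξ hw hρ hβ hα hL J hG hMG
  have i1 : Integrable (fun ω => κ + R ω / κ) P := (integrable_const κ).add (iR.div_const κ)
  have i2 : Integrable (fun ω => κ + R ω / κ + 5 * (κ * W ω)) P :=
    i1.add ((iW.const_mul κ).const_mul 5)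
  have i3 : Integrable (fun ω => κ + R ω / κ + 5 * (κ * W ω) + 5 * (F ω / κ)) P :=
    i2.add ((iF.div_const κ).const_mul 5)
  refine ⟨fun ω => κ + R ω / κ + 5 * (κ * W ω) + 5 * (F ω / κ) + |W ω - V|, i3.add iV,
    fun ω => ?_, fun ω x => ?_, ?_⟩
  · have := hR0 ω
    have := hW0 ω
    have := hF0 ω
    positivity
  · have h1 := hξ.norm_expChar_sum_range_sub_exp_le (fun t => w t * X t ω) hL J hκ hκ1 x
    have h2 : ‖((Real.exp (-(x ^ 2 * W ω / 2)) : ℝ) : ℂ) - ((Real.exp (-(x ^ 2 * V / 2)) : ℝ) : ℂ)‖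
        ≤ (1 + x ^ 4) * |W ω - V| := by
      rw [← Complex.ofReal_sub, Complex.norm_real, Real.norm_eq_abs]
      refine (abs_exp_neg_sub_exp_neg_le (by have := hW0 ω; positivity) (by positivity)).trans ?_
      rw [show x ^ 2 * W ω / 2 - x ^ 2 * V / 2 = x ^ 2 / 2 * (W ω - V) by ring, abs_mul,
        abs_of_nonneg (by positivity)]
      gcongr
      nlinarith [sq_le_one_add_pow_four x]
    refine (norm_sub_le_norm_sub_add_norm_sub _ _ _).trans ((add_le_add h1 h2).trans_eq ?_)
    ring
  · rw [integral_add i3 iV, integral_add i2 ((iF.div_const κ).const_mul 5),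
      integral_add i1 ((iW.const_mul κ).const_mul 5),
      integral_add (integrable_const κ) (iR.div_const κ), integral_const_mul, integral_const_mul,
      integral_const_mul, integral_div, integral_div]
    have hone : ∫ _, κ ∂P = κ := by simp
    rw [hone]
    gcongr

end ConditionalApproximation

/-! ### Splicing independent innovations -/

section Splicing

variable {Ω E : Type*} [mΩ : MeasurableSpace Ω] [MeasurableSpace E] {P : Measure Ω}

theorem ProbabilityTheory.iIndepFun.indepFun_restrict {ι : Type*} {f : ι → Ω → E}
    (hf : iIndepFun f P) (hm : ∀ i, Measurable (f i)) {S T : Set ι} (hST : Disjoint S T) :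
    IndepFun (fun ω (i : S) => f i ω) (fun ω (i : T) => f i ω) P := by
  have h := indep_iSup_of_disjoint (m := fun i => MeasurableSpace.comap (f i) inferInstance)
    (fun i => (hm i).comap_le) hf hST
  have key : ∀ U : Set ι, MeasurableSpace.comap (fun ω (i : U) => f i ω) MeasurableSpace.pi
      = ⨆ i ∈ U, MeasurableSpace.comap (f i) inferInstance := by
    intro U
    rw [MeasurableSpace.comap_process_pi, iSup_subtype']
  rw [IndepFun_iff_Indep, key, key]
  exact h

/-- If `A` and `B` are independent and `C` is independent of the pair, then `A` is independent of
`(B, C)`. -/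
theorem ProbabilityTheory.IndepFun.prodMk_right_of_prodMk_left [IsProbabilityMeasure P]
    {α β γ : Type*} [MeasurableSpace α] [MeasurableSpace β] [MeasurableSpace γ] {A : Ω → α}
    {B : Ω → β} {C : Ω → γ} (hA : Measurable A) (hB : Measurable B) (hC : Measurable C)
    (hAB : IndepFun A B P) (h : IndepFun (fun ω => (A ω, B ω)) C P) :
    IndepFun A (fun ω => (B ω, C ω)) P := by
  have hBC : IndepFun B C P := h.comp measurable_snd measurable_id
  rw [indepFun_iff_map_prod_eq_prod_map_map hA.aemeasurable (hB.prodMk hC).aemeasurable,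
    hBC.map_prod_eq_prod_map_map hB.aemeasurable hC.aemeasurable, ← Measure.prodAssoc_prod,
    ← hAB.map_prod_eq_prod_map_map hA.aemeasurable hB.aemeasurable,
    ← h.map_prod_eq_prod_map_map (hA.prodMk hB).aemeasurable hC.aemeasurable,
    Measure.map_map (MeasurableEquiv.measurable _) ((hA.prodMk hB).prodMk hC)]
  rfl

/-- The path on `ℤ` that follows `z.1` after `r` and `z.2` up to `r`. -/
noncomputable def spliceAt (r : ℤ) (z : (Set.Ioi r → E) × (Set.Iic r → E)) (j : ℤ) : E :=
  if h : r < j then z.1 ⟨j, h⟩ else z.2 ⟨j, not_lt.1 h⟩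

theorem measurable_spliceAt (r : ℤ) : Measurable (spliceAt (E := E) r) := by
  refine measurable_pi_lambda _ fun j => ?_
  unfold spliceAt
  split_ifs with h
  · exact (measurable_pi_apply _).comp measurable_fst
  · exact (measurable_pi_apply _).comp measurable_snd

variable {e e' : ℤ → Ω → E}

theorem measurable_restrict_family (he : ∀ j, Measurable (e j)) (S : Set ℤ) :
    Measurable fun ω (j : S) => e j ω := measurable_pi_lambda _ fun j => he j

variable [IsProbabilityMeasure P]

/-- The innovations up to `r` are independent of the sequence in which they are replaced by those of
an independent copy. -/
theorem indepFun_splice (he : ∀ j, Measurable (e j)) (he' : ∀ j, Measurable (e' j))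
    (hi : iIndepFun e P) (hc : IndepFun (fun ω j => e j ω) (fun ω j => e' j ω) P) (r : ℤ) :
    IndepFun (fun ω (j : Set.Iic r) => e j ω) (fun ω j => if r < j then e j ω else e' j ω) P := by
  have hAB : IndepFun (fun ω (j : Set.Iic r) => e j ω) (fun ω (j : Set.Ioi r) => e j ω) P :=
    hi.indepFun_restrict he (Set.Iic_disjoint_Ioi le_rfl)
  have hm1 : Measurable fun x : ℤ → E =>
      ((fun j : Set.Iic r => x j), (fun j : Set.Ioi r => x j)) := by fun_prop
  have hm2 : Measurable fun x : ℤ → E => (fun j : Set.Iic r => x j) := by fun_prop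
  have h := IndepFun.prodMk_right_of_prodMk_left (measurable_restrict_family he _)
    (measurable_restrict_family he _) (measurable_restrict_family he' (Set.Iic r)) hAB
    (hc.comp hm1 hm2)
  convert h.comp measurable_id (measurable_spliceAt (E := E) r) using 1
  · rfl
  · funext ω j
    by_cases hj : r < j <;> simp [spliceAt, hj]

/-- Replacing the innovations up to `r` by an independent copy does not change the law. -/
theorem identDistrib_splice (he : ∀ j, Measurable (e j))
    (hi : iIndepFun e P) (hc : IndepFun (fun ω j => e j ω) (fun ω j => e' j ω) P)
    (hl : IdentDistrib (fun ω j => e' j ω) (fun ω j => e j ω) P P) (r : ℤ) :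
    IdentDistrib (fun ω j => if r < j then e j ω else e' j ω) (fun ω j => e j ω) P P := by
  have hBA : IndepFun (fun ω (j : Set.Ioi r) => e j ω) (fun ω (j : Set.Iic r) => e j ω) P :=
    hi.indepFun_restrict he (Set.Iic_disjoint_Ioi le_rfl).symm
  have hm1 : Measurable fun x : ℤ → E => (fun j : Set.Ioi r => x j) := by fun_prop
  have hm2 : Measurable fun x : ℤ → E => (fun j : Set.Iic r => x j) := by fun_prop
  have h := (IdentDistrib.prodMk
    (IdentDistrib.refl (measurable_restrict_family he (Set.Ioi r)).aemeasurable)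
    (hl.comp hm2) (hc.comp hm1 hm2) hBA).comp (measurable_spliceAt (E := E) r)
  convert h using 1 <;> ext ω j <;>
  by_cases hj : r < j <;> simp [spliceAt, hj]

/-- Symmetrisation: a centred variable is dominated in `L^p` by its difference with an independent
centred variable. -/
theorem eLpNorm_le_eLpNorm_sub_of_indepFun {f g : Ω → ℝ} (hf : Measurable f) (hg : Measurable g)
    (hfi : Integrable f P) (hgi : Integrable g P) (hg0 : ∫ ω, g ω ∂P = 0)
    (hfg : IndepFun f g P) {p : ℝ≥0∞} (hp : 1 ≤ p) :
    eLpNorm f p P ≤ eLpNorm (fun ω => f ω - g ω) p P := by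
  set m : MeasurableSpace Ω := MeasurableSpace.comap f inferInstance with hm
  have hle : m ≤ mΩ := hf.comap_le
  have h1 : P[f | m] = f := condExp_of_stronglyMeasurable hle
    (comap_measurable f).stronglyMeasurable hfi
  have h2 : P[g | m] =ᵐ[P] fun _ => (0 : ℝ) := by
    have := condExp_indep_eq (m₁ := MeasurableSpace.comap g inferInstance) hg.comap_le hle
      (comap_measurable g).stronglyMeasurable ((IndepFun_iff_Indep _ _ _).1 hfg.symm)
    rw [hg0] at this
    exact this
  have h3 : P[f - g | m] =ᵐ[P] f := by
    filter_upwards [condExp_sub hfi hgi m, h2] with ω h4 h5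
    rw [h4, Pi.sub_apply, h1, h5, sub_zero]
  rw [← eLpNorm_congr_ae h3]
  exact eLpNorm_condExp_le_eLpNorm (f - g) hp

end Splicing

/-! ### Causal functionals of independent innovations -/

section Causal

variable {Ω E : Type*} [MeasurableSpace Ω] [MeasurableSpace E] {P : Measure Ω}
  {e e' : ℤ → Ω → E} {F : ℕ → (ℤ → E) → ℝ}

/-- The value at date `t` of the functionals `F`, evaluated at the innovations `e` in which those up
to date `r + 1` are replaced by the innovations `e'`. -/
def splicedValue (e e' : ℤ → Ω → E) (F : ℕ → (ℤ → E) → ℝ) (r t : ℕ) (ω : Ω) : ℝ :=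
  F t fun j => if (r : ℤ) + 1 < j then e j ω else e' j ω

theorem measurable_splicedValue (he : ∀ j, Measurable (e j)) (he' : ∀ j, Measurable (e' j))
    (hF : ∀ t, Measurable (F t)) (r t : ℕ) : Measurable (splicedValue e e' F r t) := by
  refine (hF t).comp (measurable_pi_lambda _ fun j => ?_)
  split_ifs
  exacts [he j, he' j]

variable [IsProbabilityMeasure P]

/-- Causal functionals (the value at time `t` only uses innovations up to `t + 1`) of independent
innovations form a coupled process, the coupling being obtained by splicing in an independent copy of
the innovations, as soon as the moment bounds hold. -/
theorem CoupledProcess.of_causal [Nonempty E] (he : ∀ j, Measurable (e j))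
    (he' : ∀ j, Measurable (e' j)) (hi : iIndepFun e P)
    (hc : IndepFun (fun ω j => e j ω) (fun ω j => e' j ω) P)
    (hl : IdentDistrib (fun ω j => e' j ω) (fun ω j => e j ω) P P)
    (hF : ∀ t, Measurable (F t))
    (hcausal : ∀ (t : ℕ) (z z' : ℤ → E), (∀ j, j ≤ (t : ℤ) + 1 → z j = z' j) → F t z = F t z')
    {K : ℝ} (hK : 0 < K) (hL : ∀ t, MemLp (fun ω => F t fun j => e j ω) 4 P)
    (h0 : ∀ t, ∫ ω, (F t fun j => e j ω) ∂P = 0)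
    (h4 : ∀ t, ∫ ω, (F t fun j => e j ω) ^ 4 ∂P ≤ K ^ 4)
    (hd : ∀ r t, r < t → ∫ ω, ((F t fun j => e j ω) - splicedValue e e' F r t ω) ^ 4 ∂P
      ≤ (K * lagBound (t - r)) ^ 4) :
    CoupledProcess P (fun t ω => F t fun j => e j ω) (splicedValue e e' F) K where
  pos := hK
  measurable t := (hF t).comp (measurable_pi_lambda _ he)
  measurable_coupled := measurable_splicedValue he he' hF
  memLp := hL
  mean_zero := h0
  fourth_moment := h4
  coupling := hd
  indep r := by
    obtain ⟨x₀⟩ := ‹Nonempty E›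
    -- an innovation path up to `r + 1` is completed by a constant, which causality ignores
    let ext : (Set.Iic ((r : ℤ) + 1) → E) → ℤ → E := fun z j =>
      if h : j ≤ (r : ℤ) + 1 then z ⟨j, h⟩ else x₀
    have hext : Measurable ext := by
      refine measurable_pi_lambda _ fun j => ?_
      by_cases h : j ≤ (r : ℤ) + 1
      · simpa [ext, h] using measurable_pi_apply _
      · simp [ext, h]
    have h1 : Measurable fun (z : Set.Iic ((r : ℤ) + 1) → E) (s : Set.Iic r) => F s (ext z) :=
      measurable_pi_lambda _ fun s => (hF s).comp hext
    have h2 : Measurable fun (z : ℤ → E) (t : Set.Ioi r) => F t z :=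
      measurable_pi_lambda _ fun s => hF s
    have h := (indepFun_splice he he' hi hc ((r : ℤ) + 1)).comp h1 h2
    convert h using 1
    · funext ω s
      refine hcausal s _ _ fun j hj => ?_
      have hs : ((s : ℕ) : ℤ) ≤ r := by exact_mod_cast s.2
      simp [ext, show j ≤ (r : ℤ) + 1 by omega]
    · rfl
  identDistrib r :=
    (identDistrib_splice he hi hc hl ((r : ℤ) + 1)).comp
      (u := fun (z : ℤ → E) (t : Set.Ioi r) => F t z) (measurable_pi_lambda _ fun s => hF s)

end Causal

namespace DWB

/-! ### The panel at fixed sizes -/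

section Panel

variable {Ω : Type*} {N T : ℕ}

/-- The units observed at the date with index `t`, for `t` not restricted to `{0, …, T - 1}`. -/
def observedUnits (D : Fin T → Finset (Fin N)) (t : ℕ) : Finset (Fin N) :=
  if h : t < T then D ⟨t, h⟩ else ∅

theorem observedUnits_of_lt (D : Fin T → Finset (Fin N)) {t : ℕ} (h : t < T) :
    observedUnits D t = D ⟨t, h⟩ := dif_pos h

theorem observedUnits_of_le (D : Fin T → Finset (Fin N)) {t : ℕ} (h : T ≤ t) :
    observedUnits D t = ∅ := dif_neg (not_lt.2 h)

@[simp]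
theorem normalizedSum_empty (u : Fin N → ℝ) : normalizedSum ∅ u = 0 := by simp [normalizedSum]

theorem measurable_normalizedSum (D : Finset (Fin N)) : Measurable (normalizedSum D) := by
  unfold normalizedSum
  fun_prop

theorem sqrt_card_mul_normalizedSum (D : Finset (Fin N)) (u : Fin N → ℝ) :
    Real.sqrt D.card * normalizedSum D u = ∑ i ∈ D, u i := by
  unfold normalizedSum
  rcases D.eq_empty_or_nonempty with rfl | h
  · simp
  · have : Real.sqrt D.card ≠ 0 := by
      have := h.card_pos
      positivity
    field_simp

/-- The normalised cross-sectional sum at the date with index `t`, that is at the date `t + 1`, as a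
function of the path of innovations; it is `0` for `T ≤ t`. -/
noncomputable def pathSum (g : (ℕ → Fin N → ℝ) → Fin N → ℝ) (D : Fin T → Finset (Fin N)) (t : ℕ)
    (z : ℤ → Fin N → ℝ) : ℝ :=
  normalizedSum (observedUnits D t) (g fun k : ℕ => z ((t : ℤ) + 1 - k))

theorem measurable_pathSum {g : (ℕ → Fin N → ℝ) → Fin N → ℝ} (hg : Measurable g)
    (D : Fin T → Finset (Fin N)) (t : ℕ) : Measurable (pathSum g D t) := by
  refine (measurable_normalizedSum _).comp (hg.comp ?_)
  exact measurable_pi_lambda _ fun k => measurable_pi_apply _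

theorem pathSum_congr (g : (ℕ → Fin N → ℝ) → Fin N → ℝ) (D : Fin T → Finset (Fin N)) (t : ℕ)
    {z z' : ℤ → Fin N → ℝ} (h : ∀ j, j ≤ (t : ℤ) + 1 → z j = z' j) :
    pathSum g D t z = pathSum g D t z' := by
  unfold pathSum
  congr 2
  funext k
  exact h _ (by omega)

theorem pathSum_innovations (g : (ℕ → Fin N → ℝ) → Fin N → ℝ) (ε : ℤ → Ω → Fin N → ℝ)
    (D : Fin T → Finset (Fin N)) (t : Fin T) (ω : Ω) :
    pathSum g D t (fun j => ε j ω) = normalizedSum (D t) (crossSection g ε (date t) ω) := by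
  unfold pathSum
  rw [observedUnits_of_lt D t.2]
  rfl

theorem pathSum_of_le (g : (ℕ → Fin N → ℝ) → Fin N → ℝ) (D : Fin T → Finset (Fin N)) {t : ℕ}
    (h : T ≤ t) (z : ℤ → Fin N → ℝ) : pathSum g D t z = 0 := by
  unfold pathSum
  rw [observedUnits_of_le D h, normalizedSum_empty]

theorem splicedValue_pathSum (g : (ℕ → Fin N → ℝ) → Fin N → ℝ) (ε εc : ℤ → Ω → Fin N → ℝ)
    (D : Fin T → Finset (Fin N)) (t : Fin T) {r : ℕ} (h : r < t) (ω : Ω) :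
    splicedValue ε εc (pathSum g D) r t ω
      = normalizedSum (D t) (coupledCrossSection g ε εc (t - r) (date t) ω) := by
  unfold splicedValue pathSum coupledCrossSection date
  rw [observedUnits_of_lt D t.2]
  congr 2
  funext k
  have : ((r : ℤ) + 1 < (t : ℕ) + 1 - (k : ℤ)) ↔ k < (t : ℕ) - r := by omega
  simp only [this]

/-- The weight `(N_t / ∑_s N_s)^{1/2}` of the date with index `t`. -/
noncomputable def dateWeight (D : Fin T → Finset (Fin N)) (t : ℕ) : ℝ :=
  (Real.sqrt (totalObs D))⁻¹ * Real.sqrt (observedUnits D t).card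

theorem dateWeight_of_le (D : Fin T → Finset (Fin N)) {t : ℕ} (h : T ≤ t) : dateWeight D t = 0 := by
  simp [dateWeight, observedUnits_of_le D h]

theorem dateWeight_nonneg (D : Fin T → Finset (Fin N)) (t : ℕ) : 0 ≤ dateWeight D t := by
  unfold dateWeight
  positivity

theorem dateWeight_le (D : Fin T → Finset (Fin N)) (t : ℕ) :
    dateWeight D t ≤ Real.sqrt (maxObs D / totalObs D) := by
  rw [Real.sqrt_div (by positivity), div_eq_inv_mul]
  unfold dateWeight
  gcongr
  unfold observedUnits
  split_ifs with h
  · exact Finset.le_sup (f := fun t => (D t).card) (Finset.mem_univ _)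
  · simp

theorem sum_fin_eq_sum_range {n : ℕ} (h : T ≤ n) {f : ℕ → ℝ} (hf : ∀ t, T ≤ t → f t = 0) :
    ∑ t : Fin T, f t = ∑ t ∈ Finset.range n, f t := by
  rw [Fin.sum_univ_eq_sum_range, ← Finset.sum_subset (Finset.range_mono h)]
  intro t _ ht
  exact hf t (not_lt.1 fun h' => ht (Finset.mem_range.2 h'))

theorem panelSum_eq (g : (ℕ → Fin N → ℝ) → Fin N → ℝ) (ε : ℤ → Ω → Fin N → ℝ)
    (D : Fin T → Finset (Fin N)) (ω : Ω) {n : ℕ} (h : T ≤ n) :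
    panelSum g ε D ω
      = ∑ t ∈ Finset.range n, dateWeight D t * pathSum g D t fun j => ε j ω := by
  rw [← sum_fin_eq_sum_range h fun t ht => by rw [dateWeight_of_le D ht, zero_mul]]
  unfold panelSum
  rw [Finset.mul_sum]
  refine Finset.sum_congr rfl fun t _ => ?_
  rw [pathSum_innovations, dateWeight, observedUnits_of_lt D t.2, mul_assoc,
    sqrt_card_mul_normalizedSum]

/-- The multipliers, extended by `0` beyond the dates of the panel. -/
noncomputable def extendMultipliers {Ω' : Type*} (ξ : Fin T → Ω' → ℝ) (t : ℕ) (ω' : Ω') : ℝ :=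
  if h : t < T then ξ ⟨t, h⟩ ω' else 0

theorem extendMultipliers_of_lt {Ω' : Type*} (ξ : Fin T → Ω' → ℝ) {t : ℕ} (h : t < T) :
    extendMultipliers ξ t = ξ ⟨t, h⟩ := by
  funext ω'
  exact dif_pos h

theorem extendMultipliers_of_le {Ω' : Type*} (ξ : Fin T → Ω' → ℝ) {t : ℕ} (h : T ≤ t) :
    extendMultipliers ξ t = fun _ => 0 := by
  funext ω'
  exact dif_neg (not_lt.2 h)

theorem bootSum_eq {Ω' : Type*} (g : (ℕ → Fin N → ℝ) → Fin N → ℝ) (ε : ℤ → Ω → Fin N → ℝ)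
    (D : Fin T → Finset (Fin N)) (ξ : Fin T → Ω' → ℝ) (ω : Ω) (ω' : Ω') {n : ℕ} (h : T ≤ n) :
    bootSum g ε D ξ ω ω' = ∑ t ∈ Finset.range n,
      dateWeight D t * (pathSum g D t fun j => ε j ω) * extendMultipliers ξ t ω' := by
  rw [← sum_fin_eq_sum_range h fun t ht => by rw [dateWeight_of_le D ht, zero_mul, zero_mul]]
  unfold bootSum
  rw [Finset.mul_sum]
  refine Finset.sum_congr rfl fun t _ => ?_
  rw [pathSum_innovations, dateWeight, observedUnits_of_lt D t.2, mul_assoc _ (Real.sqrt _),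
    sqrt_card_mul_normalizedSum, extendMultipliers_of_lt ξ t.2, mul_assoc]

/-- The extended multipliers of an `ℓ`-dependent family are independent across gaps of length
`q ≥ ℓ`. -/
theorem gapIndependentMultipliers {Ω' : Type*} [MeasurableSpace Ω'] {P' : Measure Ω'}
    [IsProbabilityMeasure P'] {ξ : Fin T → Ω' → ℝ} {ℓ M : ℝ} {q : ℕ} (hq : ℓ ≤ q)
    (hm : ∀ t, Measurable (ξ t)) (hdep : IsLDependent P' ℓ ξ) (h0 : ∀ t, ∫ ω', ξ t ω' ∂P' = 0)
    (h2 : ∀ t, ∫ ω', ξ t ω' ^ 2 ∂P' = 1) (hL : ∀ t, MemLp (ξ t) 4 P')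
    (h4 : ∀ t, ∫ ω', ξ t ω' ^ 4 ∂P' ≤ M) (hM : 0 ≤ M) :
    GapIndependentMultipliers P' (extendMultipliers ξ) q M := by
  have cases : ∀ {p : (Ω' → ℝ) → Prop}, (∀ t, p (ξ t)) → p (fun _ => 0) →
      ∀ t, p (extendMultipliers ξ t) := by
    intro p hp hp0 t
    rcases lt_or_ge t T with h | h
    · rw [extendMultipliers_of_lt ξ h]
      exact hp _
    · rw [extendMultipliers_of_le ξ h]
      exact hp0
  refine ⟨cases hm measurable_const, cases (p := fun f => MemLp f 4 P') hL MemLp.zero', ?_, ?_, ?_, fun r => ?_⟩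
  · exact cases (p := fun f => ∫ ω', f ω' ∂P' = 0) h0 (by simp)
  · exact cases (p := fun f => ∫ ω', f ω' ^ 2 ∂P' ≤ 1) (fun t => (h2 t).le) (by simp)
  · exact cases (p := fun f => ∫ ω', f ω' ^ 4 ∂P' ≤ M) h4 (by simpa using hM)
  rcases lt_or_ge r T with h | h
  · let k : Fin T := ⟨r, h⟩
    have m1 : Measurable fun (x : {s : Fin T // s ≤ k} → ℝ) (s : Set.Iic r) =>
        x ⟨⟨s, lt_of_le_of_lt s.2 h⟩, s.2⟩ :=
      measurable_pi_lambda _ fun s => measurable_pi_apply _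
    have m2 : Measurable fun (x : {s : Fin T // ((k : ℕ) : ℝ) + ℓ < ((s : ℕ) : ℝ)} → ℝ)
        (t : Set.Ioi (r + q)) => if ht : (t : ℕ) < T then x ⟨⟨t, ht⟩, by
          have : ((r + q : ℕ) : ℝ) < (t : ℕ) := by exact_mod_cast t.2
          push_cast at this
          change (r : ℝ) + ℓ < (t : ℕ)
          linarith⟩ else 0 := by
      refine measurable_pi_lambda _ fun t => ?_
      split_ifs
      · exact measurable_pi_apply _
      · exact measurable_const
    convert (hdep k).comp m1 m2 using 1
    · funext ω' s
      rw [extendMultipliers_of_lt ξ (lt_of_le_of_lt s.2 h)]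
      rfl
    · rfl
  · have : (fun ω' (t : Set.Ioi (r + q)) => extendMultipliers ξ t ω') = fun _ _ => 0 := by
      funext ω' t
      have ht : r + q < (t : ℕ) := t.2
      rw [extendMultipliers_of_le ξ (by omega)]
    rw [this]
    exact indepFun_const_right _ _

end Panel

end DWB

namespace DWB

section PanelProcess

variable {Ω : Type*} [MeasurableSpace Ω] {P : Measure Ω}
  {g : ∀ N : ℕ, (ℕ → Fin N → ℝ) → Fin N → ℝ} {ε εc : ∀ N : ℕ, ℤ → Ω → Fin N → ℝ}
  {D : ∀ N T : ℕ, Fin T → Finset (Fin N)} {δ : ℝ}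

namespace WeakDependence

theorem measurable_pathSum_innovations (hU : WeakDependence P g ε εc D δ) (N T t : ℕ) :
    Measurable fun ω => pathSum (g N) (D N T) t fun j => ε N j ω :=
  (measurable_pathSum (hU.measurable_g N) _ t).comp
    (measurable_pi_lambda _ fun j => hU.measurable_innovation N j)

theorem integrable_pathSum (hU : WeakDependence P g ε εc D δ) (N T t : ℕ) :
    Integrable (fun ω => pathSum (g N) (D N T) t fun j => ε N j ω) P := by
  unfold pathSum normalizedSum
  refine (integrable_finsetSum _ fun i _ => ?_).const_mul _
  exact hU.integrable N ((t : ℤ) + 1) i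

theorem integral_pathSum (hU : WeakDependence P g ε εc D δ) (N T t : ℕ) :
    ∫ ω, (pathSum (g N) (D N T) t fun j => ε N j ω) ∂P = 0 := by
  have h : ∀ i, ∫ ω, g N (fun k : ℕ => ε N ((t : ℤ) + 1 - k) ω) i ∂P = 0 := fun i =>
    hU.mean_zero N ((t : ℤ) + 1) i
  have hi : ∀ i, Integrable (fun ω => g N (fun k : ℕ => ε N ((t : ℤ) + 1 - k) ω) i) P := fun i =>
    hU.integrable N ((t : ℤ) + 1) i
  unfold pathSum normalizedSum
  rw [integral_const_mul, integral_finsetSum _ fun i _ => hi i]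
  simp [h]

variable [IsProbabilityMeasure P]

/-- With `m² λ_m ≤ C` and `(m + 1)² ≤ 4 m²`, the coupling distances have the rate `(m + 1)⁻²` in
`L⁴`. -/
theorem eLpNorm_sub_splicedValue_le (hU : WeakDependence P g ε εc D δ) {N T : ℕ} {C : ℝ≥0}
    (hC : ∀ t : Fin T, depCoeff P (g N) (ε N) (εc N) δ (D N T t) (date t) 0
      + ∑' m : ℕ, (m : ℝ≥0∞) ^ 2 *
          depCoeff P (g N) (ε N) (εc N) δ (D N T t) (date t) m ≤ C) {r t : ℕ} (hrt : r < t) :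
    eLpNorm (fun ω => (pathSum (g N) (D N T) t fun j => ε N j ω)
        - splicedValue (ε N) (εc N) (pathSum (g N) (D N T)) r t ω) 4 P
      ≤ ENNReal.ofReal ((4 * C + 1) * lagBound (t - r)) := by
  rcases lt_or_ge t T with h | h
  · have h1 : ((t - r : ℕ) : ℝ≥0∞) ^ 2 *
        depCoeff P (g N) (ε N) (εc N) δ (D N T ⟨t, h⟩) (date ⟨t, h⟩) (t - r) ≤ C :=
      (ENNReal.le_tsum (t - r)).trans (le_add_self.trans (hC ⟨t, h⟩))
    have h2 : eLpNorm (fun ω => (pathSum (g N) (D N T) t fun j => ε N j ω)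
        - splicedValue (ε N) (εc N) (pathSum (g N) (D N T)) r t ω) 4 P
        ≤ depCoeff P (g N) (ε N) (εc N) δ (D N T ⟨t, h⟩) (date ⟨t, h⟩) (t - r) := by
      unfold depCoeff
      have e : ∀ ω, (pathSum (g N) (D N T) t fun j => ε N j ω)
          - splicedValue (ε N) (εc N) (pathSum (g N) (D N T)) r t ω
          = normalizedSum (D N T ⟨t, h⟩) (crossSection (g N) (ε N) (date ⟨t, h⟩) ω)
            - normalizedSum (D N T ⟨t, h⟩)
              (coupledCrossSection (g N) (ε N) (εc N) (t - r) (date ⟨t, h⟩) ω) := fun ω => by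
        rw [← pathSum_innovations (g N) (ε N) (D N T) ⟨t, h⟩,
          ← splicedValue_pathSum (g N) (ε N) (εc N) (D N T) ⟨t, h⟩ hrt]
      simp_rw [e]
      refine eLpNorm_le_eLpNorm_of_exponent_le ?_ ?_
      · rw [← ENNReal.ofReal_ofNat]
        exact ENNReal.ofReal_le_ofReal hU.four_le
      · simp_rw [← e]
        exact ((hU.measurable_pathSum_innovations N T t).sub
          (measurable_splicedValue (hU.measurable_innovation N) (hU.measurable_copy N)
            (measurable_pathSum (hU.measurable_g N) _) r t)).aestronglyMeasurable
    refine h2.trans ?_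
    have hm : (1 : ℝ) ≤ (t - r : ℕ) := by exact_mod_cast (by omega : 1 ≤ t - r)
    have hm0 : ((t - r : ℕ) : ℝ≥0∞) ^ 2 ≠ 0 := by
      have : t - r ≠ 0 := by omega
      positivity
    have hmt : ((t - r : ℕ) : ℝ≥0∞) ^ 2 ≠ ∞ := ENNReal.pow_ne_top (ENNReal.natCast_ne_top _)
    rw [← ENNReal.mul_le_mul_iff_right hm0 hmt]
    refine h1.trans ?_
    rw [← ENNReal.ofReal_natCast, ← ENNReal.ofReal_pow (by positivity),
      ← ENNReal.ofReal_mul (by positivity), ← ENNReal.ofReal_coe_nnreal]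
    refine ENNReal.ofReal_le_ofReal ?_
    unfold lagBound
    rw [mul_one_div, ← mul_div_assoc, le_div_iff₀ (by positivity)]
    have hC0 : (0 : ℝ) ≤ C := C.2
    nlinarith [mul_nonneg hC0 (sq_nonneg (((t - r : ℕ) : ℝ) - 1)), mul_nonneg hC0 (sub_nonneg.2 hm),
      mul_nonneg (mul_nonneg hC0 (sub_nonneg.2 hm)) (sub_nonneg.2 hm)]
  · have e : ∀ ω, (pathSum (g N) (D N T) t fun j => ε N j ω)
        - splicedValue (ε N) (εc N) (pathSum (g N) (D N T)) r t ω = 0 := fun ω => by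
      unfold splicedValue
      rw [pathSum_of_le _ _ h, pathSum_of_le _ _ h, sub_zero]
    simp_rw [e]
    simp

/-- The coefficient `λ_0` compares `Ū_t` with an independent copy, hence bounds `Ū_t` itself. -/
theorem eLpNorm_pathSum_le (hU : WeakDependence P g ε εc D δ) {N T : ℕ} {C : ℝ≥0}
    (hC : ∀ t : Fin T, depCoeff P (g N) (ε N) (εc N) δ (D N T t) (date t) 0
      + ∑' m : ℕ, (m : ℝ≥0∞) ^ 2 *
          depCoeff P (g N) (ε N) (εc N) δ (D N T t) (date t) m ≤ C) (t : ℕ) :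
    eLpNorm (fun ω => pathSum (g N) (D N T) t fun j => ε N j ω) 4 P
      ≤ ENNReal.ofReal (4 * C + 1) := by
  have hmF := measurable_pathSum (hU.measurable_g N) (D N T)
  rcases lt_or_ge t T with h | h
  · have hm := hU.measurable_pathSum_innovations N T t
    have hmc : Measurable fun ω => pathSum (g N) (D N T) t fun j => εc N j ω :=
      (hmF t).comp (measurable_pi_lambda _ fun j => hU.measurable_copy N j)
    have hid : IdentDistrib (fun ω => pathSum (g N) (D N T) t fun j => εc N j ω)
        (fun ω => pathSum (g N) (D N T) t fun j => ε N j ω) P P := (hU.copy_law N).comp (hmF t)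
    have h1 := eLpNorm_le_eLpNorm_sub_of_indepFun hm hmc (hU.integrable_pathSum N T t)
      (hid.integrable_iff.2 (hU.integrable_pathSum N T t))
      (hid.integral_eq.trans (hU.integral_pathSum N T t))
      ((hU.copy_indep N).comp (hmF t) (hmF t)) (p := ENNReal.ofReal δ)
      (by
        rw [← ENNReal.ofReal_one]
        exact ENNReal.ofReal_le_ofReal (by linarith [hU.four_le]))
    have e : ∀ ω, (pathSum (g N) (D N T) t fun j => ε N j ω)
        - (pathSum (g N) (D N T) t fun j => εc N j ω)
        = normalizedSum (D N T ⟨t, h⟩) (crossSection (g N) (ε N) (date ⟨t, h⟩) ω)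
          - normalizedSum (D N T ⟨t, h⟩)
            (coupledCrossSection (g N) (ε N) (εc N) 0 (date ⟨t, h⟩) ω) := fun ω => by
      rw [← pathSum_innovations (g N) (ε N) (D N T) ⟨t, h⟩]
      have : coupledCrossSection (g N) (ε N) (εc N) 0 (date ⟨t, h⟩) ω
          = crossSection (g N) (εc N) (date ⟨t, h⟩) ω := by
        simp [coupledCrossSection, crossSection]
      rw [this, ← pathSum_innovations (g N) (εc N) (D N T) ⟨t, h⟩]
    simp_rw [e] at h1
    refine le_trans ?_ (h1.trans ((le_self_add.trans (hC ⟨t, h⟩)).trans ?_))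
    · refine eLpNorm_le_eLpNorm_of_exponent_le ?_ hm.aestronglyMeasurable
      rw [← ENNReal.ofReal_ofNat]
      exact ENNReal.ofReal_le_ofReal hU.four_le
    · rw [← ENNReal.ofReal_coe_nnreal]
      refine ENNReal.ofReal_le_ofReal ?_
      have hC0 : (0 : ℝ) ≤ C := C.2
      linarith
  · simp_rw [pathSum_of_le _ _ h]
    simp

/-- The normalised cross-sectional sums form a coupled process. -/
theorem coupledProcess (hU : WeakDependence P g ε εc D δ) {N T : ℕ} {C : ℝ≥0}
    (hC : ∀ t : Fin T, depCoeff P (g N) (ε N) (εc N) δ (D N T t) (date t) 0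
      + ∑' m : ℕ, (m : ℝ≥0∞) ^ 2 *
          depCoeff P (g N) (ε N) (εc N) δ (D N T t) (date t) m ≤ C) :
    CoupledProcess P (fun t ω => pathSum (g N) (D N T) t fun j => ε N j ω)
      (splicedValue (ε N) (εc N) (pathSum (g N) (D N T))) (4 * C + 1) := by
  have hK : (0 : ℝ) < 4 * C + 1 := by
    have hC0 : (0 : ℝ) ≤ C := C.2
    linarith
  have hmF := measurable_pathSum (hU.measurable_g N) (D N T)
  have hL : ∀ t, MemLp (fun ω => pathSum (g N) (D N T) t fun j => ε N j ω) 4 P := fun t =>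
    ⟨(hU.measurable_pathSum_innovations N T t).aestronglyMeasurable,
      (hU.eLpNorm_pathSum_le hC t).trans_lt ENNReal.ofReal_lt_top⟩
  refine CoupledProcess.of_causal (hU.measurable_innovation N) (hU.measurable_copy N) (hU.indep N)
    (hU.copy_indep N) (hU.copy_law N) hmF
    (fun t z z' h => pathSum_congr (g N) (D N T) t h) hK hL (hU.integral_pathSum N T)
    (fun t => ?_) fun r t hrt => ?_
  · exact (eLpNorm_le_ofReal_iff (n := 4) (by decide) (by decide) (hL t) hK.le).1
      (hU.eLpNorm_pathSum_le hC t)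
  · have hb := hU.eLpNorm_sub_splicedValue_le hC hrt
    refine (eLpNorm_le_ofReal_iff (n := 4) (by decide) (by decide) ⟨?_, ?_⟩
      (mul_nonneg hK.le (lagBound_nonneg _))).1 hb
    · exact ((hU.measurable_pathSum_innovations N T t).sub (measurable_splicedValue
        (hU.measurable_innovation N) (hU.measurable_copy N) hmF r t)).aestronglyMeasurable
    · exact hb.trans_lt ENNReal.ofReal_lt_top

end WeakDependence

end PanelProcess

/-! ### The bootstrap kernel -/

/-- A kernel approaches its value `1` at the origin at rate `|u|^{1/2}`: it is Lipschitz on `[-1, 1]`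
and bounded. -/
theorem IsBootstrapKernel.exists_abs_sub_one_le {a : ℝ → ℝ} (ha : IsBootstrapKernel a) :
    ∃ A : ℝ, 0 ≤ A ∧ ∀ u, |a u - 1| ≤ A * Real.sqrt |u| := by
  obtain ⟨K, hK⟩ := ha.lipschitz
  have hK0 : (0 : ℝ) ≤ K := K.2
  refine ⟨K + 1, by linarith, fun u => ?_⟩
  rcases le_or_gt |u| 1 with h | h
  · have h1 := hK.dist_le_mul u (abs_le.1 h) 0 (by simp)
    rw [Real.dist_eq, Real.dist_eq, ha.at_zero, sub_zero] at h1
    have h2 : |u| ≤ Real.sqrt |u| := Real.le_sqrt_of_sq_le (by nlinarith [abs_nonneg u])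
    nlinarith [Real.sqrt_nonneg |u|]
  · rw [ha.support u h, zero_sub, abs_neg, abs_one]
    have h2 : 1 ≤ Real.sqrt |u| := Real.one_le_sqrt.2 h.le
    nlinarith

theorem summable_sqrt_mul_lagBound : Summable fun k : ℕ => Real.sqrt k * lagBound k := by
  have h : Summable fun k : ℕ => ((k : ℝ) + 1) ^ (-(3 / 2) : ℝ) := by
    have := (Real.summable_nat_rpow (p := -(3 / 2))).2 (by norm_num)
    exact_mod_cast (summable_nat_add_iff 1).2 this
  refine Summable.of_nonneg_of_le (fun k => mul_nonneg (Real.sqrt_nonneg _) (lagBound_nonneg _))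
    (fun k => ?_) h
  have hk : (0 : ℝ) < (k : ℝ) + 1 := by positivity
  have e : ((k : ℝ) + 1) ^ (-(3 / 2) : ℝ) = Real.sqrt ((k : ℝ) + 1) * lagBound k := by
    have h2 : lagBound k = ((k : ℝ) + 1) ^ (-2 : ℝ) := by
      rw [lagBound, Real.rpow_neg hk.le, one_div]
      norm_cast
    rw [h2, Real.sqrt_eq_rpow, ← Real.rpow_add hk]
    norm_num
  rw [e]
  gcongr
  · exact lagBound_nonneg _
  · linarith

end DWB

/-! ### Choice of the block lengths -/

section BlockLengths

/-- Numbers `J` and lengths `L` of blocks separated by gaps of length `q`, for weights bounded by `b`: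
the total contribution of the blocks is bounded by `B`, whereas the gaps, the fourth moments of the
block sums and the decoupling errors are negligible along `F`. -/
structure BlockScheme {ι : Type*} (F : Filter ι) (q L J : ι → ℕ) (b : ι → ℝ) (B : ℝ) : Prop where
  length_pos : ∀ i, 0 < L i
  nonneg : 0 ≤ B
  weight_nonneg : ∀ i, 0 ≤ b i
  blocks : ∀ᶠ i in F, (J i : ℝ) * L i * b i ^ 2 ≤ B
  gaps : Tendsto (fun i => (J i : ℝ) * q i * b i ^ 2) F (𝓝 0)
  fourth : Tendsto (fun i => (J i : ℝ) * L i ^ 2 * b i ^ 4) F (𝓝 0)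
  decoupling : Tendsto (fun i => (J i : ℝ) * (L i * (b i * lagBound (q i)))) F (𝓝 0)
  decoupling_sq : Tendsto (fun i => (J i : ℝ) * L i ^ 2 * b i ^ 2 * lagBound (q i)) F (𝓝 0)

/-- Blocks of length about `(qT)^{1/2}` work if `T^{1/2} ≤ q ≪ T` and `b ≲ T^{-1/2}`. -/
theorem exists_blockScheme {ι : Type*} {F : Filter ι} {T q : ι → ℕ} {b : ι → ℝ} {B : ℝ}
    (hT : Tendsto T F atTop) (hq : ∀ i, T i ≤ (q i + 1) ^ 2)
    (hqT : Tendsto (fun i => (q i : ℝ) / T i) F (𝓝 0)) (hB : 0 ≤ B) (hb0 : ∀ i, 0 ≤ b i)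
    (hb : ∀ i, b i ^ 2 ≤ B / T i) :
    ∃ L J : ι → ℕ, (∀ i, T i ≤ J i * (L i + q i)) ∧ BlockScheme F q L J b (2 * B) := by
  let L : ι → ℕ := fun i => Nat.sqrt (q i * T i) + 1
  let J : ι → ℕ := fun i => T i / (L i + q i) + 1
  have hL0 : ∀ i, 0 < L i := fun i => Nat.succ_pos _
  have hLlow : ∀ i, (q i : ℝ) * T i ≤ (L i : ℝ) ^ 2 := fun i => by
    have h := Nat.lt_succ_sqrt (q i * T i)
    have h' : q i * T i ≤ L i ^ 2 := by
      rw [sq]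
      exact h.le
    exact_mod_cast h'
  have hLup : ∀ i, (L i : ℝ) ≤ Real.sqrt ((q i : ℝ) * T i) + 1 := fun i => by
    have := Real.nat_sqrt_le_real_sqrt (a := q i * T i)
    push_cast [L] at this ⊢
    linarith
  have hTpos : ∀ᶠ i in F, (0 : ℝ) < T i := by
    filter_upwards [hT.eventually_gt_atTop 0] with i hi
    exact_mod_cast hi
  have hsq : Tendsto (fun i => Real.sqrt ((q i : ℝ) / T i)) F (𝓝 0) := by
    simpa using hqT.sqrt
  have hTinv : Tendsto (fun i => ((T i : ℝ))⁻¹) F (𝓝 0) :=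
    tendsto_inv_atTop_zero.comp (tendsto_natCast_atTop_atTop.comp hT)
  have hr : Tendsto (fun i => (L i : ℝ) / T i) F (𝓝 0) := by
    refine squeeze_zero' (Eventually.of_forall fun i => by positivity) ?_
      (by simpa using hsq.add hTinv)
    filter_upwards [hTpos] with i hi
    rw [div_le_iff₀ hi, add_mul, inv_mul_cancel₀ hi.ne']
    refine (hLup i).trans_eq ?_
    congr 1
    rw [show (q i : ℝ) * T i = (q i : ℝ) / T i * (T i : ℝ) ^ 2 by field_simp,
      Real.sqrt_mul (by positivity), Real.sqrt_sq hi.le, Real.sqrt_div (Nat.cast_nonneg _)]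
  have hs : Tendsto (fun i => (q i : ℝ) / L i) F (𝓝 0) := by
    refine squeeze_zero' (Eventually.of_forall fun i => by positivity) ?_ hsq
    filter_upwards [hTpos] with i hi
    refine Real.le_sqrt_of_sq_le ?_
    have hL : (0 : ℝ) < L i := by exact_mod_cast hL0 i
    rw [div_pow, div_le_div_iff₀ (by positivity) hi]
    nlinarith [hLlow i, (Nat.cast_nonneg (q i) : (0 : ℝ) ≤ q i)]
  have hJ : ∀ᶠ i in F, (J i : ℝ) * (L i + q i) ≤ 2 * T i := by
    have h1 : Tendsto (fun i => (L i : ℝ) / T i + (q i : ℝ) / T i) F (𝓝 0) := by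
      simpa using hr.add hqT
    filter_upwards [hTpos, h1.eventually_le_const one_pos] with i hi h
    rw [← add_div, div_le_one hi] at h
    have h2 : ((T i / (L i + q i) : ℕ) : ℝ) * (L i + q i) ≤ T i := by
      exact_mod_cast Nat.div_mul_le_self (T i) (L i + q i)
    push_cast [J]
    linarith
  have hJL : ∀ᶠ i in F, (J i : ℝ) * L i ≤ 2 * T i := by
    filter_upwards [hJ] with i hi
    refine le_trans ?_ hi
    gcongr
    simp
  have hb2 : ∀ᶠ i in F, b i ^ 2 * T i ≤ B := by
    filter_upwards [hTpos] with i hi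
    exact (le_div_iff₀ hi).1 (hb i)
  have hlag : ∀ᶠ i in F, lagBound (q i) ≤ (T i : ℝ)⁻¹ := by
    filter_upwards [hTpos] with i hi
    unfold lagBound
    rw [one_div]
    refine inv_anti₀ hi ?_
    exact_mod_cast hq i
  have hblocks : ∀ᶠ i in F, (J i : ℝ) * L i * b i ^ 2 ≤ 2 * B := by
    filter_upwards [hJL, hb2] with i h1 h2
    nlinarith [sq_nonneg (b i)]
  have hsqT : Tendsto (fun i => (Real.sqrt (T i))⁻¹) F (𝓝 0) := by simpa using hTinv.sqrt
  refine ⟨L, J, fun i => ?_, hL0, by positivity, hb0, hblocks, ?_, ?_, ?_, ?_⟩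
  · have := Nat.lt_div_mul_add (a := T i) (b := L i + q i) (by have := hL0 i; omega)
    calc T i ≤ T i / (L i + q i) * (L i + q i) + (L i + q i) := this.le
      _ = J i * (L i + q i) := by ring
  · refine squeeze_zero' (Eventually.of_forall fun i => by positivity) ?_
      (by simpa using hs.const_mul (2 * B))
    filter_upwards [hblocks] with i h
    have hL : (0 : ℝ) < L i := by exact_mod_cast hL0 i
    calc (J i : ℝ) * q i * b i ^ 2 = (J i : ℝ) * L i * b i ^ 2 * (q i / L i) := by field_simp
      _ ≤ _ := by gcongr
  · refine squeeze_zero' (Eventually.of_forall fun i => by have := hb0 i; positivity) ?_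
      (by simpa using hr.const_mul (2 * B * B))
    filter_upwards [hblocks, hb2, hTpos] with i h h2 hi
    calc (J i : ℝ) * L i ^ 2 * b i ^ 4
        = (J i : ℝ) * L i * b i ^ 2 * (b i ^ 2 * T i) * (L i / T i) := by field_simp
      _ ≤ _ := by gcongr
  · refine squeeze_zero' (Eventually.of_forall fun i => by
      have := hb0 i
      have := lagBound_nonneg (q i)
      positivity) ?_ (by simpa using hsqT.const_mul (2 * Real.sqrt B))
    filter_upwards [hJL, hTpos, hlag] with i h hi h3
    have hbi : b i ≤ Real.sqrt B * (Real.sqrt (T i))⁻¹ := by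
      rw [← div_eq_mul_inv, ← Real.sqrt_div hB]
      exact Real.le_sqrt_of_sq_le (hb i)
    have h0 := lagBound_nonneg (q i)
    calc (J i : ℝ) * (L i * (b i * lagBound (q i))) = (J i : ℝ) * L i * b i * lagBound (q i) := by
          ring
      _ ≤ 2 * T i * (Real.sqrt B * (Real.sqrt (T i))⁻¹) * (T i : ℝ)⁻¹ := by
          have := hb0 i
          gcongr
      _ = _ := by field_simp
  · refine squeeze_zero' (Eventually.of_forall fun i => by
      have := lagBound_nonneg (q i)
      positivity) ?_ (by simpa using hr.const_mul (2 * B))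
    filter_upwards [hblocks, hTpos, hlag] with i h hi h3
    have h0 := lagBound_nonneg (q i)
    calc (J i : ℝ) * L i ^ 2 * b i ^ 2 * lagBound (q i)
        = (J i : ℝ) * L i * b i ^ 2 * (L i * lagBound (q i)) := by ring
      _ ≤ 2 * B * (L i * (T i : ℝ)⁻¹) := by gcongr
      _ = _ := by rw [div_eq_mul_inv]

end BlockLengths

/-! ### The limits along a block scheme -/

section Limits

variable {Ω Ω' ι : Type*} [MeasurableSpace Ω] [MeasurableSpace Ω'] {P : Measure Ω} {Q : Measure Ω'}
  [IsProbabilityMeasure P] {F : Filter ι} {X : ι → ℕ → Ω → ℝ}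
  {Y : ι → ℕ → ℕ → Ω → ℝ} {ξ : ι → ℕ → Ω' → ℝ} {w : ι → ℕ → ℝ} {q L J : ι → ℕ} {b : ι → ℝ}
  {B K M : ℝ}

theorem exists_pos_mul_le (a : ℝ) {δ : ℝ} (hδ : 0 < δ) :
    ∃ κ : ℝ, 0 < κ ∧ κ ≤ 1 ∧ κ * a ≤ δ := by
  refine ⟨min 1 (δ / (|a| + 1)), by positivity, min_le_left _ _, ?_⟩
  calc min 1 (δ / (|a| + 1)) * a ≤ min 1 (δ / (|a| + 1)) * (|a| + 1) := by
        gcongr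
        linarith [le_abs_self a]
    _ ≤ δ / (|a| + 1) * (|a| + 1) := by
        gcongr
        exact min_le_right _ _
    _ = δ := by field_simp

/-- Central limit theorem for the weighted sums, in terms of characteristic functions. -/
theorem BlockScheme.eventually_norm_expChar_sub_le (hS : BlockScheme F q L J b B)
    (hX : ∀ᶠ i in F, CoupledProcess P (X i) (Y i) K) (hw : ∀ᶠ i in F, ∀ t, |w i t| ≤ b i)
    {δ : ℝ} (hδ : 0 < δ) :
    ∀ᶠ i in F, ∀ x, ‖expChar P (fun ω => ∑ t ∈ Finset.range (J i * (L i + q i)),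
        w i t * X i t ω) x
      - ((Real.exp (-(x ^ 2 * blockVariance P (X i) (w i) (L i) (q i) (J i) / 2)) : ℝ) : ℂ)‖
      ≤ δ * (1 + x ^ 4) := by
  obtain ⟨κ, hκ, hκ1, hκδ⟩ := exists_pos_mul_le (1 + 20 * K ^ 2 * B) (half_pos hδ)
  have h : Tendsto (fun i => 4 * K ^ 2 / κ * ((J i : ℝ) * q i * b i ^ 2)
      + K * ((J i : ℝ) * (L i * (b i * lagBound (q i))))
      + 5 * (10 ^ 6 * K ^ 4) / κ * ((J i : ℝ) * L i ^ 2 * b i ^ 4)) F (𝓝 0) := by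
    simpa using ((hS.gaps.const_mul _).add (hS.decoupling.const_mul _)).add (hS.fourth.const_mul _)
  filter_upwards [hX, hw, hS.blocks, h.eventually_le_const (half_pos hδ)] with i h1 h2 h3 h4 x
  refine (h1.norm_expChar_sum_range_sub_exp_le h2 (hS.length_pos i) (q i) (J i) hκ hκ1 x).trans ?_
  rw [mul_comm δ]
  gcongr
  have h5 : κ * (4 * K ^ 2 * (J i * L i * b i ^ 2)) ≤ κ * (4 * K ^ 2 * B) := by gcongr
  have e1 : 4 * K ^ 2 * (J i * q i * b i ^ 2) / κ
      = 4 * K ^ 2 / κ * ((J i : ℝ) * q i * b i ^ 2) := by ring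
  have e2 : (J i : ℝ) * (L i * (b i * (K * lagBound (q i))))
      = K * ((J i : ℝ) * (L i * (b i * lagBound (q i)))) := by ring
  have e3 : 5 * (10 ^ 6 * K ^ 4 * (J i * L i ^ 2 * b i ^ 4) / κ)
      = 5 * (10 ^ 6 * K ^ 4) / κ * ((J i : ℝ) * L i ^ 2 * b i ^ 4) := by ring
  rw [e1, e2, e3]
  linarith

/-- The block variances inherit a positive lower bound from the variances of the sums. -/
theorem BlockScheme.eventually_le_blockVariance (hS : BlockScheme F q L J b B)
    (hX : ∀ᶠ i in F, CoupledProcess P (X i) (Y i) K) (hw : ∀ᶠ i in F, ∀ t, |w i t| ≤ b i)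
    {v : ℝ} (hv : 0 < v) (hvar : ∀ᶠ i in F,
      v ≤ ∫ ω, (∑ t ∈ Finset.range (J i * (L i + q i)), w i t * X i t ω) ^ 2 ∂P) :
    ∀ᶠ i in F, v / 4 ≤ blockVariance P (X i) (w i) (L i) (q i) (J i) := by
  have h : Tendsto (fun i => 4 * Real.sqrt (4 * K ^ 2 * B) * K
      * ((J i : ℝ) * (L i * (b i * lagBound (q i))))
      + 8 * K ^ 2 * ((J i : ℝ) * q i * b i ^ 2)) F (𝓝 0) := by
    simpa using (hS.decoupling.const_mul _).add (hS.gaps.const_mul _)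
  filter_upwards [hX, hw, hS.blocks, hvar, h.eventually_le_const (half_pos hv)] with i h1 h2 h3 h4 h5
  have hB := hS.nonneg
  have h6 := h1.integral_sq_sum_range_le h2 (hS.length_pos i) (q i) (J i)
    (Real.sqrt_nonneg (4 * K ^ 2 * B)) (by
      rw [Real.sq_sqrt (by positivity)]
      gcongr)
  have e2 : 4 * ((J i : ℝ) * (Real.sqrt (4 * K ^ 2 * B) * (L i * (b i * (K * lagBound (q i))))))
      = 4 * Real.sqrt (4 * K ^ 2 * B) * K * ((J i : ℝ) * (L i * (b i * lagBound (q i)))) := by ring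
  rw [e2] at h6
  linarith

theorem BlockScheme.eventually_blockVariance_le (hS : BlockScheme F q L J b B)
    (hX : ∀ᶠ i in F, CoupledProcess P (X i) (Y i) K) (hw : ∀ᶠ i in F, ∀ t, |w i t| ≤ b i) :
    ∀ᶠ i in F, blockVariance P (X i) (w i) (L i) (q i) (J i) ≤ 4 * K ^ 2 * B := by
  filter_upwards [hX, hw, hS.blocks] with i h1 h2 h3
  refine (h1.blockVariance_le h2 (L i) (q i) (J i)).trans ?_
  gcongr

variable [IsProbabilityMeasure Q]

/-- Conditional central limit theorem for the sums with multipliers, in terms of characteristic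
functions: it holds with the same block variances as for the sums without multipliers, outside of
events of vanishing probability. -/
theorem BlockScheme.tendsto_measure_conditional (hS : BlockScheme F q L J b B)
    (hX : ∀ᶠ i in F, CoupledProcess P (X i) (Y i) K) (hw : ∀ᶠ i in F, ∀ t, |w i t| ≤ b i)
    (hξ : ∀ i, GapIndependentMultipliers Q (ξ i) (q i) M) (hM : 0 ≤ M)
    {ρ : ι → ℕ → ℝ} {β : ι → ℝ} (hρ : ∀ i k, 0 ≤ ρ i k)
    (hβ : ∀ i n, ∑ k ∈ Finset.range n, ρ i k ≤ β i) (hβ0 : Tendsto β F (𝓝 0))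
    (hα : ∀ i t s, w i t ≠ 0 → w i s ≠ 0 →
      |∫ ω', ξ i t ω' * ξ i s ω' ∂Q - 1| * lagBound (Nat.dist t s) ≤ ρ i (Nat.dist t s))
    {δ : ℝ} (hδ : 0 < δ) :
    Tendsto (fun i => P {ω | ¬ ∀ x,
        ‖expChar Q (fun ω' => ∑ t ∈ Finset.range (J i * (L i + q i)),
          w i t * X i t ω * ξ i t ω') x
        - ((Real.exp (-(x ^ 2 * blockVariance P (X i) (w i) (L i) (q i) (J i) / 2)) : ℝ) : ℂ)‖
        ≤ δ * (1 + x ^ 4)}) F (𝓝 0) := by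
  have hB := hS.nonneg
  rw [ENNReal.tendsto_nhds_zero]
  intro η hη
  -- a finite threshold below `η`
  obtain ⟨θ, hθ, hθη⟩ : ∃ θ : ℝ, 0 < θ ∧ ENNReal.ofReal θ ≤ η := by
    rcases eq_or_ne η ∞ with rfl | h
    · exact ⟨1, one_pos, le_top⟩
    · exact ⟨η.toReal, ENNReal.toReal_pos hη.ne' h, (ENNReal.ofReal_toReal h).le⟩
  have hδθ : 0 < δ * θ := mul_pos hδ hθ
  obtain ⟨κ, hκ, hκ1, hκδ⟩ := exists_pos_mul_le (1 + 20 * K ^ 2 * B) (half_pos hδθ)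
  set c : ℝ := Real.sqrt (10 ^ 6 * K ^ 4 * M) with hc
  have hc2 : c ^ 2 = 10 ^ 6 * K ^ 4 * M := Real.sq_sqrt (by positivity)
  have hc0 : 0 ≤ c := Real.sqrt_nonneg _
  have h : Tendsto (fun i => 4 * K ^ 2 / κ * ((J i : ℝ) * q i * b i ^ 2)
      + 5 * (10 ^ 6 * K ^ 4) * M / κ * ((J i : ℝ) * L i ^ 2 * b i ^ 4)
      + Real.sqrt (c ^ 2 * ((J i : ℝ) * L i ^ 2 * b i ^ 4)
        + 4 * K ^ 2 * c * B * ((J i : ℝ) * L i ^ 2 * b i ^ 2 * lagBound (q i)))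
      + 2 * K ^ 2 * B * β i) F (𝓝 0) := by
    have h1 : Tendsto (fun i => Real.sqrt (c ^ 2 * ((J i : ℝ) * L i ^ 2 * b i ^ 4)
        + 4 * K ^ 2 * c * B * ((J i : ℝ) * L i ^ 2 * b i ^ 2 * lagBound (q i)))) F (𝓝 0) := by
      simpa using ((hS.fourth.const_mul (c ^ 2)).add
        (hS.decoupling_sq.const_mul (4 * K ^ 2 * c * B))).sqrt
    simpa using (((hS.gaps.const_mul _).add (hS.fourth.const_mul _)).add h1).add
      (hβ0.const_mul (2 * K ^ 2 * B))
  filter_upwards [hX, hw, hS.blocks, h.eventually_le_const (half_pos hδθ)] with i h1 h2 h3 h4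
  have hb0 := hS.weight_nonneg i
  have hβi : 0 ≤ β i := by simpa using hβ i 0
  have hlag := lagBound_nonneg (q i)
  obtain ⟨err, herr, herr0, herrx, herrI⟩ := exists_conditional_error h1 (hξ i) h2 (hρ i) (hβ i)
    (hα i) (hS.length_pos i) (J i) (G := c * (L i * b i ^ 2)) (by positivity)
    (by
      rw [mul_pow, hc2]
      exact le_of_eq (by ring)) hκ hκ1
  have hint : ∫ ω, err ω ∂P ≤ δ * θ := by
    refine herrI.trans ?_
    have h5 : κ * (4 * K ^ 2 * (J i * L i * b i ^ 2)) ≤ κ * (4 * K ^ 2 * B) := by gcongr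
    have h6 : Real.sqrt (J i * ((c * (L i * b i ^ 2)) ^ 2
        + 2 * (J i * (c * (L i * b i ^ 2)) * (L i ^ 2 * b i ^ 2 * (2 * K ^ 2 * lagBound (q i))))))
        ≤ Real.sqrt (c ^ 2 * ((J i : ℝ) * L i ^ 2 * b i ^ 4)
          + 4 * K ^ 2 * c * B * ((J i : ℝ) * L i ^ 2 * b i ^ 2 * lagBound (q i))) := by
      refine Real.sqrt_le_sqrt ?_
      calc J i * ((c * (L i * b i ^ 2)) ^ 2
        + 2 * (J i * (c * (L i * b i ^ 2)) * (L i ^ 2 * b i ^ 2 * (2 * K ^ 2 * lagBound (q i)))))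
          = c ^ 2 * ((J i : ℝ) * L i ^ 2 * b i ^ 4) + 4 * K ^ 2 * c * ((J i : ℝ) * L i * b i ^ 2)
            * ((J i : ℝ) * L i ^ 2 * b i ^ 2 * lagBound (q i)) := by ring
        _ ≤ _ := by gcongr
    have h7 : 2 * β i * K ^ 2 * (J i * L i * b i ^ 2) ≤ 2 * β i * K ^ 2 * B := by gcongr
    have e1 : 4 * K ^ 2 * (J i * q i * b i ^ 2) / κ
        = 4 * K ^ 2 / κ * ((J i : ℝ) * q i * b i ^ 2) := by ring
    have e3 : 5 * (10 ^ 6 * K ^ 4 * (J i * L i ^ 2 * b i ^ 4) * M / κ)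
        = 5 * (10 ^ 6 * K ^ 4) * M / κ * ((J i : ℝ) * L i ^ 2 * b i ^ 4) := by ring
    rw [e1, e3]
    linarith
  have hmarkov := mul_meas_ge_le_integral_of_nonneg (ae_of_all P herr0) herr δ
  have hreal : P.real {ω | δ ≤ err ω} ≤ θ :=
    le_of_mul_le_mul_left (hmarkov.trans hint) hδ
  refine le_trans (measure_mono (t := {ω | δ ≤ err ω}) fun ω hω => ?_) (le_trans ?_ hθη)
  · by_contra hlt
    refine hω fun x => (herrx ω x).trans ?_
    rw [mul_comm]
    have : err ω ≤ δ := (not_le.1 hlt).le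
    gcongr
  · rw [← ENNReal.ofReal_toReal (measure_ne_top P {ω | δ ≤ err ω})]
    exact ENNReal.ofReal_le_ofReal hreal

end Limits

/-! ### Consistency of the bootstrap -/

theorem measureReal_map_Iic {Ω : Type*} [MeasurableSpace Ω] (P : Measure Ω) {f : Ω → ℝ}
    (hf : Measurable f) (x : ℝ) : (P.map f).real (Set.Iic x) = P.real {ω | f ω ≤ x} :=
  map_measureReal_apply hf measurableSet_Iic

theorem abs_natCast_sub_eq_dist (t s : ℕ) : |(t : ℝ) - s| = (Nat.dist t s : ℕ) := by
  rcases le_total t s with h | h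
  · rw [Nat.dist_eq_sub_of_le h, Nat.cast_sub h, abs_sub_comm, abs_of_nonneg]
    exact sub_nonneg.2 (by exact_mod_cast h)
  · rw [Nat.dist_eq_sub_of_le_right h, Nat.cast_sub h, abs_of_nonneg]
    exact sub_nonneg.2 (by exact_mod_cast h)

namespace DWB

variable {Ω' : Type*} [MeasurableSpace Ω'] {P' : Measure Ω'} {a : ℝ → ℝ} {ℓ : ℕ → ℕ → ℝ}
  {ξ : ∀ _N T : ℕ, Fin T → Ω' → ℝ}

/-- The gap between blocks: at least `ℓ` for the independence of the bootstrap weights, and at least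
`T^{1/2}` so that the decoupling errors, added up over the blocks, vanish. -/
noncomputable def gapLength (ℓ : ℝ) (T : ℕ) : ℕ := ⌈ℓ⌉₊ + Nat.sqrt T

theorem le_gapLength (ℓ : ℝ) (T : ℕ) : ℓ ≤ gapLength ℓ T := by
  refine (Nat.le_ceil ℓ).trans ?_
  exact_mod_cast Nat.le_add_right _ _

theorem le_gapLength_add_one_sq (ℓ : ℝ) (T : ℕ) : T ≤ (gapLength ℓ T + 1) ^ 2 := by
  have h := Nat.lt_succ_sqrt T
  have h2 : Nat.succ (Nat.sqrt T) ≤ gapLength ℓ T + 1 := by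
    unfold gapLength
    omega
  rw [sq]
  exact h.le.trans (Nat.mul_le_mul h2 h2)

theorem BootstrapWeights.tendsto_gapLength_div (hξ : BootstrapWeights P' a ℓ ξ) :
    Tendsto (fun p : ℕ × ℕ => (gapLength (ℓ p.1 p.2) p.2 : ℝ) / (p.2 : ℝ)) (atTop ×ˢ atTop)
      (𝓝 0) := by
  have hT : Tendsto (fun p : ℕ × ℕ => (p.2 : ℝ)) (atTop ×ˢ atTop) atTop :=
    tendsto_natCast_atTop_atTop.comp tendsto_snd
  have h1 : Tendsto (fun p : ℕ × ℕ => ((p.2 : ℝ))⁻¹) (atTop ×ˢ atTop) (𝓝 0) :=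
    tendsto_inv_atTop_zero.comp hT
  have h2 : Tendsto (fun p : ℕ × ℕ => Real.sqrt ((p.2 : ℝ))⁻¹) (atTop ×ˢ atTop) (𝓝 0) := by
    have h := (Real.continuous_sqrt.tendsto 0).comp h1
    rwa [Real.sqrt_zero] at h
  have h3 := (hξ.bandwidth_small.add h1).add h2
  rw [add_zero, add_zero] at h3
  refine squeeze_zero' (Eventually.of_forall fun p => by positivity) ?_ h3
  filter_upwards [hT.eventually_gt_atTop 0] with p hp
  have h4 : (⌈ℓ p.1 p.2⌉₊ : ℝ) ≤ ℓ p.1 p.2 + 1 := (Nat.ceil_lt_add_one (hξ.bandwidth_pos _ _).le).le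
  have h5 : (Nat.sqrt p.2 : ℝ) ≤ Real.sqrt p.2 := Real.nat_sqrt_le_real_sqrt
  have h6 : Real.sqrt ((p.2 : ℝ))⁻¹ = Real.sqrt p.2 / p.2 := by
    rw [Real.sqrt_inv, eq_div_iff hp.ne']
    nth_rewrite 2 [← Real.mul_self_sqrt hp.le]
    have : Real.sqrt p.2 ≠ 0 := (Real.sqrt_pos.2 hp).ne'
    field_simp
  rw [h6, ← one_div, ← add_div, ← add_div]
  unfold gapLength
  push_cast
  gcongr

theorem BootstrapWeights.exists_gapIndependentMultipliers [IsProbabilityMeasure P']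
    (hξ : BootstrapWeights P' a ℓ ξ) : ∃ M : ℝ, 0 ≤ M ∧ ∀ p : ℕ × ℕ,
      GapIndependentMultipliers P' (extendMultipliers (ξ p.1 p.2))
        (gapLength (ℓ p.1 p.2) p.2) M := by
  obtain ⟨M, hM⟩ := hξ.fourth_moment
  exact ⟨max M 0, le_max_right _ _, fun p => gapIndependentMultipliers (le_gapLength _ _)
    (hξ.measurable _ _) (hξ.lDependent _ _) (hξ.mean_zero _ _) (hξ.variance_one _ _)
    (hξ.memLp_four _ _) (fun t => (hM _ _ t).trans (le_max_left _ _)) (le_max_right _ _)⟩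

/-- The difference between the covariances of the bootstrap weights and `1`, damped by the decay of
the covariances of the data, is summable over the lags with a sum of order `ℓ^{-1/2}`. -/
theorem BootstrapWeights.exists_covariance_bound (hξ : BootstrapWeights P' a ℓ ξ) :
    ∃ (ρ : ℕ × ℕ → ℕ → ℝ) (β : ℕ × ℕ → ℝ), (∀ p k, 0 ≤ ρ p k) ∧
      (∀ p n, ∑ k ∈ Finset.range n, ρ p k ≤ β p) ∧ Tendsto β (atTop ×ˢ atTop) (𝓝 0) ∧
      ∀ (p : ℕ × ℕ) (t s : ℕ), t < p.2 → s < p.2 →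
        |∫ ω', extendMultipliers (ξ p.1 p.2) t ω' * extendMultipliers (ξ p.1 p.2) s ω' ∂P' - 1|
          * lagBound (Nat.dist t s) ≤ ρ p (Nat.dist t s) := by
  obtain ⟨A, hA, hA1⟩ := hξ.kernel.exists_abs_sub_one_le
  have hρ0 : ∀ k : ℕ, 0 ≤ Real.sqrt k * lagBound k := fun k =>
    mul_nonneg (Real.sqrt_nonneg _) (lagBound_nonneg k)
  refine ⟨fun p k => A * (Real.sqrt (ℓ p.1 p.2))⁻¹ * (Real.sqrt k * lagBound k),
    fun p => A * (Real.sqrt (ℓ p.1 p.2))⁻¹ * ∑' k : ℕ, Real.sqrt k * lagBound k,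
    fun p k => mul_nonneg (by positivity) (hρ0 k), fun p n => ?_, ?_, fun p t s ht hs => ?_⟩
  · rw [← Finset.mul_sum]
    exact mul_le_mul_of_nonneg_left (summable_sqrt_mul_lagBound.sum_le_tsum _ fun k _ => hρ0 k)
      (by positivity)
  · have h := tendsto_inv_atTop_zero.comp (Real.tendsto_sqrt_atTop.comp hξ.bandwidth_atTop)
    simpa using (h.const_mul A).mul_const (∑' k : ℕ, Real.sqrt k * lagBound k)
  · rw [extendMultipliers_of_lt _ ht, extendMultipliers_of_lt _ hs, hξ.covariance]
    simp only
    have h := hA1 (((t : ℝ) - s) / ℓ p.1 p.2)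
    rw [abs_div, abs_of_pos (hξ.bandwidth_pos _ _), abs_natCast_sub_eq_dist,
      Real.sqrt_div (Nat.cast_nonneg _)] at h
    calc _ ≤ A * (Real.sqrt (Nat.dist t s : ℕ) / Real.sqrt (ℓ p.1 p.2))
          * lagBound (Nat.dist t s) :=
          mul_le_mul_of_nonneg_right h (lagBound_nonneg _)
      _ = _ := by ring

theorem BalancedInTheLimit.eventually_dateWeight_le {D : ∀ N T : ℕ, Fin T → Finset (Fin N)} {c : ℝ}
    (hD : BalancedInTheLimit D c) : ∀ᶠ p : ℕ × ℕ in atTop ×ˢ atTop, ∀ t,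
      |dateWeight (D p.1 p.2) t| ≤ Real.sqrt (2 * c / p.2) := by
  have hT : Tendsto (fun p : ℕ × ℕ => (p.2 : ℝ)) (atTop ×ˢ atTop) atTop :=
    tendsto_natCast_atTop_atTop.comp tendsto_snd
  filter_upwards [hD.2.eventually_le_const (show c < 2 * c by linarith [hD.1]),
    hT.eventually_gt_atTop 0] with p h1 h2 t
  rw [abs_of_nonneg (dateWeight_nonneg _ _)]
  refine (dateWeight_le _ t).trans (Real.sqrt_le_sqrt ?_)
  rw [le_div_iff₀ h2]
  refine le_of_eq_of_le ?_ h1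
  ring

end DWB

theorem corollary2p2
    {Ω Ω' : Type*} [MeasurableSpace Ω] [MeasurableSpace Ω']
    (P : Measure Ω) [IsProbabilityMeasure P] (P' : Measure Ω') [IsProbabilityMeasure P']
    (g : ∀ N : ℕ, (ℕ → Fin N → ℝ) → Fin N → ℝ) (ε εc : ∀ N : ℕ, ℤ → Ω → Fin N → ℝ)
    (D : ∀ N T : ℕ, Fin T → Finset (Fin N)) (δ : ℝ)
    (a : ℝ → ℝ) (ℓ : ℕ → ℕ → ℝ) (ξ : ∀ _N T : ℕ, Fin T → Ω' → ℝ) (c : ℝ)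
    (hU : DWB.WeakDependence P g ε εc D δ)
    (hσ : DWB.NondegenerateVariance P g ε D)
    (hξ : DWB.BootstrapWeights P' a ℓ ξ)
    (hD : DWB.BalancedInTheLimit D c) :
    TendstoInMeasure P
      (fun (p : ℕ × ℕ) (ω : Ω) => ⨆ w : ℝ,
        |DWB.bootCDF P' (g p.1) (ε p.1) (D p.1 p.2) (ξ p.1 p.2) ω w
          - DWB.panelCDF P (g p.1) (ε p.1) (D p.1 p.2) w|)
      (atTop ×ˢ atTop) (fun _ => 0) := by
  obtain ⟨C, hC⟩ := hU.summable
  obtain ⟨v, hv, hvar⟩ := hσ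
  obtain ⟨M, hM0, hM⟩ := hξ.exists_gapIndependentMultipliers
  obtain ⟨ρ, β, hρ, hβ, hβ0, hα⟩ := hξ.exists_covariance_bound
  have hc : 0 ≤ 2 * c := by linarith [hD.1]
  let X : ℕ × ℕ → ℕ → Ω → ℝ := fun p t ω =>
    DWB.pathSum (g p.1) (D p.1 p.2) t fun j => ε p.1 j ω
  let ζ : ℕ × ℕ → ℕ → Ω' → ℝ := fun p => DWB.extendMultipliers (ξ p.1 p.2)
  let w : ℕ × ℕ → ℕ → ℝ := fun p => DWB.dateWeight (D p.1 p.2)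
  obtain ⟨L, J, hJ, hS⟩ := exists_blockScheme (F := atTop ×ˢ atTop) (T := fun p : ℕ × ℕ => p.2)
    (q := fun p => DWB.gapLength (ℓ p.1 p.2) p.2) (b := fun p => Real.sqrt (2 * c / p.2))
    tendsto_snd (fun p => DWB.le_gapLength_add_one_sq _ _) hξ.tendsto_gapLength_div hc
    (fun p => Real.sqrt_nonneg _) (fun p => (Real.sq_sqrt (by positivity)).le)
  have hX : ∀ᶠ p in atTop ×ˢ atTop, CoupledProcess P (X p)
      (splicedValue (ε p.1) (εc p.1) (DWB.pathSum (g p.1) (D p.1 p.2))) (4 * C + 1) := by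
    filter_upwards [hC] with p hp
    exact hU.coupledProcess hp
  have hw : ∀ᶠ p : ℕ × ℕ in atTop ×ˢ atTop, ∀ t, |w p t| ≤ Real.sqrt (2 * c / p.2) :=
    hD.eventually_dateWeight_le
  have hpanel : ∀ p ω, DWB.panelSum (g p.1) (ε p.1) (D p.1 p.2) ω
      = ∑ t ∈ Finset.range (J p * (L p + DWB.gapLength (ℓ p.1 p.2) p.2)), w p t * X p t ω :=
    fun p ω => DWB.panelSum_eq _ _ _ ω (hJ p)
  have hboot : ∀ p ω ω', DWB.bootSum (g p.1) (ε p.1) (D p.1 p.2) (ξ p.1 p.2) ω ω'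
      = ∑ t ∈ Finset.range (J p * (L p + DWB.gapLength (ℓ p.1 p.2) p.2)),
        w p t * X p t ω * ζ p t ω' := fun p ω ω' => DWB.bootSum_eq _ _ _ _ ω ω' (hJ p)
  have hlow := hS.eventually_le_blockVariance hX hw hv (by
    filter_upwards [hvar] with p hp
    simpa only [hpanel] using hp)
  have hup := hS.eventually_blockVariance_le hX hw
  rw [tendstoInMeasure_iff_norm]
  intro τ hτ
  obtain ⟨δ₁, hδ₁, hK⟩ := exists_kolmogorov_le_of_charFun
    (C := 4 * (4 * C + 1) ^ 2 * (2 * (2 * c))) (show 0 < τ / 3 by positivity)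
    (show 0 < v / 4 by positivity)
  have hdata := hS.eventually_norm_expChar_sub_le hX hw hδ₁
  have hcond := hS.tendsto_measure_conditional (Q := P') (ξ := ζ) hX hw hM hM0 hρ hβ hβ0
    (fun p t s ht hs => hα p t s
      (not_le.1 fun h => ht (DWB.dateWeight_of_le _ h))
      (not_le.1 fun h => hs (DWB.dateWeight_of_le _ h))) hδ₁
  -- off the exceptional event both distribution functions are within `τ / 3` of the same Gaussian
  refine tendsto_of_tendsto_of_tendsto_of_le_of_le' tendsto_const_nhds hcond
    (Eventually.of_forall fun p => zero_le) ?_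
  filter_upwards [hdata, hlow, hup] with p h1 h2 h3
  refine measure_mono fun ω hω => ?_
  intro hgood
  have hm1 : ∀ t, Measurable (X p t) := fun t => hU.measurable_pathSum_innovations _ _ t
  have hm2 : ∀ t, Measurable (ζ p t) := (hM p).measurable
  set n := J p * (L p + DWB.gapLength (ℓ p.1 p.2) p.2) with hn
  have hf1 : Measurable fun ω => ∑ t ∈ Finset.range n, w p t * X p t ω := by fun_prop
  have hf2 : Measurable fun ω' => ∑ t ∈ Finset.range n, w p t * X p t ω * ζ p t ω' := by fun_prop
  have := Measure.isProbabilityMeasure_map hf1.aemeasurable (μ := P)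
  have := Measure.isProbabilityMeasure_map hf2.aemeasurable (μ := P')
  have k1 := hK (P.map _) _ h2 h3 fun x => by
    rw [charFun_map_eq_expChar hf1.aemeasurable]
    exact h1 x
  have k2 := hK (P'.map _) _ h2 h3 fun x => by
    rw [charFun_map_eq_expChar hf2.aemeasurable]
    exact hgood x
  simp_rw [measureReal_map_Iic P hf1] at k1
  simp_rw [measureReal_map_Iic P' hf2] at k2
  have hsup : ⨆ x : ℝ, |DWB.bootCDF P' (g p.1) (ε p.1) (D p.1 p.2) (ξ p.1 p.2) ω x
      - DWB.panelCDF P (g p.1) (ε p.1) (D p.1 p.2) x| ≤ 2 * (τ / 3) := by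
    refine ciSup_le fun x => ?_
    unfold DWB.bootCDF DWB.panelCDF
    simp_rw [hpanel, hboot]
    refine (abs_sub_le _ _ _).trans ((add_le_add (k2 x) ((abs_sub_comm _ _).trans_le (k1 x))).trans_eq
      (two_mul _).symm)
  have hnn : 0 ≤ ⨆ x : ℝ, |DWB.bootCDF P' (g p.1) (ε p.1) (D p.1 p.2) (ξ p.1 p.2) ω x
      - DWB.panelCDF P (g p.1) (ε p.1) (D p.1 p.2) x| := Real.iSup_nonneg fun x => abs_nonneg _
  rw [Set.mem_ofPred_eq, sub_zero, Real.norm_of_nonneg hnn] at hω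
  linarith
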